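/- **Setting.** Let $d\in\{2,3\}$, and let $\widehat T\subset\mathbb R^d$ be the open unit simplex or the open unit hypercube. Let $\Omega\subset\mathbb R^d$ be a polygonal/polyhedral open set, and let $\mathcal T_1,\dots,\mathcal T_K$ be partitions of $\Omega$: finite families of pairwise disjoint elements $T=\mathsf F_T(\widehat T)$, with $\mathsf F_T$ an invertible affine map, such that $\Omega$ is the interior of the union of the closed elements. For $k\ge 2$, $\mathcal T_k$ is obtained from $\mathcal T_{k-1}$ by uniform (red) refinement: each triangle or parallelogram is split into four congruent ones and each parallelepiped into eight congruent ones; each tetrahedron is split, through the midpoints of its edges, into four corner tetrahedra and four tetrahedra obtained by cutting the remaining octahedron along one of its diagonals. Write $h_T$ for the diameter of $T$. Assume that $\mathcal T_K$ is shape-regular (each $T\in\mathcal T_K$ contains a ball of radius $r_T>0$ with $h_T\le\kappa_1 r_T$) and quasi-uniform ($h_T\le\kappa_2 h_{T'}$ for all $T,T'\in\mathcal T_K$). Let $p_1,\dots,p_K\geq 1$ be integers with $p_{k-1}\le p_k\le c\,p_{k-1}$, and let $$V_k=\{v\in L^2(\Omega): v\circ\mathsf F_T\in\mathbb M^{p_k}(\widehat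 T)\ \ \forall T\in\mathcal T_k\},$$ where $\mathbb M^{p}(\widehat T)$ is the space of polynomials of total degree at most $p$ if $\widehat T$ is the simplex, and of degree at most $p$ in each variable if $\widehat T$ is the hypercube. An interior face of $\mathcal T_k$ is the intersection of the closures of two different elements, and a boundary face is the intersection of a facet of an element with $\partial\Omega$, in both cases of positive $(d-1)$-dimensional measure; let $\mathcal F_k$ be the set of all faces and $\mathcal F_k^I$ that of the interior ones. On an interior face between $T^+$ and $T^-$, with outward unit normals $\mathbf n^\pm$, put $[\![v]\!]=v^+\mathbf n^++v^-\mathbf n^-$, $[\![\boldsymbol\eta]\!]=\boldsymbol\eta^+\cdot\mathbf n^++\boldsymbol\eta^-\cdot\mathbf n^-$ and $\{\boldsymbol\eta\}=\tfrac12(\boldsymbol\eta^++\boldsymbol\eta^-)$; on a boundary face of $T$ put $[\![v]\!]=v\,\mathbf n_T$ and $\{\boldsymbol\eta\}=\boldsymbol\eta$. The liftings $r_F(\boldsymbol\tau)\in[V_k]^d$ ($F\in\mathcal F_k$) and $l_F(q)\in[V_k]^d$ ($F\in\mathcal F_k^I$) are defined by $$\int_\Omega r_F(\boldsymbol\tau)\cdot\boldsymbol\eta\,dx=-\int_F\boldsymbol\tau\cdot\{\boldsymbol\eta\}\,ds,\qquad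 \int_\Omega l_F(q)\cdot\boldsymbol\eta\,dx=-\int_F q\,[\![\boldsymbol\eta]\!]\,ds\qquad\forall\boldsymbol\eta\in[V_k]^d .$$ Put $\mathcal R_k(\boldsymbol\tau)=\sum_{F\in\mathcal F_k}r_F(\boldsymbol\tau)$, $\mathcal L_k(q)=\sum_{F\in\mathcal F_k^I}l_F(q)$ and $\boldsymbol\Lambda_k(v)=\mathcal R_k([\![v]\!])+\mathcal L_k(\boldsymbol\beta_k\cdot[\![v]\!])$, and for $w,v\in V_k$ $$\mathcal A_k(w,v)=\sum_{T\in\mathcal T_k}\int_T\big(\nabla w\cdot\nabla v+\nabla w\cdot\boldsymbol\Lambda_k(v)+\boldsymbol\Lambda_k(w)\cdot\nabla v\big)dx+\sum_{F\in\mathcal F_k}\int_F\sigma_k[\![w]\!]\cdot[\![v]\!]\,ds+\theta\int_\Omega\boldsymbol\Lambda_k(w)\cdot\boldsymbol\Lambda_k(v)\,dx,$$ where $\sigma_k|_F=\alpha_kp_k^2/\min(h_{T^+},h_{T^-})$ on interior faces, $\sigma_k|_F=\alpha_kp_k^2/h_T$ on boundary faces, and $0<\alpha_{\min}\le\alpha_k\le\alpha_{\max}$.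 The method is one of the following: SIPG ($\theta=0$, $\boldsymbol\beta_k=0$); SIPG($\delta$) ($\theta=0$, $\boldsymbol\beta_k|_F=(\delta_F-\tfrac12)\mathbf n_F$ on each interior face, with $\delta_F\in[0,1]$ and $\mathbf n_F$ the normal pointing out of one of the two adjacent elements); LDG ($\theta=1$, $|\boldsymbol\beta_k|_F|\le B$ on each interior face). The energy norm on $V_k$ is $|||v|||_{1,k}=\sqrt{\mathcal A_k(v,v)}$. **Lemma 4.4.** There is a constant $\alpha_0>0$, depending only on $d$, $\widehat T$, the method, $\kappa_1$, $\kappa_2$, $B$, such that the following holds for every $\alpha_{\min}>0$, where for SIPG and SIPG($\delta$) it is also assumed that $\alpha_{\min}\ge\alpha_0$. There is a constant $C_{\mathsf{stab}}>0$, depending only on these data and on $\alpha_{\min},\alpha_{\max},c$ (in particular not on the mesh sizes, the polynomial degrees, $k$ or $K$), such that for all $\Omega$, $K$, $\mathcal T_k$, $p_k$, $\alpha_k$, $\boldsymbol\beta_k$ as above: * $\mathcal A_k(v,v)>0$ for all $0\neq v\in V_k$, $1\le k\le K$ (so the energy norms are well defined); * for $2\le k\le K$ one has $V_{k-1}\subseteq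 V_k$, and with $R_{k-1}^k:V_{k-1}\to V_k$ the inclusion there is exactly one linear operator $P_k^{k-1}:V_k\to V_{k-1}$ with $\mathcal A_{k-1}(P_k^{k-1}v,w)=\mathcal A_k(v,R_{k-1}^kw)$ for all $v\in V_k$, $w\in V_{k-1}$; moreover $$|||R_{k-1}^kv|||_{1,k}\le C_{\mathsf{stab}}|||v|||_{1,k-1}\quad\forall v\in V_{k-1},\qquad |||P_k^{k-1}v|||_{1,k-1}\le C_{\mathsf{stab}}|||v|||_{1,k}\quad\forall v\in V_k.$$ -/

import Mathlib

open MeasureTheory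
open scoped RealInnerProductSpace

noncomputable section

namespace HPDG

/-- Euclidean space `ℝᵈ`. -/
abbrev E (d : ℕ) : Type := EuclideanSpace ℝ (Fin d)

/-! ### Elements and meshes -/

/-- The two kinds of reference element. -/
inductive Shape
  | simplex
  | cube

/-- The reference element: the open unit simplex or the open unit hypercube. -/
def refElement (d : ℕ) : Shape → Set (E d)
  | .simplex => {x | (∀ i, 0 < x i) ∧ ∑ i, x i < 1}
  | .cube => {x | ∀ i, 0 < x i ∧ x i < 1}

/-- An element is given by its (invertible, affine) element map `F_T`. -/
abbrev Cell (d : ℕ) : Type := E d ≃ᵃ[ℝ] E d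

/-- The (open) element `T = F_T(T̂)`. -/
def cell {d : ℕ} (s : Shape) (T : Cell d) : Set (E d) := T '' refElement d s

/-- `𝒯` is a partition of `Ω` into elements: the elements are pairwise disjoint, and `Ω` is the
interior of the union of the closed elements (so that `Ω` is a bounded polygonal/polyhedral open
set lying on one side of its boundary). -/
structure IsPartition {d : ℕ} (s : Shape) (Ω : Set (E d)) (𝒯 : Finset (Cell d)) : Prop where
  disjoint : ∀ T ∈ 𝒯, ∀ T' ∈ 𝒯, T ≠ T' → Disjoint (cell s T) (cell s T')
  cover : Ω = interior (⋃ T ∈ 𝒯, closure (cell s T))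

/-- Shape regularity: each element contains a ball of radius `r > 0` with `h_T ≤ κ r`. -/
def IsShapeRegular {d : ℕ} (s : Shape) (κ : ℝ) (𝒯 : Finset (Cell d)) : Prop :=
  ∀ T ∈ 𝒯, ∃ (x : E d) (r : ℝ), 0 < r ∧ Metric.ball x r ⊆ cell s T ∧
    Metric.diam (cell s T) ≤ κ * r

/-- Quasi-uniformity: the diameters of any two elements are comparable. -/
def IsQuasiUniform {d : ℕ} (s : Shape) (κ : ℝ) (𝒯 : Finset (Cell d)) : Prop :=
  ∀ T ∈ 𝒯, ∀ T' ∈ 𝒯, Metric.diam (cell s T) ≤ κ * Metric.diam (cell s T')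

/-- The vertices `0, e₁, …, e_d` of the reference simplex. -/
def refVertex (d : ℕ) : Fin (d + 1) → E d :=
  Fin.cons 0 (fun i => EuclideanSpace.single i 1)

/-- Uniform (red) refinement of a triangle into four triangles and of a tetrahedron into eight
tetrahedra. Each entry describes a child: its `j`-th vertex is the midpoint of the vertices
`(c j).1` and `(c j).2` of the parent. For the tetrahedron, the first four children are the ones
at the corners, the last four split the remaining octahedron along the diagonal that joins the
midpoints of the edges `02` and `13`. -/
def redChildren : (d : ℕ) → List (Fin (d + 1) → Fin (d + 1) × Fin (d + 1))
  | 2 => [![(0, 0), (0, 1), (0, 2)],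
          ![(0, 1), (1, 1), (1, 2)],
          ![(0, 2), (1, 2), (2, 2)],
          ![(0, 1), (1, 2), (0, 2)]]
  | 3 => [![(0, 0), (0, 1), (0, 2), (0, 3)],
          ![(0, 1), (1, 1), (1, 2), (1, 3)],
          ![(0, 2), (1, 2), (2, 2), (2, 3)],
          ![(0, 3), (1, 3), (2, 3), (3, 3)],
          ![(0, 1), (0, 2), (0, 3), (1, 3)],
          ![(0, 1), (0, 2), (1, 2), (1, 3)],
          ![(0, 2), (0, 3), (1, 3), (2, 3)],
          ![(0, 2), (1, 2), (1, 3), (2, 3)]]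
  | _ => []

/-- `T'` is one of the children of `T` under uniform refinement. For simplices, `π` is the
numbering of the vertices of `T` that is used; for `d = 2` it does not affect the set of children,
for `d = 3` it selects the diagonal of the inner octahedron. Parallelograms/parallelepipeds are
split into `2 ^ d` congruent ones. -/
def IsChild {d : ℕ} (s : Shape) (π : Equiv.Perm (Fin (d + 1))) (T T' : Cell d) : Prop :=
  match s with
  | .simplex => ∃ c ∈ redChildren d, ∀ j,
      T' (refVertex d j) =
        midpoint ℝ (T (refVertex d (π (c j).1))) (T (refVertex d (π (c j).2)))
  | .cube => ∃ ε : Finset (Fin d), ∀ x,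
      T' x = T ((1 / 2 : ℝ) • (x + ∑ i ∈ ε, EuclideanSpace.single i 1))

/-- `𝒯'` is a uniform refinement of `𝒯`: its elements are exactly the children of those of `𝒯`. -/
def IsRefinement {d : ℕ} (s : Shape) (𝒯 𝒯' : Finset (Cell d)) : Prop :=
  ∃ π : Cell d → Equiv.Perm (Fin (d + 1)),
    ∀ T', T' ∈ 𝒯' ↔ ∃ T ∈ 𝒯, IsChild s (π T) T T'

/-! ### Faces -/

/-- The closed facets of the reference element. -/
def refFacets (d : ℕ) : Shape → Set (Set (E d))
  | .simplex => Set.range (fun i : Fin d => closure (refElement d .simplex) ∩ {x | x i = 0}) ∪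
      {closure (refElement d .simplex) ∩ {x | ∑ i, x i = 1}}
  | .cube => Set.range (fun i : Fin d => closure (refElement d .cube) ∩ {x | x i = 0}) ∪
      Set.range (fun i : Fin d => closure (refElement d .cube) ∩ {x | x i = 1})

theorem refFacets_finite (d : ℕ) (s : Shape) : (refFacets d s).Finite := by
  cases s
  · exact (Set.finite_range _).union (Set.finite_singleton _)
  · exact (Set.finite_range _).union (Set.finite_range _)

/-- Surface measure (`(d-1)`-dimensional Hausdorff measure, normalised as Lebesgue measure on
hyperplanes). -/
def surface (d : ℕ) : Measure (E d) := Measure.euclideanHausdorffMeasure (d - 1)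

/-- A face, together with the elements adjacent to it: two for an interior face, one for a
boundary face. -/
structure Face (d : ℕ) where
  cells : Finset (Cell d)
  carrier : Set (E d)

open Classical in
/-- Interior faces: the intersections of the closures of two neighbouring elements. -/
def interiorFaces {d : ℕ} (s : Shape) (𝒯 : Finset (Cell d)) : Finset (Face d) :=
  ((𝒯.powersetCard 2).image
    (fun c => (⟨c, ⋂ T ∈ c, closure (cell s T)⟩ : Face d))).filter
      (fun f => 0 < surface d f.carrier)

open Classical in
/-- Boundary faces: the parts of the facets of the elements that lie on `∂Ω`. -/
def boundaryFaces {d : ℕ} (s : Shape) (Ω : Set (E d)) (𝒯 : Finset (Cell d)) :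
    Finset (Face d) :=
  ((𝒯 ×ˢ (refFacets_finite d s).toFinset).image
    (fun a => (⟨{a.1}, a.1 '' a.2 ∩ frontier Ω⟩ : Face d))).filter
      (fun f => 0 < surface d f.carrier)

open Classical in
/-- All faces. -/
def faces {d : ℕ} (s : Shape) (Ω : Set (E d)) (𝒯 : Finset (Cell d)) : Finset (Face d) :=
  interiorFaces s 𝒯 ∪ boundaryFaces s Ω 𝒯

/-- The outward unit normal of the element `T` on the face `f`, i.e. the unit vector `n` such that
`T` lies in the half-space `⟪n, y - x⟫ ≤ 0` for every `x` in the face. (It exists, and since the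
face has positive surface measure it is unique, for each face `f` of `T`.) -/
def normal {d : ℕ} (s : Shape) (T : Cell d) (f : Face d) : E d :=
  Classical.epsilon (fun n : E d =>
    ‖n‖ = 1 ∧ ∀ x ∈ f.carrier, ∀ y ∈ cell s T, ⟪n, y - x⟫ ≤ 0)

/-! ### Discontinuous Galerkin spaces and forms -/

/-- `𝕄ᵖ(T̂)`: polynomials of total degree at most `p` on the simplex, and of degree at most `p` in
each variable on the hypercube. -/
def refPoly (d : ℕ) : Shape → ℕ → Submodule ℝ (MvPolynomial (Fin d) ℝ)
  | .simplex, p => MvPolynomial.restrictTotalDegree (Fin d) ℝ p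
  | .cube, p => MvPolynomial.restrictDegree (Fin d) ℝ p

/-- The data of one level of a DG method on `Ω`: the shape of the elements, the mesh, the degree,
the penalty parameter `α`, the parameter `θ`, and the vectors `β` on the interior faces. -/
structure Level (d : ℕ) (Ω : Set (E d)) where
  shape : Shape
  mesh : Finset (Cell d)
  degree : ℕ
  α : ℝ
  θ : ℝ
  β : Face d → E d

namespace Level

variable {d : ℕ} {Ω : Set (E d)} (D : Level d Ω)

/-- The function `P ∘ F_T⁻¹` for a polynomial `P` on the reference element. -/
def pushPoly (T : Cell d) (P : MvPolynomial (Fin d) ℝ) (x : E d) : ℝ :=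
  MvPolynomial.eval (fun i => T.symm x i) P

theorem pushPoly_add (T : Cell d) (P Q : MvPolynomial (Fin d) ℝ) (x : E d) :
    pushPoly T (P + Q) x = pushPoly T P x + pushPoly T Q x := by
  simp [pushPoly]

theorem pushPoly_smul (T : Cell d) (a : ℝ) (P : MvPolynomial (Fin d) ℝ) (x : E d) :
    pushPoly T (a • P) x = a * pushPoly T P x := by
  simp [pushPoly, MvPolynomial.smul_eval]

/-- The space `V = {v ∈ L²(Ω) : v ∘ F_T ∈ 𝕄ᵖ(T̂) for all T ∈ 𝒯}`. -/
def V : Submodule ℝ (Lp ℝ 2 (volume.restrict Ω)) where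
  carrier := {v | ∀ T ∈ D.mesh, ∃ P ∈ refPoly d D.shape D.degree,
    ∀ᵐ x ∂(volume.restrict Ω), x ∈ cell D.shape T → v x = pushPoly T P x}
  zero_mem' := fun T _ => ⟨0, Submodule.zero_mem _, by
    filter_upwards [Lp.coeFn_zero ℝ 2 (volume.restrict Ω)] with x hx _
    exact hx.trans (by simp [pushPoly])⟩
  add_mem' := by
    intro v w hv hw T hT
    obtain ⟨P, hP, hvP⟩ := hv T hT
    obtain ⟨Q, hQ, hwQ⟩ := hw T hT
    refine ⟨P + Q, Submodule.add_mem _ hP hQ, ?_⟩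
    filter_upwards [hvP, hwQ, Lp.coeFn_add v w] with x h1 h2 h3 hx
    rw [h3, Pi.add_apply, h1 hx, h2 hx, pushPoly_add]
  smul_mem' := by
    intro a v hv T hT
    obtain ⟨P, hP, hvP⟩ := hv T hT
    refine ⟨a • P, Submodule.smul_mem _ a hP, ?_⟩
    filter_upwards [hvP, Lp.coeFn_smul a v] with x h1 h3 hx
    rw [h3, Pi.smul_apply, h1 hx, pushPoly_smul, smul_eq_mul]

open Classical in
/-- `v|_T`, as the polynomial function on `ℝᵈ` that agrees with `v` almost everywhere on `T`. Its
values on `∂T` are the traces of `v` taken from within `T`. -/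
def on (v : D.V) (T : Cell d) : E d → ℝ :=
  if h : T ∈ D.mesh then pushPoly T (v.2 T h).choose else 0

/-- The jump `⟦v⟧ = v⁺ n⁺ + v⁻ n⁻` on an interior face, `⟦v⟧ = v n` on a boundary face. -/
def jump (v : D.V) (f : Face d) (x : E d) : E d :=
  ∑ T ∈ f.cells, D.on v T x • normal D.shape T f

/-- The restriction to `T` of a vector-valued function `η ∈ [V]ᵈ`. -/
def vecOn (η : Fin d → D.V) (T : Cell d) (x : E d) : E d :=
  WithLp.toLp 2 (fun i => D.on (η i) T x)

/-- The jump `⟦η⟧ = η⁺ · n⁺ + η⁻ · n⁻` of a vector-valued function on an interior face. -/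
def vecJump (η : Fin d → D.V) (f : Face d) (x : E d) : ℝ :=
  ∑ T ∈ f.cells, ⟪D.vecOn η T x, normal D.shape T f⟫

/-- The average `{η} = (η⁺ + η⁻) / 2` on an interior face, `{η} = η` on a boundary face. -/
def vecAvg (η : Fin d → D.V) (f : Face d) (x : E d) : E d :=
  (f.cells.card : ℝ)⁻¹ • ∑ T ∈ f.cells, D.vecOn η T x

/-- The local lifting `r_F(τ) ∈ [V]ᵈ`: `∫_Ω r_F(τ) · η = - ∫_F τ · {η}` for all `η ∈ [V]ᵈ`. -/
def liftR (f : Face d) (τ : E d → E d) : Fin d → D.V :=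
  Classical.epsilon (fun r : Fin d → D.V => ∀ η : Fin d → D.V,
    ∫ x in Ω, ∑ i, (r i).1 x * (η i).1 x =
      -∫ x in f.carrier, ⟪τ x, D.vecAvg η f x⟫ ∂(surface d))

/-- The local lifting `l_F(q) ∈ [V]ᵈ`: `∫_Ω l_F(q) · η = - ∫_F q ⟦η⟧` for all `η ∈ [V]ᵈ`. -/
def liftL (f : Face d) (q : E d → ℝ) : Fin d → D.V :=
  Classical.epsilon (fun r : Fin d → D.V => ∀ η : Fin d → D.V,
    ∫ x in Ω, ∑ i, (r i).1 x * (η i).1 x =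
      -∫ x in f.carrier, q x * D.vecJump η f x ∂(surface d))

/-- `ℛ(⟦v⟧) + ℒ(β · ⟦v⟧)`, where `ℛ` is the sum of the `r_F` over all faces and `ℒ` is the sum of
the `l_F` over the interior faces. -/
def lift (v : D.V) : Fin d → D.V :=
  (∑ f ∈ faces D.shape Ω D.mesh, D.liftR f (D.jump v f)) +
    (∑ f ∈ interiorFaces D.shape D.mesh, D.liftL f (fun x => ⟪D.β f, D.jump v f x⟫))

/-- `ℛ(⟦v⟧) + ℒ(β · ⟦v⟧)` as a vector field. -/
def liftFn (v : D.V) (x : E d) : E d :=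
  WithLp.toLp 2 (fun i => (D.lift v i).1 x)

/-- The penalty `σ|_F = α p² / min(h_{T⁺}, h_{T⁻})`, resp. `α p² / h_T` on the boundary. -/
def σ (f : Face d) : ℝ :=
  D.α * (D.degree : ℝ) ^ 2 / ⨅ T : {T // T ∈ f.cells}, Metric.diam (cell D.shape T.1)

/-- The DG bilinear form `𝒜(w, v)`. -/
def form (w v : D.V) : ℝ :=
  (∑ T ∈ D.mesh, (∫ x in cell D.shape T, ⟪gradient (D.on w T) x, gradient (D.on v T) x⟫)) +
  (∑ T ∈ D.mesh, (∫ x in cell D.shape T, ⟪gradient (D.on w T) x, D.liftFn v x⟫)) +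
  (∑ T ∈ D.mesh, (∫ x in cell D.shape T, ⟪D.liftFn w x, gradient (D.on v T) x⟫)) +
  (∑ f ∈ faces D.shape Ω D.mesh,
    (∫ x in f.carrier, D.σ f * ⟪D.jump w f x, D.jump v f x⟫ ∂(surface d))) +
  D.θ * (∫ x in Ω, ⟪D.liftFn w x, D.liftFn v x⟫)

/-- The energy norm `|||v|||₁ = √(A v, v) = √𝒜(v, v)`. -/
def energyNorm (v : D.V) : ℝ := Real.sqrt (D.form v v)

end Level

/-! ### The methods -/

/-- The symmetric interior penalty method, its version with weighted averages, and the local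
discontinuous Galerkin method. -/
inductive Method
  | sipg
  | sipgDelta
  | ldg

/-- `θ = 0` for SIPG and SIPG(δ), and `θ = 1` for LDG. -/
def Method.θ : Method → ℝ
  | .sipg => 0
  | .sipgDelta => 0
  | .ldg => 1

/-- The vectors `β` of the method: `β = 0` for SIPG; `β = (δ - 1/2) n_F` with a weight
`δ ∈ [0,1]`, where `n_F` is the normal to the face pointing out of one of the two elements
adjacent to it, for SIPG(δ); a bounded `β` for LDG. -/
def Method.IsBeta {d : ℕ} (m : Method) (B : ℝ) (s : Shape) (𝒯 : Finset (Cell d))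
    (β : Face d → E d) : Prop :=
  match m with
  | .sipg => ∀ f ∈ interiorFaces s 𝒯, β f = 0
  | .sipgDelta => ∀ f ∈ interiorFaces s 𝒯, ∃ T ∈ f.cells, ∃ δ : ℝ, 0 ≤ δ ∧ δ ≤ 1 ∧
      β f = (δ - 1 / 2) • normal s T f
  | .ldg => ∀ f ∈ interiorFaces s 𝒯, ‖β f‖ ≤ B

end HPDG

end

noncomputable section

namespace HPDG

/-! ### A univariate endpoint inequality -/

/-! The energy norm is compared with the DG norm, whose square is G + J, where G is the sum of the
squared L² norms of the broken gradient and J is the sum of the penalised squared jumps. On one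
level both norms are equivalent, uniformly in the mesh size and the degree. The inclusion of the
coarse space into the fine one is then shown to be bounded in the DG norm, and the bound for the
adjoint operator follows by duality.

Norm equivalence rests on the lifting bound `volForm_liftOn_le`: the squared L² norm of Λ(v) is at
most a constant times the sum over the faces of (p²/h) ∫_F |⟦v⟧|². Testing the lifting with itself
and applying Young's inequality reduces this to the trace inverse inequality
`IsFacet.integral_sq_le`, in which the power p² must be sharp. That inequality comes from joining
the centre of an inscribed ball to the points of the face and using, on each segment, the univariate
estimate q(1)² ≤ 16 (n+1)² ∫_{1/2}^1 q² for deg q ≤ n. The univariate estimate is obtained from an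
expansion in Chebyshev polynomials of the second kind.

With L the squared norm of the lifting, the form on the diagonal is G + 2(∇v, Λ(v)) + J + θL. For θ
= 0 a large penalty makes L at most J/4 and the mixed term is absorbed. For θ = 1 the term L itself
absorbs most of the mixed term, so every positive penalty suffices (`le_form`). If G = J = 0, then v
is piecewise constant without jumps. Were it nonzero, the union of the closed elements on which it
takes one fixed nonzero value would have a boundary of zero surface measure, which is impossible for
a bounded set with interior points (`eq_zero_of_grad_jump`).

For two consecutive levels, the corner child of an element is a copy of it scaled by 1/2. Hence
shape regularity and quasi-uniformity pass from the finest mesh to all coarser ones with the same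
constants. A coarse function has no jump across a fine face inside a coarse element, and the
remaining fine faces are covered by coarse faces up to null sets. The weights p²/h change by a
bounded factor, and all multiplicities are bounded by a packing argument
(`IsNested.volForm_grad_le`, `IsNested.jumpSum_le`). The adjoint exists because the coarse form is
positive definite on a finite dimensional space. Cauchy–Schwarz in |||Pv|||² = 𝒜_k(v, R P v)
transfers the bound from R to P (`sqrt_adjoint_le`). -/

theorem integral_sin_mul_sin (i j : ℕ) :
    ∫ θ in (0 : ℝ)..Real.pi, Real.sin ((i + 1) * θ) * Real.sin ((j + 1) * θ) =
      if i = j then Real.pi / 2 else 0 := by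
  have hcos : ∀ k : ℤ, ∫ θ in (0 : ℝ)..Real.pi, Real.cos (k * θ) =
      if k = 0 then Real.pi else 0 := by
    intro k
    split_ifs with h
    · simp [h]
    · have hk : (k : ℝ) ≠ 0 := by exact_mod_cast h
      rw [intervalIntegral.integral_comp_mul_left (fun x => Real.cos x) hk]
      simp [Real.sin_int_mul_pi]
  have h : ∀ θ : ℝ, Real.sin ((i + 1) * θ) * Real.sin ((j + 1) * θ) =
      (1 / 2) * Real.cos (((i - j : ℤ) : ℝ) * θ) -
        (1 / 2) * Real.cos (((i + j + 2 : ℤ) : ℝ) * θ) := by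
    intro θ
    have e1 : (((i - j : ℤ) : ℝ) * θ) = (i + 1) * θ - (j + 1) * θ := by push_cast; ring
    have e2 : (((i + j + 2 : ℤ) : ℝ) * θ) = (i + 1) * θ + (j + 1) * θ := by push_cast; ring
    rw [e1, e2, Real.cos_sub, Real.cos_add]
    ring
  simp_rw [h]
  rw [intervalIntegral.integral_sub (by apply Continuous.intervalIntegrable; fun_prop)
    (by apply Continuous.intervalIntegrable; fun_prop),
    intervalIntegral.integral_const_mul, intervalIntegral.integral_const_mul, hcos, hcos]
  have h2 : ¬ ((i : ℤ) + j + 2 = 0) := by omega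
  rw [if_neg h2]
  by_cases hij : i = j
  · subst hij; simp; ring
  · have : ¬ ((i : ℤ) - j = 0) := by omega
    rw [if_neg this, if_neg hij]; simp

open Polynomial in
/-- Point evaluation at `1` through the expansion in Chebyshev polynomials of the second kind. -/
theorem eval_one_eq_sum_integral (M : ℕ) : ∀ m ≤ M, ∀ Q : ℝ[X], Q.natDegree ≤ m →
    Q.eval 1 = ∑ j ∈ Finset.range (M + 1), ((j : ℝ) + 1) * (2 / Real.pi) *
      ∫ θ in (0 : ℝ)..Real.pi, Q.eval (Real.cos θ) * Real.sin θ * Real.sin ((j + 1) * θ) := by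
  -- Since U_m(cos θ) sin θ = sin((m+1)θ), orthogonality of the sines leaves only the term j = m,
  -- and (m+1)(2/π)(π/2) = m+1 = U_m(1).
  have hU : ∀ m ≤ M, ∀ c : ℝ, ((C c * Chebyshev.U ℝ (m : ℤ)).eval 1 : ℝ) =
      ∑ j ∈ Finset.range (M + 1), ((j : ℝ) + 1) * (2 / Real.pi) *
      ∫ θ in (0 : ℝ)..Real.pi, (C c * Chebyshev.U ℝ (m : ℤ)).eval (Real.cos θ) * Real.sin θ *
        Real.sin ((j + 1) * θ) := by
    intro m hm c
    have h : ∀ j : ℕ, ∫ θ in (0 : ℝ)..Real.pi, (C c * Chebyshev.U ℝ (m : ℤ)).eval (Real.cos θ) *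
        Real.sin θ * Real.sin ((j + 1) * θ) = c * if m = j then Real.pi / 2 else 0 := by
      intro j
      rw [← integral_sin_mul_sin, ← intervalIntegral.integral_const_mul]
      congr 1
      ext θ
      have := Chebyshev.U_real_cos θ m
      rw [eval_mul, eval_C, mul_assoc c, this]
      push_cast
      ring
    simp_rw [h]
    rw [Finset.sum_eq_single m]
    · have := Real.pi_pos.ne'
      rw [eval_mul, eval_C, Chebyshev.U_eval_one, if_pos rfl]
      push_cast
      field_simp
    · intro j _ hj; rw [if_neg (Ne.symm hj)]; simp
    · intro h; exact absurd (Finset.mem_range.2 (by omega)) h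
  have hadd : ∀ P Q : ℝ[X],
      ∑ j ∈ Finset.range (M + 1), ((j : ℝ) + 1) * (2 / Real.pi) *
        ∫ θ in (0 : ℝ)..Real.pi, (P + Q).eval (Real.cos θ) * Real.sin θ * Real.sin ((j + 1) * θ) =
      (∑ j ∈ Finset.range (M + 1), ((j : ℝ) + 1) * (2 / Real.pi) *
        ∫ θ in (0 : ℝ)..Real.pi, P.eval (Real.cos θ) * Real.sin θ * Real.sin ((j + 1) * θ)) +
      ∑ j ∈ Finset.range (M + 1), ((j : ℝ) + 1) * (2 / Real.pi) *
        ∫ θ in (0 : ℝ)..Real.pi, Q.eval (Real.cos θ) * Real.sin θ * Real.sin ((j + 1) * θ) := by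
    intro P Q
    rw [← Finset.sum_add_distrib]
    refine Finset.sum_congr rfl fun j _ => ?_
    rw [← mul_add, ← intervalIntegral.integral_add
      (by apply Continuous.intervalIntegrable; fun_prop)
      (by apply Continuous.intervalIntegrable; fun_prop)]
    simp only [eval_add, add_mul]
  intro m
  induction m with
  | zero =>
    intro hm Q hQ
    replace hQ : Q = C (Q.coeff 0) := eq_C_of_natDegree_le_zero hQ
    have := hU 0 hm (Q.coeff 0)
    simp only [Nat.cast_zero, Chebyshev.U_zero, mul_one] at this
    rw [← hQ] at this
    exact this
  | succ m ih =>
    intro hm Q hQ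
    set U := Chebyshev.U ℝ ((m + 1 : ℕ) : ℤ) with hUdef
    have hl : U.coeff (m + 1) ≠ 0 := by
      have h1 : U.natDegree = m + 1 := Chebyshev.natDegree_U_natCast ℝ (m + 1)
      have h2 : U.leadingCoeff ≠ 0 := by
        rw [hUdef, Chebyshev.leadingCoeff_U_natCast]; positivity
      rwa [leadingCoeff, h1] at h2
    -- Subtracting this multiple of U removes the leading coefficient and lowers the degree.
    set c := Q.coeff (m + 1) / U.coeff (m + 1) with hc
    have hdeg : (Q - C c * U).natDegree ≤ m := by
      rw [natDegree_le_iff_coeff_eq_zero]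
      intro k hk
      rcases Nat.eq_or_lt_of_le (Nat.succ_le_of_lt hk) with h | h
      · subst h
        simp [hc, hl]
      · have h1 : Q.coeff k = 0 := coeff_eq_zero_of_natDegree_lt (by omega)
        have h2 : U.coeff k = 0 := by
          apply coeff_eq_zero_of_natDegree_lt
          rw [hUdef, Chebyshev.natDegree_U_natCast]; omega
        simp [h1, h2]
    have e : Q = (Q - C c * U) + C c * U := by ring
    rw [e, hadd, eval_add, ih (by omega) _ hdeg, hU (m + 1) hm c]

open Polynomial in
-- In the Chebyshev expansion of Q(1), nonnegativity of Q(cos θ) sin θ allows sin((j+1)θ) to be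
-- replaced by 1, which leaves the integral of Q over [-1,1]. The m+1 terms are then at most m+1
-- times this integral each.
theorem eval_one_le_integral {m : ℕ} {Q : ℝ[X]} (hQ : Q.natDegree ≤ m)
    (hpos : ∀ t, 0 ≤ Q.eval t) :
    Q.eval 1 ≤ (m + 1) ^ 2 * ∫ t in (-1 : ℝ)..1, Q.eval t := by
  set I := ∫ t in (-1 : ℝ)..1, Q.eval t with hI
  have hI0 : 0 ≤ I := intervalIntegral.integral_nonneg (by norm_num) fun t _ => hpos t
  have hsub : ∫ θ in (0 : ℝ)..Real.pi, Q.eval (Real.cos θ) * Real.sin θ = I := by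
    have := intervalIntegral.integral_comp_mul_deriv (a := 0) (b := Real.pi)
      (f := Real.cos) (f' := fun x => -Real.sin x) (g := fun t => Q.eval t)
      (fun x _ => Real.hasDerivAt_cos x) (by fun_prop) (by fun_prop)
    simp only [Function.comp_apply, mul_neg, intervalIntegral.integral_neg, Real.cos_zero,
      Real.cos_pi] at this
    rw [hI, intervalIntegral.integral_symm 1 (-1), ← this, neg_neg]
  rw [eval_one_eq_sum_integral m m le_rfl Q hQ]
  have hterm : ∀ j ∈ Finset.range (m + 1), ((j : ℝ) + 1) * (2 / Real.pi) *
      ∫ θ in (0 : ℝ)..Real.pi, Q.eval (Real.cos θ) * Real.sin θ * Real.sin ((j + 1) * θ) ≤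
      (m + 1) * I := by
    intro j hj
    have hj' : (j : ℝ) + 1 ≤ m + 1 := by
      have := Finset.mem_range.1 hj
      have : (j : ℝ) ≤ m := by exact_mod_cast (by omega : j ≤ m)
      linarith
    have h1 : ∫ θ in (0 : ℝ)..Real.pi, Q.eval (Real.cos θ) * Real.sin θ * Real.sin ((j + 1) * θ)
        ≤ I := by
      rw [← hsub]
      refine intervalIntegral.integral_mono_on Real.pi_pos.le
        (by apply Continuous.intervalIntegrable; fun_prop)
        (by apply Continuous.intervalIntegrable; fun_prop) fun θ hθ => ?_
      exact mul_le_of_le_one_right (mul_nonneg (hpos _) (Real.sin_nonneg_of_mem_Icc hθ))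
        (Real.sin_le_one _)
    have h2 : 2 / Real.pi ≤ 1 := by
      rw [div_le_one Real.pi_pos]; exact Real.two_le_pi
    have h3 : 0 ≤ 2 / Real.pi := by positivity
    calc _ ≤ ((j : ℝ) + 1) * (2 / Real.pi) * I := by gcongr
      _ ≤ (m + 1) * 1 * I := by gcongr
      _ = _ := by ring
  refine (Finset.sum_le_sum hterm).trans ?_
  simp only [Finset.sum_const, Finset.card_range, nsmul_eq_mul]
  push_cast
  nlinarith

open Polynomial in
-- The affine map L takes [-1,1] onto [1/2,1] and fixes 1. The previous bound for the square of q ∘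
-- L, of degree at most 2n, gives the factor 4(2n+1)² ≤ 16(n+1)².
theorem sq_eval_one_le_integral {n : ℕ} {q : ℝ[X]} (hq : q.natDegree ≤ n) :
    q.eval 1 ^ 2 ≤ 16 * (n + 1) ^ 2 * ∫ t in (1 / 2 : ℝ)..1, q.eval t ^ 2 := by
  set L : ℝ[X] := C (1 / 4) * X + C (3 / 4) with hL
  have hLd : L.natDegree ≤ 1 := natDegree_linear_le
  have hd : ((q.comp L) ^ 2).natDegree ≤ 2 * n := by
    refine natDegree_pow_le.trans ?_
    have : (q.comp L).natDegree ≤ n * 1 := natDegree_comp_le.trans (Nat.mul_le_mul hq hLd)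
    omega
  have hev : ∀ t, ((q.comp L) ^ 2).eval t = q.eval (1 / 4 * t + 3 / 4) ^ 2 := by
    intro t; simp [hL]
  have h := eval_one_le_integral hd (fun t => by rw [hev]; positivity)
  simp_rw [hev] at h
  rw [intervalIntegral.integral_comp_mul_add (fun t => q.eval t ^ 2) (by norm_num : (1 / 4 : ℝ) ≠ 0)
    (3 / 4)] at h
  norm_num at h
  have hI0 : 0 ≤ ∫ t in (1 / 2 : ℝ)..1, q.eval t ^ 2 :=
    intervalIntegral.integral_nonneg (by norm_num) fun t _ => by positivity
  have hn : (0 : ℝ) ≤ n := Nat.cast_nonneg n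
  norm_num at hI0 ⊢
  nlinarith

/-! ### The trace inverse inequality -/

/-- Slicing a set by the hyperplanes through the points `x₀ + t δ n`. -/
theorem lintegral_surface_slice_le {d : ℕ} {n x₀ : E d} (hn : ‖n‖ = 1) {δ : ℝ} (hδ : 0 < δ)
    {F A : Set (E d)} (hA : MeasurableSet A) (hF : ∀ z ∈ F, ⟪n, z - x₀⟫ = δ)
    (S : ℝ → Set (E d))
    (hS : ∀ t ∈ Set.Ioc (1 / 2 : ℝ) 1, S t ⊆ F ∧ ∀ z ∈ S t, x₀ + t • (z - x₀) ∈ A) :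
    ∫⁻ t in Set.Ioc (1 / 2 : ℝ) 1, surface d (S t) ≤
      ENNReal.ofReal (2 ^ (d - 1) / δ) * volume A := by
  set v : E d := δ • n with hv
  have hvn : ‖v‖ = δ := by rw [hv, norm_smul, hn, mul_one, Real.norm_of_nonneg hδ.le]
  have hv0 : v ≠ 0 := by rw [← norm_pos_iff, hvn]; exact hδ
  -- Fubini for the parallel hyperplanes through x₀ + t v, with the factor ‖v‖ = δ.
  have key := EuclideanGeometry.euclideanHausdorffMeasure_eq_lintegral x₀ hv0 hA
  rw [finrank_euclideanSpace_fin, EuclideanSpace.euclideanHausdorffMeasure_eq_volume] at key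
  -- The homothety with centre x₀ and ratio t carries S t into the slice at height t and multiplies
  -- surface measure by t^(d-1). Keeping away from the apex, t > 1/2, bounds the inverse of this
  -- factor by 2^(d-1).
  have hslice : ∀ t ∈ Set.Ioc (1 / 2 : ℝ) 1, surface d (S t) ≤ ENNReal.ofReal (2 ^ (d - 1)) *
      surface d (A ∩ AffineSubspace.mk' (t • v +ᵥ x₀) (ℝ ∙ v)ᗮ) := by
    intro t ht
    have ht0 : 0 < t := by linarith [ht.1]
    have himg : AffineMap.homothety x₀ t '' S t ⊆
        A ∩ AffineSubspace.mk' (t • v +ᵥ x₀) (ℝ ∙ v)ᗮ := by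
      rintro _ ⟨z, hz, rfl⟩
      have e : AffineMap.homothety x₀ t z = x₀ + t • (z - x₀) := by
        simp [AffineMap.homothety_apply, add_comm]
      refine ⟨e ▸ (hS t ht).2 z hz, ?_⟩
      rw [SetLike.mem_coe, AffineSubspace.mem_mk', Submodule.mem_orthogonal_singleton_iff_inner_right,
        e]
      have hz' := hF z ((hS t ht).1 hz)
      have e2 : x₀ + t • (z - x₀) -ᵥ (t • v +ᵥ x₀) = t • ((z - x₀) - v) := by
        simp only [vsub_eq_sub, vadd_eq_add, smul_sub]; abel
      rw [e2, hv, inner_smul_left, inner_smul_right, inner_sub_right, inner_smul_right, hz',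
        real_inner_self_eq_norm_sq, hn]
      simp
    have hm := euclideanHausdorffMeasure_homothety_image (d - 1) x₀ ht0.ne' (S t)
    have h1 : surface d (S t) = ENNReal.ofReal ((t ^ (d - 1))⁻¹) *
        surface d (AffineMap.homothety x₀ t '' S t) := by
      have e3 : ((‖t‖₊ ^ (d - 1) : NNReal) : ENNReal) = ENNReal.ofReal (t ^ (d - 1)) := by
        rw [ENNReal.ofReal, ENNReal.coe_inj]
        ext
        rw [Real.coe_toNNReal _ (by positivity)]
        simp [abs_of_pos ht0]
      rw [surface, hm, ENNReal.smul_def, smul_eq_mul, e3, ← mul_assoc,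
        ← ENNReal.ofReal_mul (by positivity), inv_mul_cancel₀ (by positivity)]
      simp
    rw [h1]
    refine mul_le_mul' (ENNReal.ofReal_le_ofReal ?_) (measure_mono himg)
    rw [← inv_pow]
    refine pow_le_pow_left₀ (by positivity) ?_ _
    rw [inv_le_comm₀ ht0 (by norm_num)]
    linarith [ht.1]
  calc ∫⁻ t in Set.Ioc (1 / 2 : ℝ) 1, surface d (S t)
      ≤ ∫⁻ t in Set.Ioc (1 / 2 : ℝ) 1, ENNReal.ofReal (2 ^ (d - 1)) *
          surface d (A ∩ AffineSubspace.mk' (t • v +ᵥ x₀) (ℝ ∙ v)ᗮ) :=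
        setLIntegral_mono' measurableSet_Ioc hslice
    _ ≤ ∫⁻ t : ℝ, ENNReal.ofReal (2 ^ (d - 1)) *
          surface d (A ∩ AffineSubspace.mk' (t • v +ᵥ x₀) (ℝ ∙ v)ᗮ) :=
        setLIntegral_le_lintegral _ _
    _ = ENNReal.ofReal (2 ^ (d - 1)) *
          ∫⁻ t : ℝ, surface d (A ∩ AffineSubspace.mk' (t • v +ᵥ x₀) (ℝ ∙ v)ᗮ) := by
        rw [lintegral_const_mul' _ _ ENNReal.ofReal_ne_top]
    _ = ENNReal.ofReal (2 ^ (d - 1) / δ) * volume A := by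
        rw [key, ← ofReal_norm, hvn, ← mul_assoc, ← ENNReal.ofReal_mul (by positivity),
          div_mul_cancel₀ _ hδ.ne']
        rfl

/-- A flat face `F` of the convex open set `T` with outward unit normal `n`. -/
structure IsFacet {d : ℕ} (T F : Set (E d)) (n : E d) : Prop where
  subset : F ⊆ closure T
  norm : ‖n‖ = 1
  inner_le : ∀ x ∈ F, ∀ y ∈ T, ⟪n, y - x⟫ ≤ 0

theorem IsFacet.inner_le_closure {d : ℕ} {T F : Set (E d)} {n : E d} (h : IsFacet T F n)
    {x y : E d} (hx : x ∈ F) (hy : y ∈ closure T) : ⟪n, y - x⟫ ≤ 0 := by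
  have hc : IsClosed {y : E d | ⟪n, y - x⟫ ≤ 0} :=
    isClosed_le (by fun_prop) continuous_const
  exact (hc.closure_subset_iff.2 fun y hy => h.inner_le x hx y hy) hy

theorem IsFacet.inner_eq_zero {d : ℕ} {T F : Set (E d)} {n : E d} (h : IsFacet T F n)
    {x y : E d} (hx : x ∈ F) (hy : y ∈ F) : ⟪n, y - x⟫ = 0 := by
  apply le_antisymm (h.inner_le_closure hx (h.subset hy))
  have := h.inner_le_closure hy (h.subset hx)
  rw [← neg_sub, inner_neg_right] at this
  linarith

/-- The height of the cone over a facet is at least the radius of an inscribed ball. -/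
theorem IsFacet.exists_height {d : ℕ} {T F : Set (E d)} {n x₀ : E d} (h : IsFacet T F n) {r : ℝ}
    (hr : 0 < r) (hball : Metric.ball x₀ r ⊆ T) :
    ∃ δ, r ≤ δ ∧ ∀ z ∈ F, ⟪n, z - x₀⟫ = δ := by
  rcases F.eq_empty_or_nonempty with rfl | ⟨z₀, hz₀⟩
  · exact ⟨r, le_rfl, by simp⟩
  refine ⟨⟪n, z₀ - x₀⟫, ?_, fun z hz => ?_⟩
  · refine le_of_forall_lt fun ρ hρ => ?_
    rcases lt_or_ge ρ 0 with h0 | h0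
    · have := h.inner_le z₀ hz₀ x₀ (hball (Metric.mem_ball_self hr))
      rw [← neg_sub, inner_neg_right] at this
      linarith
    · obtain ⟨ρ', h1, h2⟩ := exists_between hρ
      have hmem : x₀ + ρ' • n ∈ T := hball (by
        rw [Metric.mem_ball, dist_eq_norm, add_sub_cancel_left, norm_smul, h.norm, mul_one,
          Real.norm_of_nonneg (by linarith)]
        exact h2)
      have := h.inner_le z₀ hz₀ _ hmem
      have e : x₀ + ρ' • n - z₀ = ρ' • n - (z₀ - x₀) := by abel
      rw [e, inner_sub_right, inner_smul_right, real_inner_self_eq_norm_sq, h.norm] at this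
      linarith
  · have := h.inner_eq_zero hz₀ hz
    have e : z - x₀ = (z - z₀) + (z₀ - x₀) := by abel
    rw [e, inner_add_right, this, zero_add]

theorem cone_mem_closure {d : ℕ} {T : Set (E d)} (hT : Convex ℝ T) {x₀ z : E d} (hx : x₀ ∈ T)
    (hz : z ∈ closure T) {t : ℝ} (ht : t ∈ Set.Ioc (1 / 2 : ℝ) 1) :
    x₀ + t • (z - x₀) ∈ closure T := by
  have := hT.closure (subset_closure hx) hz (a := 1 - t) (b := t) (by linarith [ht.2])
    (by linarith [ht.1]) (by ring)
  convert this using 1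
  rw [smul_sub, sub_smul, one_smul]; abel

/-- The slicing estimate with S t = F for every t bounds half the surface of F by a multiple of the
finite volume of the closure of T. -/
theorem IsFacet.surface_lt_top {d : ℕ} {T F : Set (E d)} {n x₀ : E d} (h : IsFacet T F n) {r : ℝ}
    (hT : Convex ℝ T) (hTb : Bornology.IsBounded T)
    (hr : 0 < r) (hball : Metric.ball x₀ r ⊆ T) : surface d F < ⊤ := by
  obtain ⟨δ, hδ, hF⟩ := h.exists_height hr hball
  have hx₀ : x₀ ∈ T := hball (Metric.mem_ball_self hr)
  have := lintegral_surface_slice_le h.norm (hr.trans_le hδ) (A := closure T) (F := F)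
    isClosed_closure.measurableSet hF (fun _ => F)
    (fun t ht => ⟨subset_rfl, fun z hz => cone_mem_closure hT hx₀ (h.subset hz) ht⟩)
  rw [setLIntegral_const, Real.volume_Ioc] at this
  have hfin : ENNReal.ofReal (2 ^ (d - 1) / δ) * volume (closure T) < ⊤ :=
    ENNReal.mul_lt_top ENNReal.ofReal_lt_top hTb.closure.measure_lt_top
  by_contra htop
  rw [not_lt, top_le_iff] at htop
  rw [htop, ENNReal.top_mul (by norm_num)] at this
  exact absurd (this.trans_lt hfin) (lt_irrefl _)

/-- The outer half of the cone with apex x₀ over F lies in the closure of T. The slicing estimate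
says that the image of the product measure under (z,t) ↦ x₀ + t(z - x₀) is dominated by a multiple
of Lebesgue measure on T. This is a change of variables in the form of an inequality. -/
theorem IsFacet.lintegral_le {d : ℕ} {T F : Set (E d)} {n x₀ : E d} (h : IsFacet T F n) {r : ℝ}
    (hT : Convex ℝ T) (hTb : Bornology.IsBounded T)
    (hr : 0 < r) (hball : Metric.ball x₀ r ⊆ T) {g : E d → ENNReal} (hg : Measurable g) :
    ∫⁻ z in F, (∫⁻ t in Set.Ioc (1 / 2 : ℝ) 1, g (x₀ + t • (z - x₀))) ∂(surface d) ≤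
      ENNReal.ofReal (2 ^ (d - 1) / r) * ∫⁻ x in T, g x := by
  obtain ⟨δ, hδ, hF⟩ := h.exists_height hr hball
  have hδ0 := hr.trans_le hδ
  have hx₀ : x₀ ∈ T := hball (Metric.mem_ball_self hr)
  have hfin := h.surface_lt_top hT hTb hr hball
  have : IsFiniteMeasure ((surface d).restrict F) := ⟨by simpa using hfin⟩
  set μ := (surface d).restrict F with hμ
  set ν := (volume : Measure ℝ).restrict (Set.Ioc (1 / 2 : ℝ) 1) with hν
  set Φ : E d × ℝ → E d := fun p => x₀ + p.2 • (p.1 - x₀) with hΦ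
  have hΦm : Measurable Φ := by
    have : Continuous Φ := by fun_prop
    exact this.measurable
  have hle : (μ.prod ν).map Φ ≤ ENNReal.ofReal (2 ^ (d - 1) / r) • volume.restrict T := by
    refine Measure.le_iff.2 fun A hA => ?_
    rw [Measure.map_apply hΦm hA, Measure.prod_apply_symm (hΦm hA), Measure.smul_apply, smul_eq_mul]
    -- The points of the cone are only known to lie in the closure of T, but the frontier of a
    -- convex set is a null set.
    have hcl : (volume.restrict T) A = volume (A ∩ closure T) := by
      rw [Measure.restrict_apply hA]
      apply measure_congr
      exact (Filter.EventuallyEq.refl _ _).inter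
        (hT.addHaar_frontier volume |> fun h0 => (closure_ae_eq_of_null_frontier h0).symm)
    rw [hcl]
    have e : ∀ t, μ ((fun x => (x, t)) ⁻¹' (Φ ⁻¹' A)) =
        surface d ({z | x₀ + t • (z - x₀) ∈ A} ∩ F) := by
      intro t
      have hm : MeasurableSet ((fun x => (x, t)) ⁻¹' (Φ ⁻¹' A)) :=
        measurable_prodMk_right (hΦm hA)
      rw [hμ, Measure.restrict_apply hm]
      rfl
    simp_rw [e]
    refine (lintegral_surface_slice_le h.norm hδ0 (A := A ∩ closure T) (F := F)
      (hA.inter isClosed_closure.measurableSet) hF _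
      (fun t ht => ⟨Set.inter_subset_right, fun z hz =>
        ⟨hz.1, cone_mem_closure hT hx₀ (h.subset hz.2) ht⟩⟩)).trans ?_
    gcongr
  calc _ = ∫⁻ p, g (Φ p) ∂(μ.prod ν) :=
        (lintegral_prod (fun p => g (Φ p)) (hg.comp hΦm).aemeasurable).symm
    _ = ∫⁻ x, g x ∂((μ.prod ν).map Φ) := by rw [lintegral_map hg hΦm]
    _ ≤ ∫⁻ x, g x ∂(ENNReal.ofReal (2 ^ (d - 1) / r) • volume.restrict T) :=
        lintegral_mono' hle le_rfl
    _ = _ := by rw [lintegral_smul_measure, smul_eq_mul]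

/-- `g` is a polynomial of degree at most `N` on every line. -/
def IsPolyOnLines {d : ℕ} (N : ℕ) (g : E d → ℝ) : Prop :=
  ∀ x v : E d, ∃ q : Polynomial ℝ, q.natDegree ≤ N ∧ ∀ t : ℝ, g (x + t • v) = q.eval t

/-- The trace inverse inequality, with the sharp power of the degree. -/
theorem IsFacet.integral_sq_le {d : ℕ} {T F : Set (E d)} {n x₀ : E d} (h : IsFacet T F n) {r : ℝ}
    (hT : Convex ℝ T) (hTb : Bornology.IsBounded T)
    (hr : 0 < r) (hball : Metric.ball x₀ r ⊆ T) {N : ℕ} {g : E d → ℝ} (hgc : Continuous g)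
    (hg : IsPolyOnLines N g) :
    ∫ z in F, g z ^ 2 ∂(surface d) ≤ 16 * 2 ^ (d - 1) * (N + 1) ^ 2 / r * ∫ x in T, g x ^ 2 := by
  have hint : IntegrableOn (fun x => g x ^ 2) T volume :=
    ((hgc.pow 2).continuousOn.integrableOn_compact
      (hTb.isCompact_closure)).mono_set subset_closure
  -- The univariate estimate along the segment from x₀ (t = 0) to z (t = 1).
  have hpt : ∀ z, ENNReal.ofReal (g z ^ 2) ≤ ENNReal.ofReal (16 * (N + 1) ^ 2) *
      ∫⁻ t in Set.Ioc (1 / 2 : ℝ) 1, ENNReal.ofReal (g (x₀ + t • (z - x₀)) ^ 2) := by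
    intro z
    obtain ⟨q, hq, hqe⟩ := hg x₀ (z - x₀)
    have h1 := sq_eval_one_le_integral hq
    rw [← hqe, one_smul, add_sub_cancel] at h1
    simp_rw [← hqe] at h1
    rw [intervalIntegral.integral_of_le (by norm_num)] at h1
    have hc : Continuous fun t : ℝ => g (x₀ + t • (z - x₀)) ^ 2 := by fun_prop
    rw [← ofReal_integral_eq_lintegral_ofReal
      ((hc.integrableOn_Icc (a := 1 / 2) (b := 1)).mono_set Set.Ioc_subset_Icc_self)
      (Filter.Eventually.of_forall fun t => by positivity), ← ENNReal.ofReal_mul (by positivity)]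
    exact ENNReal.ofReal_le_ofReal h1
  have hle : ∫⁻ z in F, ENNReal.ofReal (g z ^ 2) ∂(surface d) ≤
      ENNReal.ofReal (16 * 2 ^ (d - 1) * (N + 1) ^ 2 / r) *
        ∫⁻ x in T, ENNReal.ofReal (g x ^ 2) := by
    calc _ ≤ ∫⁻ z in F, ENNReal.ofReal (16 * (N + 1) ^ 2) *
          (∫⁻ t in Set.Ioc (1 / 2 : ℝ) 1, ENNReal.ofReal (g (x₀ + t • (z - x₀)) ^ 2))
            ∂(surface d) := lintegral_mono hpt
      _ = ENNReal.ofReal (16 * (N + 1) ^ 2) * ∫⁻ z in F,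
          (∫⁻ t in Set.Ioc (1 / 2 : ℝ) 1, ENNReal.ofReal (g (x₀ + t • (z - x₀)) ^ 2))
            ∂(surface d) := lintegral_const_mul' _ _ ENNReal.ofReal_ne_top
      _ ≤ ENNReal.ofReal (16 * (N + 1) ^ 2) * (ENNReal.ofReal (2 ^ (d - 1) / r) *
          ∫⁻ x in T, ENNReal.ofReal (g x ^ 2)) := by
        gcongr
        exact h.lintegral_le hT hTb hr hball (hgc.pow 2).measurable.ennreal_ofReal
      _ = _ := by
        rw [← mul_assoc, ← ENNReal.ofReal_mul (by positivity)]
        congr 2; ring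
  rw [integral_eq_lintegral_of_nonneg_ae (f := fun z => g z ^ 2)
      (Filter.Eventually.of_forall fun t => by positivity)
      (by fun_prop : Continuous fun z => g z ^ 2).aestronglyMeasurable]
  refine ENNReal.toReal_le_of_le_ofReal
    (mul_nonneg (by positivity) (integral_nonneg fun _ => by positivity)) ?_
  refine hle.trans (le_of_eq ?_)
  rw [ENNReal.ofReal_mul (by positivity), ofReal_integral_eq_lintegral_ofReal hint
    (Filter.Eventually.of_forall fun t => by positivity)]

/-! ### Geometry of the elements -/

/-- The barycentric coordinates with respect to the vertices of the reference simplex. -/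
def bary {d : ℕ} (x : E d) : Fin (d + 1) → ℝ := Fin.cons (1 - ∑ i, x i) (fun i => x i)

theorem sum_bary {d : ℕ} (x : E d) : ∑ j, bary x j = 1 := by
  simp [bary, Fin.sum_univ_succ]

theorem mem_simplex_iff {d : ℕ} (x : E d) :
    x ∈ refElement d .simplex ↔ ∀ j, 0 < bary x j := by
  simp only [refElement, Set.mem_ofPred_eq, Fin.forall_fin_succ, bary, Fin.cons_zero, Fin.cons_succ,
    sub_pos]
  exact and_comm

theorem isOpen_refElement (d : ℕ) (s : Shape) : IsOpen (refElement d s) := by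
  cases s
  · have : refElement d .simplex = (⋂ i, {x : E d | 0 < x i}) ∩ {x | ∑ i, x i < 1} := by
      ext x; simp [refElement]
    rw [this]
    exact (isOpen_iInter_of_finite fun i => isOpen_lt continuous_const (by fun_prop)).inter
      (isOpen_lt (by fun_prop) continuous_const)
  · have : refElement d .cube = ⋂ i, ({x : E d | 0 < x i} ∩ {x | x i < 1}) := by
      ext x; simp [refElement]
    rw [this]
    exact isOpen_iInter_of_finite fun i => (isOpen_lt continuous_const (by fun_prop)).inter
      (isOpen_lt (by fun_prop) continuous_const)

theorem convex_refElement (d : ℕ) (s : Shape) : Convex ℝ (refElement d s) := by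
  rw [convex_iff_forall_pos]
  cases s
  · rintro x ⟨hx, hx'⟩ y ⟨hy, hy'⟩ a b ha hb hab
    refine ⟨fun i => ?_, ?_⟩
    · have := mul_pos ha (hx i)
      have := mul_pos hb (hy i)
      simp only [PiLp.add_apply, PiLp.smul_apply, smul_eq_mul]
      linarith
    · simp only [PiLp.add_apply, PiLp.smul_apply, smul_eq_mul, Finset.sum_add_distrib,
        ← Finset.mul_sum]
      nlinarith
  · intro x hx y hy a b ha hb hab i
    have h1 := mul_pos ha (hx i).1
    have h2 := mul_pos hb (hy i).1
    have h3 := mul_lt_mul_of_pos_left (hx i).2 ha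
    have h4 := mul_lt_mul_of_pos_left (hy i).2 hb
    simp only [PiLp.add_apply, PiLp.smul_apply, smul_eq_mul]
    exact ⟨by linarith, by linarith⟩

theorem refElement_nonempty (d : ℕ) (s : Shape) : (refElement d s).Nonempty := by
  cases s
  · refine ⟨WithLp.toLp 2 fun _ => 1 / ((d : ℝ) + 1), fun i => ?_, ?_⟩
    · simp only; positivity
    · simp only [Finset.sum_const, Finset.card_univ, Fintype.card_fin, nsmul_eq_mul]
      rw [mul_one_div, div_lt_one (by positivity)]
      linarith
  · exact ⟨WithLp.toLp 2 fun _ => 1 / 2, fun i => by simp only; norm_num⟩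

theorem mem_Icc_of_mem_refElement {d : ℕ} {s : Shape} {x : E d} (hx : x ∈ refElement d s)
    (i : Fin d) : 0 < x i ∧ x i < 1 := by
  cases s
  · refine ⟨hx.1 i, lt_of_le_of_lt ?_ hx.2⟩
    exact Finset.single_le_sum (f := fun i => x i) (fun j _ => (hx.1 j).le) (Finset.mem_univ i)
  · exact hx i

theorem isBounded_refElement (d : ℕ) (s : Shape) : Bornology.IsBounded (refElement d s) := by
  refine (Metric.isBounded_closedBall (x := (0 : E d)) (r := Real.sqrt d)).subset fun x hx => ?_
  rw [mem_closedBall_zero_iff, EuclideanSpace.norm_eq]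
  refine Real.sqrt_le_sqrt ?_
  calc ∑ i, ‖x i‖ ^ 2 ≤ ∑ i : Fin d, (1 : ℝ) := by
        refine Finset.sum_le_sum fun i _ => ?_
        have := mem_Icc_of_mem_refElement hx i
        rw [Real.norm_eq_abs, sq_abs]
        nlinarith
    _ = d := by simp

theorem frontier_refElement_subset (d : ℕ) (s : Shape) :
    frontier (refElement d s) ⊆ ⋃ G ∈ refFacets d s, G := by
  intro x hx
  rw [(isOpen_refElement d s).frontier_eq] at hx
  obtain ⟨hxc, hxn⟩ := hx
  have hcl : ∀ i, 0 ≤ x i ∧ x i ≤ 1 := by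
    intro i
    have hc : IsClosed ({x : E d | 0 ≤ x i} ∩ {x | x i ≤ 1}) :=
      (isClosed_le continuous_const (by fun_prop)).inter
        (isClosed_le (by fun_prop) continuous_const)
    exact (hc.closure_subset_iff.2 fun y hy =>
      ⟨(mem_Icc_of_mem_refElement hy i).1.le, (mem_Icc_of_mem_refElement hy i).2.le⟩) hxc
  simp only [Set.mem_iUnion, exists_prop]
  cases s
  · have hsum : ∑ i, x i ≤ 1 := by
      have hc : IsClosed {x : E d | ∑ i, x i ≤ 1} := isClosed_le (by fun_prop) continuous_const
      exact (hc.closure_subset_iff.2 fun y hy => hy.2.le) hxc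
    by_cases h : ∀ i, 0 < x i
    · refine ⟨_, Or.inr rfl, hxc, ?_⟩
      by_contra hne
      exact hxn ⟨h, lt_of_le_of_ne hsum hne⟩
    · push Not at h
      obtain ⟨i, hi⟩ := h
      exact ⟨_, Or.inl ⟨i, rfl⟩, hxc, le_antisymm hi (hcl i).1⟩
  · have : ∃ i, ¬ (0 < x i ∧ x i < 1) := not_forall.1 hxn
    obtain ⟨i, hi⟩ := this
    by_cases h0 : 0 < x i
    · exact ⟨_, Or.inr ⟨i, rfl⟩, hxc, le_antisymm (hcl i).2 (not_lt.1 fun h => hi ⟨h0, h⟩)⟩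
    · exact ⟨_, Or.inl ⟨i, rfl⟩, hxc, le_antisymm (not_lt.1 h0) (hcl i).1⟩

theorem refFacets_subset_closure {d : ℕ} {s : Shape} {G : Set (E d)} (hG : G ∈ refFacets d s) :
    G ⊆ closure (refElement d s) := by
  cases s
  · rcases hG with ⟨i, rfl⟩ | rfl <;> exact Set.inter_subset_left
  · rcases hG with ⟨i, rfl⟩ | ⟨i, rfl⟩ <;> exact Set.inter_subset_left

theorem isClosed_refFacet {d : ℕ} {s : Shape} {G : Set (E d)} (hG : G ∈ refFacets d s) :
    IsClosed G := by
  cases s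
  · rcases hG with ⟨i, rfl⟩ | rfl
    · exact isClosed_closure.inter (isClosed_eq (by fun_prop) continuous_const)
    · exact isClosed_closure.inter (isClosed_eq (by fun_prop) continuous_const)
  · rcases hG with ⟨i, rfl⟩ | ⟨i, rfl⟩ <;>
    exact isClosed_closure.inter (isClosed_eq (by fun_prop) continuous_const)

/-- The `i`-th coordinate as a linear form. -/
def coordForm {d : ℕ} (i : Fin d) : E d →ₗ[ℝ] ℝ where
  toFun x := x i
  map_add' _ _ := rfl
  map_smul' _ _ := rfl

@[simp]
theorem coordForm_apply {d : ℕ} (i : Fin d) (x : E d) : coordForm i x = x i := rfl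

/-- Strictness is what shows later that the form transported to an element is nonzero, so that it
can be normalised to a unit normal. -/
theorem exists_form_refFacet {d : ℕ} {s : Shape} {G : Set (E d)} (hG : G ∈ refFacets d s) :
    ∃ L : E d →ₗ[ℝ] ℝ, ∀ x ∈ G, ∀ y ∈ refElement d s, L (y - x) < 0 := by
  cases s
  · rcases hG with ⟨i, rfl⟩ | rfl
    · refine ⟨-coordForm i, fun x hx y hy => ?_⟩
      have h1 : x i = 0 := hx.2
      have h2 := (mem_Icc_of_mem_refElement hy i).1
      simp [h1, h2]
    · refine ⟨∑ i, coordForm i, fun x hx y hy => ?_⟩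
      have h1 : ∑ i, x i = 1 := hx.2
      have h2 : ∑ i, y i < 1 := hy.2
      simp [h1, h2]
  · rcases hG with ⟨i, rfl⟩ | ⟨i, rfl⟩
    · refine ⟨-coordForm i, fun x hx y hy => ?_⟩
      have h1 : x i = 0 := hx.2
      have h2 := (mem_Icc_of_mem_refElement hy i).1
      simp [h1, h2]
    · refine ⟨coordForm i, fun x hx y hy => ?_⟩
      have h1 : x i = 1 := hx.2
      have h2 := (mem_Icc_of_mem_refElement hy i).2
      simp [h1, h2]

section Cell

variable {d : ℕ} (s : Shape) (T : Cell d)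

/-- The element map as a homeomorphism. -/
def Cell.homeo (T : Cell d) : E d ≃ₜ E d := (AffineEquiv.toContinuousAffineEquiv T).toHomeomorph

theorem cell_eq_homeo : cell s T = Cell.homeo T '' refElement d s := rfl

theorem isOpen_cell : IsOpen (cell s T) :=
  (Cell.homeo T).isOpenMap _ (isOpen_refElement d s)

theorem convex_cell : Convex ℝ (cell s T) :=
  (convex_refElement d s).affine_image (T : E d →ᵃ[ℝ] E d)

theorem cell_nonempty : (cell s T).Nonempty := (refElement_nonempty d s).image _

theorem closure_cell : closure (cell s T) = T '' closure (refElement d s) :=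
  ((Cell.homeo T).image_closure _).symm

theorem isBounded_cell : Bornology.IsBounded (cell s T) := by
  have h : IsCompact (Cell.homeo T '' closure (refElement d s)) :=
    (isBounded_refElement d s).isCompact_closure.image (Cell.homeo T).continuous
  exact h.isBounded.subset (Set.image_mono subset_closure)

theorem measurableSet_cell : MeasurableSet (cell s T) := (isOpen_cell s T).measurableSet

theorem volume_frontier_cell : volume (frontier (cell s T)) = 0 :=
  (convex_cell s T).addHaar_frontier volume

theorem frontier_cell_subset :
    frontier (cell s T) ⊆ ⋃ G ∈ refFacets d s, T '' G := by
  rw [cell_eq_homeo, ← (Cell.homeo T).image_frontier]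
  rintro _ ⟨x, hx, rfl⟩
  have := frontier_refElement_subset d s hx
  simp only [Set.mem_iUnion, exists_prop] at this ⊢
  obtain ⟨G, hG, hxG⟩ := this
  exact ⟨G, hG, x, hxG, rfl⟩

theorem isClosed_image_facet {G : Set (E d)} (hG : G ∈ refFacets d s) : IsClosed (T '' G) :=
  (Cell.homeo T).isClosedMap _ (isClosed_refFacet hG)

theorem diam_cell_pos (hd : 0 < d) : 0 < Metric.diam (cell s T) := by
  obtain ⟨x, hx⟩ := cell_nonempty s T
  obtain ⟨r, hr, hball⟩ := Metric.isOpen_iff.1 (isOpen_cell s T) x hx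
  set e : E d := EuclideanSpace.single ⟨0, hd⟩ (1 : ℝ)
  have he : ‖e‖ = 1 := by simp [e]
  have hn : ‖(r / 2) • e‖ = r / 2 := by
    rw [norm_smul, he, mul_one, Real.norm_of_nonneg (by positivity)]
  have hy : x + (r / 2) • e ∈ cell s T := hball (by
    rw [Metric.mem_ball, dist_eq_norm, add_sub_cancel_left, hn]; linarith)
  have := Metric.dist_le_diam_of_mem (isBounded_cell s T) hy hx
  rw [dist_eq_norm, add_sub_cancel_left, hn] at this
  linarith

end Cell

theorem exists_unit_of_form {d : ℕ} {F C : Set (E d)} {L : E d →ₗ[ℝ] ℝ} (hL : L ≠ 0)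
    (h : ∀ x ∈ F, ∀ y ∈ C, L (y - x) ≤ 0) :
    ∃ n : E d, ‖n‖ = 1 ∧ ∀ x ∈ F, ∀ y ∈ C, ⟪n, y - x⟫ ≤ 0 := by
  set L' : E d →L[ℝ] ℝ := L.toContinuousLinearMap
  set m := (InnerProductSpace.toDual ℝ (E d)).symm L' with hm
  have hmL : ∀ z, ⟪m, z⟫ = L z := fun z => InnerProductSpace.toDual_symm_apply
  have hm0 : m ≠ 0 := by
    intro h0
    apply hL
    ext z
    rw [← hmL, h0, inner_zero_left]; rfl
  have hmp : 0 < ‖m‖ := norm_pos_iff.2 hm0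
  refine ⟨‖m‖⁻¹ • m, ?_, fun x hx y hy => ?_⟩
  · rw [norm_smul, norm_inv, norm_norm, inv_mul_cancel₀ hmp.ne']
  · rw [real_inner_smul_left, hmL]
    exact mul_nonpos_of_nonneg_of_nonpos (by positivity) (h x hx y hy)

theorem exists_normal_facet {d : ℕ} {s : Shape} (T : Cell d) {G : Set (E d)}
    (hG : G ∈ refFacets d s) (hne : G.Nonempty) :
    ∃ n : E d, ‖n‖ = 1 ∧ ∀ x ∈ T '' G, ∀ y ∈ cell s T, ⟪n, y - x⟫ ≤ 0 := by
  obtain ⟨x₀, hx₀⟩ := hne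
  obtain ⟨L, hL⟩ := exists_form_refFacet hG
  obtain ⟨y₀, hy₀⟩ := refElement_nonempty d s
  have hlin : ∀ x y : E d, L (T.symm.linear (T y - T x)) = L (y - x) := by
    intro x y
    have : T.symm.linear (T y - T x) = y - x := by
      have := (T.symm : E d →ᵃ[ℝ] E d).linearMap_vsub (T y) (T x)
      simpa using this
    rw [this]
  refine exists_unit_of_form (L := L ∘ₗ (T.symm.linear : E d →ₗ[ℝ] E d)) ?_ ?_
  · intro h0
    have h1 := hL x₀ hx₀ y₀ hy₀
    rw [← hlin] at h1
    have h2 := congrArg (fun f : E d →ₗ[ℝ] ℝ => f (T y₀ - T x₀)) h0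
    simp at h2
    simp at h1
    linarith
  · rintro _ ⟨x, hx, rfl⟩ _ ⟨y, hy, rfl⟩
    have := hL x hx y hy
    rw [← hlin] at this
    exact this.le

/-! ### Surface measure -/

/-- Sets of codimension two have zero surface measure. -/
theorem surface_eq_zero_of_codim_two {d : ℕ} (hd : 2 ≤ d) {F : Set (E d)} {x₀ n n' : E d}
    (hind : LinearIndependent ℝ ![n, n']) (h : ∀ x ∈ F, ⟪n, x - x₀⟫ = 0)
    (h' : ∀ x ∈ F, ⟪n', x - x₀⟫ = 0) : surface d F = 0 := by
  set S : Submodule ℝ (E d) := Submodule.span ℝ (Set.range ![n, n']) with hS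
  have hrank : Module.finrank ℝ S = 2 := by
    rw [hS, finrank_span_eq_card hind]; simp
  have hrank' : Module.finrank ℝ Sᗮ = d - 2 := by
    have := S.finrank_add_finrank_orthogonal
    rw [hrank, finrank_euclideanSpace_fin] at this
    omega
  set φ : Sᗮ → E d := fun w => x₀ + w with hφ
  have hiso : Isometry φ := (isometry_add_left x₀).comp isometry_subtype_coe
  have hsub : F ⊆ φ '' Set.univ := by
    intro x hx
    refine ⟨⟨x - x₀, ?_⟩, trivial, by simp [hφ]⟩
    rw [hS, Submodule.mem_orthogonal]
    intro u hu
    induction hu using Submodule.span_induction with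
    | mem u hu =>
      obtain ⟨i, rfl⟩ := hu
      fin_cases i
      · exact h x hx
      · exact h' x hx
    | zero => simp
    | add u v _ _ hu hv => rw [inner_add_left, hu, hv, add_zero]
    | smul a u _ hu => rw [inner_smul_left, hu, mul_zero]
  have hdim : dimH F ≤ ((d - 2 : ℕ) : ENNReal) := by
    refine (dimH_mono hsub).trans ?_
    rw [hiso.dimH_image, Real.dimH_univ_eq_finrank, hrank']
  have : Measure.hausdorffMeasure ((d - 1 : ℕ) : ℝ) F = 0 := by
    have hlt : dimH F < (((d - 1 : ℕ) : NNReal) : ENNReal) := by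
      refine hdim.trans_lt ?_
      simp only [ENNReal.coe_natCast]
      exact_mod_cast (by omega : d - 2 < d - 1)
    have := hausdorffMeasure_of_dimH_lt hlt
    rwa [NNReal.coe_natCast] at this
  rw [surface, Measure.euclideanHausdorffMeasure_def, Measure.smul_apply, this, smul_zero]

/-- Two independent normals would confine F to codimension two, where the surface measure vanishes.
Two opposite normals would confine the open set T to a hyperplane. -/
theorem IsFacet.eq_of_surface_pos {d : ℕ} (hd : 2 ≤ d) {T F : Set (E d)} {n n' : E d}
    (hTo : IsOpen T) (hTn : T.Nonempty) (hF : 0 < surface d F) (h : IsFacet T F n)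
    (h' : IsFacet T F n') : n = n' := by
  obtain ⟨x₀, hx₀⟩ : F.Nonempty := by
    rw [Set.nonempty_iff_ne_empty]; rintro rfl; simp at hF
  have hn0 : n ≠ 0 := by rw [← norm_ne_zero_iff, h.norm]; norm_num
  by_cases hind : LinearIndependent ℝ ![n, n']
  · exact absurd (surface_eq_zero_of_codim_two hd hind (fun x hx => h.inner_eq_zero hx₀ hx)
      (fun x hx => h'.inner_eq_zero hx₀ hx)) hF.ne'
  · rw [LinearIndependent.pair_iff' hn0] at hind
    push Not at hind
    obtain ⟨a, ha⟩ := hind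
    have hna : |a| = 1 := by
      have := congrArg (fun x => ‖x‖) ha
      simp only [norm_smul, h.norm, h'.norm, mul_one, Real.norm_eq_abs] at this
      exact this
    rcases eq_or_eq_neg_of_abs_eq hna with rfl | rfl
    · rwa [one_smul] at ha
    · exfalso
      obtain ⟨y, hy⟩ := hTn
      obtain ⟨r, hr, hball⟩ := Metric.isOpen_iff.1 hTo y hy
      have hz : ∀ z ∈ T, ⟪n, z - x₀⟫ = 0 := by
        intro z hz
        refine le_antisymm (h.inner_le x₀ hx₀ z hz) ?_
        have := h'.inner_le x₀ hx₀ z hz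
        rw [← ha, neg_one_smul, inner_neg_left] at this
        linarith
      have hmem : y + (r / 2) • n ∈ T := hball (by
        rw [Metric.mem_ball, dist_eq_norm, add_sub_cancel_left, norm_smul, h.norm, mul_one,
          Real.norm_of_nonneg (by linarith)]
        linarith)
      have h1 := hz _ hmem
      have e : y + (r / 2) • n - x₀ = (r / 2) • n + (y - x₀) := by abel
      rw [e, inner_add_right, hz y hy, inner_smul_right, real_inner_self_eq_norm_sq, h.norm] at h1
      linarith

/-- The boundary of a bounded set with nonempty interior has positive surface measure. -/
theorem surface_frontier_pos {d : ℕ} (hd : 2 ≤ d) {U : Set (E d)} (hb : Bornology.IsBounded U)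
    (hi : (interior U).Nonempty) : 0 < surface d (frontier U) := by
  obtain ⟨m, rfl⟩ : ∃ m, d = m + 1 := ⟨d - 1, by omega⟩
  let π : E (m + 1) →ₗ[ℝ] E m :=
    { toFun := fun x => WithLp.toLp 2 fun i => x i.succ
      map_add' := fun _ _ => rfl
      map_smul' := fun _ _ => rfl }
  have hπ : ∀ x i, π x i = x i.succ := fun _ _ => rfl
  have hnorm : ∀ x, ‖π x‖ ≤ ‖x‖ := by
    intro x
    rw [EuclideanSpace.norm_eq, EuclideanSpace.norm_eq]
    refine Real.sqrt_le_sqrt ?_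
    rw [Fin.sum_univ_succ]
    simp only [hπ]
    nlinarith [norm_nonneg (x 0)]
  have hlip : LipschitzWith 1 π := by
    refine LipschitzWith.of_dist_le_mul fun x y => ?_
    rw [dist_eq_norm, dist_eq_norm, ← map_sub, NNReal.coe_one, one_mul]
    exact hnorm _
  have hsurj : Function.Surjective π := fun y =>
    ⟨WithLp.toLp 2 (Fin.cons 0 fun i => y i), by ext i; simp [hπ]⟩
  have hopen : IsOpenMap π := π.isOpenMap_of_finiteDimensional hsurj
  -- A line through an interior point in the direction of the first coordinate leaves the bounded
  -- set U, so it meets the frontier at a point with the same projection.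
  have hsub : π '' interior U ⊆ π '' frontier U := by
    rintro _ ⟨x, hx, rfl⟩
    set e : E (m + 1) := EuclideanSpace.single 0 1 with he
    have hπe : π e = 0 := by ext i; simp [hπ, he]
    have hc : Continuous fun t : ℝ => x + t • e := by fun_prop
    obtain ⟨t, ht⟩ : (frontier ((fun t : ℝ => x + t • e) ⁻¹' U)).Nonempty := by
      refine nonempty_frontier_iff.2 ⟨⟨0, by simpa using interior_subset hx⟩, fun huniv => ?_⟩
      obtain ⟨R, hR⟩ := hb.subset_ball x
      have hmem : |R| ∈ (fun t : ℝ => x + t • e) ⁻¹' U := huniv ▸ Set.mem_univ _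
      have := hR hmem
      rw [Metric.mem_ball, dist_eq_norm, add_sub_cancel_left, norm_smul, he] at this
      simp at this
      exact absurd this (not_lt.2 (le_abs_self R))
    have hz : x + t • e ∈ frontier U := hc.frontier_preimage_subset U ht
    exact ⟨_, hz, by simp [hπe]⟩
  have hpos : 0 < surface (m + 1) (frontier U) := by
    have hv : 0 < (volume : Measure (E m)) (π '' interior U) :=
      (hopen _ isOpen_interior).measure_pos volume (hi.image _)
    rw [← EuclideanSpace.euclideanHausdorffMeasure_eq_volume] at hv
    refine hv.trans_le ((measure_mono hsub).trans ?_)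
    -- Both sides carry the same normalisation of the m-dimensional Hausdorff measure, which a
    -- 1-Lipschitz map does not increase.
    rw [surface, Nat.add_sub_cancel, Measure.euclideanHausdorffMeasure_def,
      Measure.euclideanHausdorffMeasure_def, Measure.smul_apply, Measure.smul_apply]
    have := hlip.hausdorffMeasure_image_le (d := (m : ℝ)) (Nat.cast_nonneg m) (frontier U)
    simp only [ENNReal.coe_one, ENNReal.one_rpow, one_mul] at this
    gcongr
  exact hpos

/-! ### Faces and normals -/

section Faces

variable {d : ℕ} {s : Shape} {Ω : Set (E d)} {𝒯 : Finset (Cell d)}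

open Classical in
theorem mem_interiorFaces {f : Face d} : f ∈ interiorFaces s 𝒯 ↔
    ∃ T ∈ 𝒯, ∃ T' ∈ 𝒯, T ≠ T' ∧ f = ⟨{T, T'}, closure (cell s T) ∩ closure (cell s T')⟩ ∧
      0 < surface d f.carrier := by
  have e : ∀ T T' : Cell d, (⋂ S ∈ ({T, T'} : Finset (Cell d)), closure (cell s S)) =
      closure (cell s T) ∩ closure (cell s T') := by
    intro T T'; simp
  simp only [interiorFaces, Finset.mem_filter, Finset.mem_image, Finset.mem_powersetCard]
  constructor
  · rintro ⟨⟨c, ⟨hc, hcard⟩, rfl⟩, hpos⟩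
    obtain ⟨T, T', hne, rfl⟩ := Finset.card_eq_two.1 hcard
    refine ⟨T, hc (by simp), T', hc (by simp), hne, ?_, hpos⟩
    rw [e]
  · rintro ⟨T, hT, T', hT', hne, rfl, hpos⟩
    refine ⟨⟨{T, T'}, ⟨?_, Finset.card_pair hne⟩, ?_⟩, hpos⟩
    · intro S hS
      rcases Finset.mem_insert.1 hS with rfl | hS
      · exact hT
      · rwa [Finset.mem_singleton.1 hS]
    · rw [e]

open Classical in
theorem mem_boundaryFaces {f : Face d} : f ∈ boundaryFaces s Ω 𝒯 ↔
    ∃ T ∈ 𝒯, ∃ G ∈ refFacets d s, f = ⟨{T}, T '' G ∩ frontier Ω⟩ ∧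
      0 < surface d f.carrier := by
  simp only [boundaryFaces, Finset.mem_filter, Finset.mem_image, Finset.mem_product,
    Set.Finite.mem_toFinset, Prod.exists]
  constructor
  · rintro ⟨⟨T, G, ⟨hT, hG⟩, rfl⟩, hpos⟩
    exact ⟨T, hT, G, hG, rfl, hpos⟩
  · rintro ⟨T, hT, G, hG, rfl, hpos⟩
    exact ⟨⟨T, G, ⟨hT, hG⟩, rfl⟩, hpos⟩

theorem mem_faces {f : Face d} : f ∈ faces s Ω 𝒯 ↔
    f ∈ interiorFaces s 𝒯 ∨ f ∈ boundaryFaces s Ω 𝒯 := by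
  classical
  simp [faces]

theorem surface_pos_of_mem_faces {f : Face d} (hf : f ∈ faces s Ω 𝒯) : 0 < surface d f.carrier := by
  rcases mem_faces.1 hf with h | h
  · obtain ⟨_, _, _, _, _, _, h⟩ := mem_interiorFaces.1 h; exact h
  · obtain ⟨_, _, _, _, _, h⟩ := mem_boundaryFaces.1 h; exact h

theorem carrier_nonempty {f : Face d} (hf : f ∈ faces s Ω 𝒯) : f.carrier.Nonempty := by
  rw [Set.nonempty_iff_ne_empty]
  intro h
  have := surface_pos_of_mem_faces hf
  rw [h] at this
  simp at this

theorem isClosed_carrier {f : Face d} (hf : f ∈ faces s Ω 𝒯) : IsClosed f.carrier := by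
  rcases mem_faces.1 hf with h | h
  · obtain ⟨T, _, T', _, _, rfl, _⟩ := mem_interiorFaces.1 h
    exact isClosed_closure.inter isClosed_closure
  · obtain ⟨T, _, G, hG, rfl, _⟩ := mem_boundaryFaces.1 h
    exact (isClosed_image_facet s T hG).inter isClosed_frontier

theorem mem_mesh_of_mem_cells {f : Face d} (hf : f ∈ faces s Ω 𝒯) {T : Cell d}
    (hT : T ∈ f.cells) : T ∈ 𝒯 := by
  classical
  rcases mem_faces.1 hf with h | h
  · obtain ⟨T₁, h₁, T₂, h₂, _, rfl, _⟩ := mem_interiorFaces.1 h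
    simp only [Finset.mem_insert, Finset.mem_singleton] at hT
    rcases hT with rfl | rfl <;> assumption
  · obtain ⟨T₁, h₁, G, hG, rfl, _⟩ := mem_boundaryFaces.1 h
    rwa [Finset.mem_singleton.1 hT]

theorem cells_nonempty {f : Face d} (hf : f ∈ faces s Ω 𝒯) : f.cells.Nonempty := by
  classical
  rcases mem_faces.1 hf with h | h
  · obtain ⟨T₁, h₁, T₂, h₂, _, rfl, _⟩ := mem_interiorFaces.1 h
    exact ⟨T₁, by simp⟩
  · obtain ⟨T₁, h₁, G, hG, rfl, _⟩ := mem_boundaryFaces.1 h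
    exact ⟨T₁, by simp⟩

theorem image_facet_subset_closure {T : Cell d} {G : Set (E d)} (hG : G ∈ refFacets d s) :
    T '' G ⊆ closure (cell s T) := by
  rw [closure_cell]; exact Set.image_mono (refFacets_subset_closure hG)

theorem carrier_subset_closure {f : Face d} (hf : f ∈ faces s Ω 𝒯) {T : Cell d}
    (hT : T ∈ f.cells) : f.carrier ⊆ closure (cell s T) := by
  classical
  rcases mem_faces.1 hf with h | h
  · obtain ⟨T₁, h₁, T₂, h₂, _, rfl, _⟩ := mem_interiorFaces.1 h
    simp only [Finset.mem_insert, Finset.mem_singleton] at hT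
    rcases hT with rfl | rfl
    · exact Set.inter_subset_left
    · exact Set.inter_subset_right
  · obtain ⟨T₁, h₁, G, hG, rfl, _⟩ := mem_boundaryFaces.1 h
    rw [Finset.mem_singleton.1 hT]
    exact Set.inter_subset_left.trans (image_facet_subset_closure hG)

/-- Hahn–Banach separates the two disjoint open convex elements. The common part of their closures
lies in the separating hyperplane, whose normal serves both elements with opposite signs. -/
theorem exists_separating_normal {T T' : Cell d} (h : Disjoint (cell s T) (cell s T')) :
    ∃ n : E d, IsFacet (cell s T) (closure (cell s T) ∩ closure (cell s T')) n ∧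
      IsFacet (cell s T') (closure (cell s T) ∩ closure (cell s T')) (-n) := by
  obtain ⟨L, u, h1, h2⟩ := geometric_hahn_banach_open_open (convex_cell s T) (isOpen_cell s T)
    (convex_cell s T') (isOpen_cell s T') h
  have hcl1 : ∀ x ∈ closure (cell s T), L x ≤ u := fun x hx =>
    ((isClosed_le L.continuous continuous_const).closure_subset_iff.2
      (fun y hy => (h1 y hy).le)) hx
  have hcl2 : ∀ x ∈ closure (cell s T'), u ≤ L x := fun x hx =>
    ((isClosed_le continuous_const L.continuous).closure_subset_iff.2
      (fun y hy => (h2 y hy).le)) hx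
  obtain ⟨y, hy⟩ := cell_nonempty s T
  obtain ⟨y', hy'⟩ := cell_nonempty s T'
  have hL : (L : E d →ₗ[ℝ] ℝ) ≠ 0 := by
    intro h0
    have e : ∀ z, L z = 0 := fun z => by
      have := congrArg (fun f : E d →ₗ[ℝ] ℝ => f z) h0
      simpa using this
    have a := h1 y hy
    have b := h2 y' hy'
    rw [e] at a b
    linarith
  obtain ⟨n, hn, hle⟩ := exists_unit_of_form
    (F := {w : E d | w = 0})
    (C := {w | L w ≤ 0}) hL (by
      rintro x hx w hw
      have hx0 : x = 0 := hx
      rw [hx0, sub_zero]; exact hw)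
  have hle' : ∀ w, L w ≤ 0 → ⟪n, w⟫ ≤ 0 := by
    intro w hw
    have := hle 0 rfl w hw
    rwa [sub_zero] at this
  refine ⟨n, ⟨Set.inter_subset_left, hn, fun x hx y hy => ?_⟩,
    ⟨Set.inter_subset_right, by rw [norm_neg, hn], fun x hx y hy => ?_⟩⟩
  · apply hle'
    rw [map_sub]
    linarith [h1 y hy, hcl2 x hx.2]
  · rw [inner_neg_left, ← inner_neg_right, neg_sub]
    apply hle'
    rw [map_sub]
    linarith [h2 y hy, hcl1 x hx.1]

/-- `normal` is an arbitrary choice, meaningful only once some admissible vector exists: the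
separating normal on an interior face, the facet normal on a boundary face. -/
theorem isFacet_normal {f : Face d} (hP : IsPartition s Ω 𝒯) (hf : f ∈ faces s Ω 𝒯) {T : Cell d}
    (hT : T ∈ f.cells) : IsFacet (cell s T) f.carrier (normal s T f) := by
  classical
  have hex : ∃ n : E d, ‖n‖ = 1 ∧ ∀ x ∈ f.carrier, ∀ y ∈ cell s T, ⟪n, y - x⟫ ≤ 0 := by
    rcases mem_faces.1 hf with h | h
    · obtain ⟨T₁, h₁, T₂, h₂, hne, rfl, _⟩ := mem_interiorFaces.1 h
      obtain ⟨n, hn1, hn2⟩ := exists_separating_normal (hP.disjoint T₁ h₁ T₂ h₂ hne)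
      simp only [Finset.mem_insert, Finset.mem_singleton] at hT
      rcases hT with rfl | rfl
      · exact ⟨n, hn1.norm, hn1.inner_le⟩
      · exact ⟨-n, hn2.norm, hn2.inner_le⟩
    · have hne := carrier_nonempty hf
      obtain ⟨T₁, h₁, G, hG, rfl, _⟩ := mem_boundaryFaces.1 h
      rw [Finset.mem_singleton.1 hT]
      obtain ⟨n, hn, hle⟩ := exists_normal_facet T₁ hG (by
        obtain ⟨x, ⟨y, hy, _⟩, _⟩ := hne
        exact ⟨y, hy⟩)
      exact ⟨n, hn, fun x hx => hle x hx.1⟩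
  have := Classical.epsilon_spec hex
  exact ⟨carrier_subset_closure hf hT, this.1, this.2⟩

/-- The two normals on an interior face are opposite. -/
theorem exists_cells_of_mem_interiorFaces (hd : 2 ≤ d) {f : Face d} (hP : IsPartition s Ω 𝒯)
    (hf : f ∈ interiorFaces s 𝒯) :
    ∃ T ∈ 𝒯, ∃ T' ∈ 𝒯, T ≠ T' ∧ (∀ S, S ∈ f.cells ↔ S = T ∨ S = T') ∧ f.cells.card = 2 ∧
      (∀ {M : Type} [AddCommMonoid M] (g : Cell d → M), ∑ S ∈ f.cells, g S = g T + g T') ∧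
      f.carrier = closure (cell s T) ∩ closure (cell s T') ∧
      normal s T' f = - normal s T f := by
  classical
  have hf' : f ∈ faces s Ω 𝒯 := mem_faces.2 (Or.inl hf)
  obtain ⟨T, hT, T', hT', hne, hfe, hpos⟩ := mem_interiorFaces.1 hf
  have hc : f.cells = {T, T'} := by rw [hfe]
  have hcar : f.carrier = closure (cell s T) ∩ closure (cell s T') := by rw [hfe]
  refine ⟨T, hT, T', hT', hne, fun S => by simp [hc], by rw [hc, Finset.card_pair hne],
    fun g => by rw [hc, Finset.sum_pair hne], hcar, ?_⟩
  obtain ⟨n, hn1, hn2⟩ := exists_separating_normal (hP.disjoint T hT T' hT' hne)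
  rw [← hcar] at hn1 hn2
  have e1 := (isFacet_normal hP hf' (T := T) (by simp [hc])).eq_of_surface_pos hd (isOpen_cell s T)
    (cell_nonempty s T) hpos hn1
  have e2 := (isFacet_normal hP hf' (T := T') (by simp [hc])).eq_of_surface_pos hd
    (isOpen_cell s T') (cell_nonempty s T') hpos hn2
  rw [e1, e2]

end Faces

/-! ### Packing -/

/-- Volume comparison: the disjoint balls of radius ρ fit into one ball of radius R. -/
theorem card_le_of_disjoint_balls {d : ℕ} {ι : Type*} (S : Finset ι) (A : ι → Set (E d))
    {x₀ : E d} {R ρ : ℝ} (hR : 0 ≤ R) (hρ : 0 < ρ)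
    (hdisj : ∀ i ∈ S, ∀ j ∈ S, i ≠ j → Disjoint (A i) (A j))
    (hball : ∀ i ∈ S, ∃ x, Metric.ball x ρ ⊆ A i) (hA : ∀ i ∈ S, A i ⊆ Metric.closedBall x₀ R) :
    (S.card : ℝ) ≤ (R / ρ) ^ d := by
  classical
  choose! x hx using hball
  set c := (volume (Metric.ball (0 : E d) 1)).toReal with hc
  have hcpos : 0 < c := ENNReal.toReal_pos (Metric.measure_ball_pos volume _ one_pos).ne'
    Metric.isBounded_ball.measure_lt_top.ne
  have hvol : ∀ y : E d, volume.real (Metric.ball y ρ) = ρ ^ d * c := by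
    intro y
    rw [Measure.real, Measure.addHaar_ball_of_pos volume y hρ, finrank_euclideanSpace_fin,
      ENNReal.toReal_mul, ENNReal.toReal_ofReal (by positivity)]
  have hvol' : volume.real (Metric.closedBall x₀ R) = R ^ d * c := by
    rw [Measure.real, Measure.addHaar_closedBall volume x₀ hR, finrank_euclideanSpace_fin,
      ENNReal.toReal_mul, ENNReal.toReal_ofReal (by positivity)]
  have hsum : ∑ i ∈ S, volume.real (Metric.ball (x i) ρ) ≤
      volume.real (Metric.closedBall x₀ R) := by
    rw [← measureReal_biUnion_finset (μ := volume) ?_ (fun i _ => measurableSet_ball)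
      (fun i _ => Metric.isBounded_ball.measure_lt_top.ne)]
    · refine measureReal_mono ?_ Metric.isBounded_closedBall.measure_lt_top.ne
      exact Set.iUnion₂_subset fun i hi => (hx i hi).trans (hA i hi)
    · intro i hi j hj hij
      exact (hdisj i hi j hj hij).mono (hx i hi) (hx j hj)
  simp only [hvol, hvol', Finset.sum_const, nsmul_eq_mul] at hsum
  rw [div_pow, le_div_iff₀ (by positivity)]
  exact le_of_mul_le_mul_right (by linarith) hcpos

/-! ### Polynomial functions -/

/-- On each line through a point of U, the two univariate polynomials agree at infinitely many
parameters. -/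
theorem IsPolyOnLines.eq_of_eqOn {d N M : ℕ} {f g : E d → ℝ} (hf : IsPolyOnLines N f)
    (hg : IsPolyOnLines M g) {U : Set (E d)} (hU : IsOpen U) (hne : U.Nonempty)
    (h : ∀ x ∈ U, f x = g x) : f = g := by
  obtain ⟨x₀, hx₀⟩ := hne
  ext x
  obtain ⟨p, -, hp⟩ := hf x₀ (x - x₀)
  obtain ⟨q, -, hq⟩ := hg x₀ (x - x₀)
  have hc : Continuous fun t : ℝ => x₀ + t • (x - x₀) := by fun_prop
  have hopen : IsOpen ((fun t : ℝ => x₀ + t • (x - x₀)) ⁻¹' U) := hU.preimage hc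
  have hinf : ((fun t : ℝ => x₀ + t • (x - x₀)) ⁻¹' U).Infinite :=
    infinite_of_mem_nhds (0 : ℝ) (hopen.mem_nhds (by simpa using hx₀))
  have hpq : p = q := Polynomial.eq_of_infinite_eval_eq p q (hinf.mono fun t ht => by
    have := h _ ht
    simpa only [Set.mem_ofPred_eq, hp, hq] using this)
  have h1 := hp 1
  have h2 := hq 1
  rw [one_smul, add_sub_cancel] at h1 h2
  rw [h1, h2, hpq]

/-- A common bound for both shapes: p is enough on the simplex and d p on the hypercube. -/
theorem totalDegree_le_of_mem_refPoly {d : ℕ} {s : Shape} {p : ℕ} {P : MvPolynomial (Fin d) ℝ}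
    (hP : P ∈ refPoly d s p) : P.totalDegree ≤ d * p + p := by
  cases s
  · have := (MvPolynomial.mem_restrictTotalDegree (Fin d) p P).1 hP
    omega
  · have hP' := (MvPolynomial.mem_restrictDegree (Fin d) P p).1 hP
    refine le_trans ?_ (Nat.le_add_right _ _)
    refine Finset.sup_le fun m hm => ?_
    have h1 : m.sum (fun _ e => e) = ∑ i, m i := m.sum_fintype _ fun _ => rfl
    rw [h1]
    calc ∑ i, m i ≤ ∑ _i : Fin d, p := Finset.sum_le_sum fun i _ => hP' m hm i
      _ = d * p := by simp

theorem refPoly_mono {d : ℕ} {s : Shape} {p q : ℕ} (h : p ≤ q) : refPoly d s p ≤ refPoly d s q := by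
  intro P hP
  cases s
  · exact (MvPolynomial.mem_restrictTotalDegree _ _ _).2
      (((MvPolynomial.mem_restrictTotalDegree (Fin d) p P).1 hP).trans h)
  · exact (MvPolynomial.mem_restrictDegree _ _ _).2 fun m hm i =>
      ((MvPolynomial.mem_restrictDegree (Fin d) P p).1 hP m hm i).trans h

instance finiteDimensional_refPoly (d : ℕ) (s : Shape) (p : ℕ) :
    FiniteDimensional ℝ (refPoly d s p) := by
  cases s
  · exact inferInstanceAs (Module.Finite ℝ (MvPolynomial.restrictTotalDegree (Fin d) ℝ p))
  · exact inferInstanceAs (Module.Finite ℝ (MvPolynomial.restrictDegree (Fin d) ℝ p))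

namespace Level

variable {d : ℕ}

theorem contDiff_pushPoly (T : Cell d) (P : MvPolynomial (Fin d) ℝ) :
    ContDiff ℝ 1 (pushPoly T P) := by
  have hT : ContDiff ℝ 1 (T.symm : E d → E d) :=
    (AffineEquiv.toContinuousAffineEquiv T.symm).toContinuousAffineMap.contDiff
  have hcoord : ∀ i : Fin d, ContDiff ℝ 1 fun x => T.symm x i := fun i => by fun_prop
  unfold pushPoly
  simp_rw [MvPolynomial.eval_eq]
  refine ContDiff.sum fun m _ => contDiff_const.mul ?_
  exact contDiff_prod fun i _ => (hcoord i).pow _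

theorem isPolyOnLines_pushPoly (T : Cell d) {s : Shape} {p : ℕ} {P : MvPolynomial (Fin d) ℝ}
    (hP : P ∈ refPoly d s p) : IsPolyOnLines (d * p + p) (pushPoly T P) := by
  intro x v
  refine ⟨MvPolynomial.aeval (fun i => Polynomial.C (T.symm x i) +
    Polynomial.C (T.symm.linear v i) * Polynomial.X) P, ?_, fun t => ?_⟩
  · have := MvPolynomial.aeval_natDegree_le (n := 1) P (totalDegree_le_of_mem_refPoly hP)
      (fun i => Polynomial.C (T.symm x i) + Polynomial.C (T.symm.linear v i) * Polynomial.X)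
      (fun i => by
        rw [add_comm]
        exact Polynomial.natDegree_linear_le)
    simpa using this
  · have h1 : T.symm (x + t • v) = T.symm x + t • T.symm.linear v := by
      have := (T.symm : E d →ᵃ[ℝ] E d).map_vadd x (t • v)
      simp only [vadd_eq_add, map_smul, AffineEquiv.coe_toAffineMap, AffineEquiv.linear_toAffineMap]
        at this
      rw [add_comm x, this, add_comm]
      rfl
    rw [pushPoly, h1, ← Polynomial.coe_evalRingHom, MvPolynomial.aeval_def,
      MvPolynomial.hom_eval₂]
    have : (Polynomial.evalRingHom t).comp (algebraMap ℝ (Polynomial ℝ)) = RingHom.id ℝ := by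
      ext a; simp
    rw [this]
    unfold MvPolynomial.eval
    rw [MvPolynomial.coe_eval₂Hom]
    congr 1
    ext i
    simp only [Polynomial.coe_evalRingHom, Polynomial.eval_add, Polynomial.eval_mul,
      Polynomial.eval_C, Polynomial.eval_X, PiLp.add_apply, PiLp.smul_apply, smul_eq_mul]
    ring

variable {Ω : Set (E d)} (D : Level d Ω)

theorem exists_on_eq (v : D.V) (T : Cell d) :
    ∃ P ∈ refPoly d D.shape D.degree, D.on v T = pushPoly T P := by
  by_cases h : T ∈ D.mesh
  · exact ⟨_, (v.2 T h).choose_spec.1, by rw [on, dif_pos h]⟩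
  · refine ⟨0, Submodule.zero_mem _, ?_⟩
    rw [on, dif_neg h]
    ext x; simp [pushPoly]

theorem contDiff_on (v : D.V) (T : Cell d) : ContDiff ℝ 1 (D.on v T) := by
  obtain ⟨P, _, h⟩ := D.exists_on_eq v T
  rw [h]; exact contDiff_pushPoly T P

@[fun_prop]
theorem continuous_on (v : D.V) (T : Cell d) : Continuous (D.on v T) :=
  (D.contDiff_on v T).continuous

@[fun_prop]
theorem continuous_gradient_on (v : D.V) (T : Cell d) : Continuous (gradient (D.on v T)) := by
  have := (D.contDiff_on v T).continuous_fderiv (by norm_num)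
  exact (InnerProductSpace.toDual ℝ (E d)).symm.continuous.comp this

theorem isPolyOnLines_on (v : D.V) (T : Cell d) :
    IsPolyOnLines (d * D.degree + D.degree) (D.on v T) := by
  obtain ⟨P, hP, h⟩ := D.exists_on_eq v T
  rw [h]; exact isPolyOnLines_pushPoly T hP

theorem on_ae (v : D.V) {T : Cell d} (hT : T ∈ D.mesh) :
    ∀ᵐ x ∂(volume.restrict Ω), x ∈ cell D.shape T → v.1 x = D.on v T x := by
  rw [on, dif_pos hT]
  exact (v.2 T hT).choose_spec.2

end Level

/-! ### Integration over partitions and faces -/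

section Mesh

variable {d : ℕ} {s : Shape} {Ω : Set (E d)} {𝒯 : Finset (Cell d)}

theorem IsPartition.isOpen (hP : IsPartition s Ω 𝒯) : IsOpen Ω := by
  rw [hP.cover]; exact isOpen_interior

theorem IsPartition.cell_subset (hP : IsPartition s Ω 𝒯) {T : Cell d} (hT : T ∈ 𝒯) :
    cell s T ⊆ Ω := by
  rw [hP.cover]
  exact interior_maximal (subset_closure.trans
    (Set.subset_biUnion_of_mem (u := fun T => closure (cell s T)) hT)) (isOpen_cell s T)

/-- The closed elements cover Ω, and the frontiers of the convex elements are null sets. -/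
theorem IsPartition.ae_eq (hP : IsPartition s Ω 𝒯) :
    (⋃ T ∈ 𝒯, cell s T) =ᵐ[volume] Ω := by
  have hsub : (⋃ T ∈ 𝒯, cell s T) ⊆ Ω := Set.iUnion₂_subset fun T hT => hP.cell_subset hT
  refine hsub.eventuallyLE.antisymm ?_
  have hnull : volume (⋃ T ∈ 𝒯, frontier (cell s T)) = 0 :=
    (measure_biUnion_null_iff 𝒯.countable_toSet).2 fun T _ => volume_frontier_cell s T
  have hnull' : ∀ᵐ x, x ∉ ⋃ T ∈ 𝒯, frontier (cell s T) := measure_eq_zero_iff_ae_notMem.1 hnull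
  filter_upwards [hnull'] with x hx hxΩ
  have hx2 : x ∈ ⋃ T ∈ 𝒯, closure (cell s T) := by
    have : x ∈ interior (⋃ T ∈ 𝒯, closure (cell s T)) := hP.cover ▸ hxΩ
    exact interior_subset this
  obtain ⟨T, hT, hxT⟩ := Set.mem_iUnion₂.1 hx2
  have hnf : x ∉ frontier (cell s T) := fun h => hx (Set.mem_iUnion₂.2 ⟨T, hT, h⟩)
  refine Set.mem_iUnion₂.2 ⟨T, hT, ?_⟩
  by_contra hnot
  exact hnf (by rw [(isOpen_cell s T).frontier_eq]; exact ⟨hxT, hnot⟩)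

theorem IsPartition.integral_eq_sum (hP : IsPartition s Ω 𝒯) {f : E d → ℝ}
    (hf : ∀ T ∈ 𝒯, IntegrableOn f (cell s T)) :
    ∫ x in Ω, f x = ∑ T ∈ 𝒯, ∫ x in cell s T, f x := by
  rw [← Measure.restrict_congr_set hP.ae_eq]
  exact integral_biUnion_finset 𝒯 (fun T _ => measurableSet_cell s T)
    (fun T hT T' hT' hne => hP.disjoint T hT T' hT' hne) hf

theorem integrableOn_cell {M : Type*} [NormedAddCommGroup M] {f : E d → M} (hf : Continuous f)
    (T : Cell d) : IntegrableOn f (cell s T) :=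
  (hf.continuousOn.integrableOn_compact (isBounded_cell s T).isCompact_closure).mono_set
    subset_closure

theorem surface_carrier_lt_top (hP : IsPartition s Ω 𝒯) {f : Face d} (hf : f ∈ faces s Ω 𝒯) :
    surface d f.carrier < ⊤ := by
  obtain ⟨T, hT⟩ := cells_nonempty hf
  obtain ⟨x, hx⟩ := cell_nonempty s T
  obtain ⟨r, hr, hball⟩ := Metric.isOpen_iff.1 (isOpen_cell s T) x hx
  exact (isFacet_normal hP hf hT).surface_lt_top (convex_cell s T) (isBounded_cell s T) hr hball

theorem isBounded_carrier {f : Face d} (hf : f ∈ faces s Ω 𝒯) :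
    Bornology.IsBounded f.carrier := by
  obtain ⟨T, hT⟩ := cells_nonempty hf
  exact (isBounded_cell s T).closure.subset (carrier_subset_closure hf hT)

theorem integrableOn_of_isBounded {A : Set (E d)} (hA : Bornology.IsBounded A)
    (hfin : surface d A < ⊤) (hAm : MeasurableSet A) {g : E d → ℝ} (hg : Continuous g) :
    IntegrableOn g A (surface d) := by
  obtain ⟨C, hC⟩ := hA.isCompact_closure.exists_bound_of_continuousOn hg.continuousOn
  refine Measure.integrableOn_of_bounded (M := C) hfin.ne hg.aestronglyMeasurable ?_
  exact (ae_restrict_iff' hAm).2 (Filter.Eventually.of_forall fun x hx =>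
    hC x (subset_closure hx))

theorem integrableOn_carrier (hP : IsPartition s Ω 𝒯) {f : Face d} (hf : f ∈ faces s Ω 𝒯)
    {g : E d → ℝ} (hg : Continuous g) : IntegrableOn g f.carrier (surface d) :=
  integrableOn_of_isBounded (isBounded_carrier hf) (surface_carrier_lt_top hP hf)
    (isClosed_carrier hf).measurableSet hg

end Mesh

/-! ### Polynomial representatives and finite dimension of the DG space -/

namespace Level

variable {d : ℕ} {Ω : Set (E d)} {D : Level d Ω}

/-- The standing assumption on a level: its mesh is a partition of `Ω`. -/
abbrev IsMesh (D : Level d Ω) : Prop := IsPartition D.shape Ω D.mesh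

theorem on_ae_cell (hP : D.IsMesh) (v : D.V) {T : Cell d} (hT : T ∈ D.mesh) :
    ∀ᵐ x ∂(volume.restrict (cell D.shape T)), v.1 x = D.on v T x := by
  have h := D.on_ae v hT
  have h2 := ae_mono (Measure.restrict_mono (hP.cell_subset hT) le_rfl) h
  filter_upwards [h2, ae_restrict_mem (measurableSet_cell D.shape T)] with x h3 h4
  exact h3 h4

/-- The representative `on` is obtained by choice from an almost everywhere statement. Polynomial
functions that agree almost everywhere on a nonempty open set coincide, so traces are well defined.
Linearity of `on` and its behaviour under refinement both rest on this. -/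
theorem on_unique (hP : D.IsMesh) (v : D.V) {T : Cell d} (hT : T ∈ D.mesh) {N : ℕ} {g : E d → ℝ}
    (hg : Continuous g) (hgN : IsPolyOnLines N g) {U : Set (E d)} (hU : IsOpen U)
    (hUne : U.Nonempty) (hUT : U ⊆ cell D.shape T)
    (h : ∀ᵐ x ∂(volume.restrict U), v.1 x = g x) : D.on v T = g := by
  have h1 := ae_mono (Measure.restrict_mono hUT le_rfl) (on_ae_cell hP v hT)
  refine (D.isPolyOnLines_on v T).eq_of_eqOn hgN hU hUne ?_
  have h2 : ∀ᵐ x ∂(volume.restrict U), D.on v T x = g x := by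
    filter_upwards [h, h1] with x ha hb
    rw [← hb, ha]
  exact Measure.eqOn_open_of_ae_eq h2 hU (by fun_prop) hg.continuousOn

theorem isPolyOnLines_add {N : ℕ} {f g : E d → ℝ} (hf : IsPolyOnLines N f)
    (hg : IsPolyOnLines N g) : IsPolyOnLines N (f + g) := by
  intro x v
  obtain ⟨p, hp, hp'⟩ := hf x v
  obtain ⟨q, hq, hq'⟩ := hg x v
  exact ⟨p + q, (Polynomial.natDegree_add_le _ _).trans (max_le hp hq), fun t => by
    simp [hp', hq']⟩

theorem isPolyOnLines_smul {N : ℕ} {f : E d → ℝ} (a : ℝ) (hf : IsPolyOnLines N f) :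
    IsPolyOnLines N (a • f) := by
  intro x v
  obtain ⟨p, hp, hp'⟩ := hf x v
  exact ⟨a • p, (Polynomial.natDegree_smul_le _ _).trans hp, fun t => by simp [hp']⟩

theorem on_add (hP : D.IsMesh) (v w : D.V) (T : Cell d) :
    D.on (v + w) T = D.on v T + D.on w T := by
  by_cases hT : T ∈ D.mesh
  · refine on_unique hP _ hT ((D.continuous_on v T).add (D.continuous_on w T))
      (isPolyOnLines_add (D.isPolyOnLines_on v T) (D.isPolyOnLines_on w T))
      (isOpen_cell D.shape T) (cell_nonempty D.shape T) subset_rfl ?_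
    have h := ae_mono (Measure.restrict_mono (hP.cell_subset hT) le_rfl) (Lp.coeFn_add v.1 w.1)
    filter_upwards [h, on_ae_cell hP v hT, on_ae_cell hP w hT] with x h1 h2 h3
    rw [Submodule.coe_add, h1, Pi.add_apply, Pi.add_apply, h2, h3]
  · simp [on, hT]

theorem on_smul (hP : D.IsMesh) (a : ℝ) (v : D.V) (T : Cell d) :
    D.on (a • v) T = a • D.on v T := by
  by_cases hT : T ∈ D.mesh
  · refine on_unique hP _ hT ((D.continuous_on v T).const_smul a)
      (isPolyOnLines_smul a (D.isPolyOnLines_on v T))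
      (isOpen_cell D.shape T) (cell_nonempty D.shape T) subset_rfl ?_
    have h := ae_mono (Measure.restrict_mono (hP.cell_subset hT) le_rfl) (Lp.coeFn_smul a v.1)
    filter_upwards [h, on_ae_cell hP v hT] with x h1 h2
    rw [Submodule.coe_smul, h1, Pi.smul_apply, Pi.smul_apply, h2]
  · simp [on, hT]

theorem ext_on (hP : D.IsMesh) {v w : D.V} (h : ∀ T ∈ D.mesh, ∀ x ∈ cell D.shape T,
    D.on v T x = D.on w T x) : v = w := by
  apply Subtype.ext
  apply Lp.ext
  have hae : ∀ᵐ x ∂(volume.restrict (⋃ T ∈ D.mesh, cell D.shape T)), v.1 x = w.1 x := by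
    rw [ae_restrict_biUnion_finset_iff]
    intro T hT
    filter_upwards [on_ae_cell hP v hT, on_ae_cell hP w hT,
      ae_restrict_mem (measurableSet_cell D.shape T)] with x h1 h2 h3
    rw [h1, h2, h T hT x h3]
  rw [Measure.restrict_congr_set hP.ae_eq] at hae
  exact hae

/-- Restriction to an element as a linear map. -/
def onLinear (hP : D.IsMesh) (T : Cell d) : D.V →ₗ[ℝ] (E d → ℝ) where
  toFun v := D.on v T
  map_add' v w := on_add hP v w T
  map_smul' a v := on_smul hP a v T

/-- The linear map `P ↦ P ∘ F_T⁻¹`. -/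
def pushLinear (T : Cell d) : MvPolynomial (Fin d) ℝ →ₗ[ℝ] (E d → ℝ) where
  toFun P := pushPoly T P
  map_add' P Q := by ext x; exact pushPoly_add T P Q x
  map_smul' a P := by ext x; exact pushPoly_smul T a P x

/-- The restrictions to the elements embed V into a finite product of finite dimensional polynomial
spaces. -/
theorem finiteDimensional_V (hP : D.IsMesh) : FiniteDimensional ℝ D.V := by
  set W : {T // T ∈ D.mesh} → Submodule ℝ (E d → ℝ) := fun T =>
    (refPoly d D.shape D.degree).map (pushLinear T.1) with hW
  have hmem : ∀ (T : {T // T ∈ D.mesh}) (v : D.V), onLinear hP T.1 v ∈ W T := by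
    intro T v
    obtain ⟨P, hPm, h⟩ := D.exists_on_eq v T.1
    exact ⟨P, hPm, h.symm⟩
  let Φ : D.V →ₗ[ℝ] (∀ T, W T) := LinearMap.pi fun T => (onLinear hP T.1).codRestrict (W T) (hmem T)
  have hinj : Function.Injective Φ := by
    intro v w hvw
    refine ext_on hP fun T hT x _ => ?_
    have := congrFun hvw ⟨T, hT⟩
    have := congrArg Subtype.val this
    exact congrFun this x
  exact FiniteDimensional.of_injective Φ hinj

end Level

namespace Level

variable {d : ℕ} {Ω : Set (E d)} {D : Level d Ω}

/-! ### The lifting operators -/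

/-- The `L²` inner product on `[V]ᵈ`. -/
def pairing (r η : Fin d → D.V) : ℝ := ∑ i, ⟪(r i).1, (η i).1⟫

theorem integral_eq_pairing (r η : Fin d → D.V) :
    ∫ x in Ω, ∑ i, (r i).1 x * (η i).1 x = pairing r η := by
  have hint : ∀ i, Integrable (fun x => (r i).1 x * (η i).1 x) (volume.restrict Ω) := by
    intro i
    have := L2.integrable_inner (𝕜 := ℝ) (r i).1 (η i).1
    refine this.congr (Filter.Eventually.of_forall fun x => ?_)
    simp [mul_comm]
  rw [integral_finsetSum _ fun i _ => hint i, pairing]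
  refine Finset.sum_congr rfl fun i _ => ?_
  rw [L2.inner_def]
  refine integral_congr_ae (Filter.Eventually.of_forall fun x => ?_)
  simp [mul_comm]

theorem pairing_add_left (r r' η : Fin d → D.V) :
    pairing (r + r') η = pairing r η + pairing r' η := by
  simp [pairing, inner_add_left, Finset.sum_add_distrib]

theorem pairing_smul_left (a : ℝ) (r η : Fin d → D.V) :
    pairing (a • r) η = a * pairing r η := by
  simp [pairing, inner_smul_left, Finset.mul_sum]

theorem pairing_sum_left {ι : Type*} (S : Finset ι) (r : ι → Fin d → D.V) (η : Fin d → D.V) :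
    pairing (∑ j ∈ S, r j) η = ∑ j ∈ S, pairing (r j) η := by
  classical
  induction S using Finset.induction_on with
  | empty => simp [pairing]
  | insert j S hj ih => rw [Finset.sum_insert hj, Finset.sum_insert hj, pairing_add_left, ih]

theorem ext_pairing {r r' : Fin d → D.V} (h : ∀ η, pairing r η = pairing r' η) : r = r' := by
  have h1 : pairing (r + (-1 : ℝ) • r') (r + (-1 : ℝ) • r') = 0 := by
    rw [pairing_add_left, pairing_smul_left, h]; ring
  rw [pairing] at h1
  rw [Finset.sum_eq_zero_iff_of_nonneg fun i _ => real_inner_self_nonneg] at h1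
  ext1 i
  have := inner_self_eq_zero.1 (h1 i (Finset.mem_univ i))
  apply Subtype.ext
  simpa [add_neg_eq_zero] using this

/-- Riesz representation in each component of the finite dimensional space [V]ᵈ. This is what makes
the liftings exist. -/
theorem exists_pairing_eq (hP : D.IsMesh) (ℓ : (Fin d → D.V) →ₗ[ℝ] ℝ) :
    ∃ r : Fin d → D.V, ∀ η, pairing r η = ℓ η := by
  have := finiteDimensional_V hP
  have hc : CompleteSpace D.V := FiniteDimensional.complete ℝ D.V
  refine ⟨fun i => (InnerProductSpace.toDual ℝ D.V).symm
    (LinearMap.toContinuousLinearMap (ℓ ∘ₗ LinearMap.single ℝ (fun _ => D.V) i)), fun η => ?_⟩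
  have h1 : ∀ i, ⟪((InnerProductSpace.toDual ℝ D.V).symm (LinearMap.toContinuousLinearMap
      (ℓ ∘ₗ LinearMap.single ℝ (fun _ => D.V) i))).1, (η i).1⟫ = ℓ (Pi.single i (η i)) := by
    intro i
    rw [← Submodule.coe_inner, InnerProductSpace.toDual_symm_apply]
    rfl
  rw [pairing]
  simp only [h1]
  rw [← map_sum, Finset.univ_sum_single]

@[fun_prop]
theorem continuous_jump (v : D.V) (f : Face d) : Continuous (D.jump v f) := by
  unfold jump; fun_prop

@[fun_prop]
theorem continuous_vecOn (η : Fin d → D.V) (T : Cell d) : Continuous (D.vecOn η T) := by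
  unfold vecOn; fun_prop

@[fun_prop]
theorem continuous_vecAvg (η : Fin d → D.V) (f : Face d) : Continuous (D.vecAvg η f) := by
  unfold vecAvg; fun_prop

@[fun_prop]
theorem continuous_vecJump (η : Fin d → D.V) (f : Face d) : Continuous (D.vecJump η f) := by
  unfold vecJump; fun_prop

theorem jump_add (hP : D.IsMesh) (v w : D.V) (f : Face d) (x : E d) :
    D.jump (v + w) f x = D.jump v f x + D.jump w f x := by
  simp [jump, on_add hP, add_smul, Finset.sum_add_distrib]

theorem jump_smul (hP : D.IsMesh) (a : ℝ) (v : D.V) (f : Face d) (x : E d) :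
    D.jump (a • v) f x = a • D.jump v f x := by
  simp [jump, on_smul hP, Finset.smul_sum, mul_smul]

theorem vecOn_add (hP : D.IsMesh) (η ξ : Fin d → D.V) (T : Cell d) (x : E d) :
    D.vecOn (η + ξ) T x = D.vecOn η T x + D.vecOn ξ T x := by
  ext i; simp [vecOn, on_add hP]

theorem vecOn_smul (hP : D.IsMesh) (a : ℝ) (η : Fin d → D.V) (T : Cell d) (x : E d) :
    D.vecOn (a • η) T x = a • D.vecOn η T x := by
  ext i; simp [vecOn, on_smul hP]

theorem vecAvg_add (hP : D.IsMesh) (η ξ : Fin d → D.V) (f : Face d) (x : E d) :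
    D.vecAvg (η + ξ) f x = D.vecAvg η f x + D.vecAvg ξ f x := by
  simp [vecAvg, vecOn_add hP, Finset.sum_add_distrib]

theorem vecAvg_smul (hP : D.IsMesh) (a : ℝ) (η : Fin d → D.V) (f : Face d) (x : E d) :
    D.vecAvg (a • η) f x = a • D.vecAvg η f x := by
  simp only [vecAvg, vecOn_smul hP, ← Finset.smul_sum, smul_comm a]

theorem vecJump_add (hP : D.IsMesh) (η ξ : Fin d → D.V) (f : Face d) (x : E d) :
    D.vecJump (η + ξ) f x = D.vecJump η f x + D.vecJump ξ f x := by
  simp [vecJump, vecOn_add hP, inner_add_left, Finset.sum_add_distrib]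

theorem vecJump_smul (hP : D.IsMesh) (a : ℝ) (η : Fin d → D.V) (f : Face d) (x : E d) :
    D.vecJump (a • η) f x = a * D.vecJump η f x := by
  simp [vecJump, vecOn_smul hP, inner_smul_left, Finset.mul_sum]

theorem pairing_liftR (hP : D.IsMesh) {f : Face d} (hf : f ∈ faces D.shape Ω D.mesh)
    {τ : E d → E d} (hτ : Continuous τ) (η : Fin d → D.V) :
    pairing (D.liftR f τ) η = -∫ x in f.carrier, ⟪τ x, D.vecAvg η f x⟫ ∂(surface d) := by
  have hint : ∀ η, IntegrableOn (fun x => ⟪τ x, D.vecAvg η f x⟫) f.carrier (surface d) :=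
    fun η => integrableOn_carrier hP hf (by fun_prop)
  let ℓ : (Fin d → D.V) →ₗ[ℝ] ℝ :=
    { toFun := fun η => -∫ x in f.carrier, ⟪τ x, D.vecAvg η f x⟫ ∂(surface d)
      map_add' := fun η ξ => by
        simp only [vecAvg_add hP, inner_add_right]
        rw [integral_add (hint η) (hint ξ)]; ring
      map_smul' := fun a η => by
        simp only [vecAvg_smul hP, inner_smul_right, integral_const_mul, RingHom.id_apply,
          smul_eq_mul]
        ring }
  obtain ⟨r, hr⟩ := exists_pairing_eq hP ℓ
  have hex : ∃ r : Fin d → D.V, ∀ η : Fin d → D.V, ∫ x in Ω, ∑ i, (r i).1 x * (η i).1 x =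
      -∫ x in f.carrier, ⟪τ x, D.vecAvg η f x⟫ ∂(surface d) :=
    ⟨r, fun η => (integral_eq_pairing r η).trans (hr η)⟩
  rw [← Classical.epsilon_spec hex η, integral_eq_pairing]
  rfl

theorem pairing_liftL (hP : D.IsMesh) {f : Face d} (hf : f ∈ faces D.shape Ω D.mesh)
    {q : E d → ℝ} (hq : Continuous q) (η : Fin d → D.V) :
    pairing (D.liftL f q) η = -∫ x in f.carrier, q x * D.vecJump η f x ∂(surface d) := by
  have hint : ∀ η, IntegrableOn (fun x => q x * D.vecJump η f x) f.carrier (surface d) :=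
    fun η => integrableOn_carrier hP hf (by fun_prop)
  let ℓ : (Fin d → D.V) →ₗ[ℝ] ℝ :=
    { toFun := fun η => -∫ x in f.carrier, q x * D.vecJump η f x ∂(surface d)
      map_add' := fun η ξ => by
        simp only [vecJump_add hP, mul_add]
        rw [integral_add (hint η) (hint ξ)]; ring
      map_smul' := fun a η => by
        simp only [vecJump_smul hP, mul_left_comm _ a, integral_const_mul, RingHom.id_apply,
          smul_eq_mul]
        ring }
  obtain ⟨r, hr⟩ := exists_pairing_eq hP ℓ
  have hex : ∃ r : Fin d → D.V, ∀ η : Fin d → D.V, ∫ x in Ω, ∑ i, (r i).1 x * (η i).1 x =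
      -∫ x in f.carrier, q x * D.vecJump η f x ∂(surface d) :=
    ⟨r, fun η => (integral_eq_pairing r η).trans (hr η)⟩
  rw [← Classical.epsilon_spec hex η, integral_eq_pairing]
  rfl

theorem mem_faces_of_interior {f : Face d} (hf : f ∈ interiorFaces D.shape D.mesh) :
    f ∈ faces D.shape Ω D.mesh := mem_faces.2 (Or.inl hf)

theorem pairing_lift (hP : D.IsMesh) (v : D.V) (η : Fin d → D.V) :
    pairing (D.lift v) η =
      (∑ f ∈ faces D.shape Ω D.mesh,
        -∫ x in f.carrier, ⟪D.jump v f x, D.vecAvg η f x⟫ ∂(surface d)) +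
      ∑ f ∈ interiorFaces D.shape D.mesh,
        -∫ x in f.carrier, ⟪D.β f, D.jump v f x⟫ * D.vecJump η f x ∂(surface d) := by
  rw [lift, pairing_add_left, pairing_sum_left, pairing_sum_left]
  congr 1
  · exact Finset.sum_congr rfl fun f hf => pairing_liftR hP hf (by fun_prop) η
  · exact Finset.sum_congr rfl fun f hf =>
      pairing_liftL hP (mem_faces_of_interior hf) (by fun_prop) η

/-- The local liftings are chosen separately for each argument, so linearity is not automatic. It
follows by testing against all η, since the pairing determines its left argument. -/
theorem lift_add (hP : D.IsMesh) (v w : D.V) : D.lift (v + w) = D.lift v + D.lift w := by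
  refine ext_pairing fun η => ?_
  rw [pairing_add_left, pairing_lift hP, pairing_lift hP, pairing_lift hP, add_add_add_comm,
    ← Finset.sum_add_distrib, ← Finset.sum_add_distrib]
  congr 1
  · refine Finset.sum_congr rfl fun f hf => ?_
    simp only [jump_add hP, inner_add_left]
    rw [integral_add (integrableOn_carrier hP hf (by fun_prop))
      (integrableOn_carrier hP hf (by fun_prop))]
    ring
  · refine Finset.sum_congr rfl fun f hf => ?_
    have hf' := mem_faces_of_interior hf
    simp only [jump_add hP, inner_add_right, add_mul]
    rw [integral_add (integrableOn_carrier hP hf' (by fun_prop))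
      (integrableOn_carrier hP hf' (by fun_prop))]
    ring

theorem lift_smul (hP : D.IsMesh) (a : ℝ) (v : D.V) : D.lift (a • v) = a • D.lift v := by
  refine ext_pairing fun η => ?_
  rw [pairing_smul_left, pairing_lift hP, pairing_lift hP, mul_add, Finset.mul_sum,
    Finset.mul_sum]
  congr 1
  · refine Finset.sum_congr rfl fun f hf => ?_
    simp only [jump_smul hP, real_inner_smul_left, integral_const_mul]
    ring
  · refine Finset.sum_congr rfl fun f hf => ?_
    simp only [jump_smul hP, real_inner_smul_right, mul_assoc, integral_const_mul]
    ring

/-! ### The bilinear form -/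

theorem liftFn_ae_cell (hP : D.IsMesh) (v : D.V) {T : Cell d} (hT : T ∈ D.mesh) :
    ∀ᵐ x ∂(volume.restrict (cell D.shape T)), D.liftFn v x = D.vecOn (D.lift v) T x := by
  have h : ∀ᵐ x ∂(volume.restrict (cell D.shape T)), ∀ i,
      (D.lift v i).1 x = D.on (D.lift v i) T x :=
    ae_all_iff.2 fun i => on_ae_cell hP (D.lift v i) hT
  filter_upwards [h] with x hx
  ext i
  exact hx i

/-- The volume terms `∑_T ∫_T ⟪a_T, b_T⟫`. -/
def volForm (D : Level d Ω) (a b : Cell d → E d → E d) : ℝ :=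
  ∑ T ∈ D.mesh, ∫ x in cell D.shape T, ⟪a T x, b T x⟫

theorem integrableOn_inner_cell {s : Shape} {a b : E d → E d} (ha : Continuous a)
    (hb : Continuous b) (T : Cell d) : IntegrableOn (fun x => ⟪a x, b x⟫) (cell s T) :=
  integrableOn_cell (by fun_prop) T

theorem volForm_comm (a b : Cell d → E d → E d) : D.volForm a b = D.volForm b a := by
  simp only [volForm, real_inner_comm]

theorem volForm_add_left {a a' b : Cell d → E d → E d} (ha : ∀ T, Continuous (a T))
    (ha' : ∀ T, Continuous (a' T)) (hb : ∀ T, Continuous (b T)) :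
    D.volForm (a + a') b = D.volForm a b + D.volForm a' b := by
  simp only [volForm, Pi.add_apply, inner_add_left, ← Finset.sum_add_distrib]
  exact Finset.sum_congr rfl fun T _ => integral_add (integrableOn_inner_cell (ha T) (hb T) T)
    (integrableOn_inner_cell (ha' T) (hb T) T)

theorem volForm_smul_left (c : ℝ) (a b : Cell d → E d → E d) :
    D.volForm (c • a) b = c * D.volForm a b := by
  simp only [volForm, Pi.smul_apply, real_inner_smul_left, integral_const_mul, Finset.mul_sum]

theorem volForm_self_nonneg (a : Cell d → E d → E d) : 0 ≤ D.volForm a a :=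
  Finset.sum_nonneg fun _ _ => integral_nonneg fun _ => real_inner_self_nonneg

/-- Young's inequality, from expanding ε times the squared norm of a ± ε⁻¹ b. -/
theorem abs_two_mul_volForm_le {a b : Cell d → E d → E d} (ha : ∀ T, Continuous (a T))
    (hb : ∀ T, Continuous (b T)) {ε : ℝ} (hε : 0 < ε) :
    |2 * D.volForm a b| ≤ ε * D.volForm a a + ε⁻¹ * D.volForm b b := by
  rw [abs_le]
  have key : ∀ c : ℝ, c ^ 2 = 1 →
      0 ≤ ε * D.volForm a a + 2 * c * D.volForm a b + ε⁻¹ * D.volForm b b := by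
    intro c hc
    have hb' : ∀ T, Continuous (((c * ε⁻¹) • b) T) := fun T => (hb T).const_smul (c * ε⁻¹)
    have hcont : ∀ T, Continuous ((a + (c * ε⁻¹) • b) T) := fun T => (ha T).add (hb' T)
    have h := volForm_self_nonneg (D := D) (a + (c * ε⁻¹) • b)
    rw [volForm_add_left ha hb' hcont, volForm_smul_left,
      volForm_comm a, volForm_comm b, volForm_add_left ha hb' ha, volForm_add_left ha hb' hb,
      volForm_smul_left, volForm_smul_left, volForm_comm b a] at h
    have h2 := mul_nonneg hε.le h
    have e : ε * (D.volForm a a + c * ε⁻¹ * D.volForm a b +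
        c * ε⁻¹ * (D.volForm a b + c * ε⁻¹ * D.volForm b b)) =
        ε * D.volForm a a + 2 * c * D.volForm a b + c ^ 2 * ε⁻¹ * D.volForm b b := by
      field_simp
      ring
    rw [e, hc, one_mul] at h2
    exact h2
  have h1 := key 1 (by norm_num)
  have h2 := key (-1) (by norm_num)
  constructor <;> linarith

/-- The broken gradient. -/
def grad (v : D.V) : Cell d → E d → E d := fun T => gradient (D.on v T)

/-- The lifting, element by element. -/
def liftOn (v : D.V) : Cell d → E d → E d := fun T => D.vecOn (D.lift v) T

theorem continuous_grad (v : D.V) (T : Cell d) : Continuous (grad v T) :=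
  D.continuous_gradient_on v T

theorem continuous_liftOn (v : D.V) (T : Cell d) : Continuous (liftOn v T) :=
  continuous_vecOn _ T

/-- The penalty terms. -/
def jumpForm (w v : D.V) : ℝ := ∑ f ∈ faces D.shape Ω D.mesh,
    (∫ x in f.carrier, D.σ f * ⟪D.jump w f x, D.jump v f x⟫ ∂(surface d))

/-- The L² class of the lifting is replaced on each element by its polynomial representative, so
that all integrands become continuous and integrability is immediate. -/
theorem form_eq (hP : D.IsMesh) (w v : D.V) :
    D.form w v = D.volForm (grad w) (grad v) + D.volForm (grad w) (liftOn v) +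
      D.volForm (liftOn w) (grad v) + jumpForm w v +
      D.θ * D.volForm (liftOn w) (liftOn v) := by
  have h2 : ∫ x in Ω, ⟪D.liftFn w x, D.liftFn v x⟫ = D.volForm (liftOn w) (liftOn v) := by
    have hae : ∀ T ∈ D.mesh, (fun x => ⟪D.liftFn w x, D.liftFn v x⟫)
        =ᵐ[volume.restrict (cell D.shape T)] fun x => ⟪liftOn w T x, liftOn v T x⟫ := by
      intro T hT
      filter_upwards [liftFn_ae_cell hP w hT, liftFn_ae_cell hP v hT] with x h1 h2
      rw [h1, h2]; rfl
    rw [hP.integral_eq_sum fun T hT => (integrableOn_inner_cell (continuous_liftOn w T)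
      (continuous_liftOn v T) T).congr (hae T hT).symm]
    exact Finset.sum_congr rfl fun T hT => integral_congr_ae (hae T hT)
  have h3 : ∑ T ∈ D.mesh, ∫ x in cell D.shape T, ⟪gradient (D.on w T) x, D.liftFn v x⟫ =
      D.volForm (grad w) (liftOn v) := by
    refine Finset.sum_congr rfl fun T hT => integral_congr_ae ?_
    filter_upwards [liftFn_ae_cell hP v hT] with x h1
    rw [h1]; rfl
  have h4 : ∑ T ∈ D.mesh, ∫ x in cell D.shape T, ⟪D.liftFn w x, gradient (D.on v T) x⟫ =
      D.volForm (liftOn w) (grad v) := by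
    refine Finset.sum_congr rfl fun T hT => integral_congr_ae ?_
    filter_upwards [liftFn_ae_cell hP w hT] with x h1
    rw [h1]; rfl
  rw [form, h2, h3, h4]
  rfl

theorem jumpForm_comm (w v : D.V) : jumpForm w v = jumpForm v w := by
  simp only [jumpForm, real_inner_comm]

theorem form_comm (hP : D.IsMesh) (w v : D.V) : D.form w v = D.form v w := by
  rw [form_eq hP, form_eq hP, volForm_comm (grad w) (grad v), volForm_comm (grad w) (liftOn v),
    volForm_comm (liftOn w) (grad v), volForm_comm (liftOn w) (liftOn v), jumpForm_comm]
  ring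

theorem grad_add (hP : D.IsMesh) (v w : D.V) : grad (v + w) = grad v + grad w := by
  ext1 T; ext1 x
  simp only [grad, gradient, on_add hP, Pi.add_apply]
  rw [fderiv_add ((D.contDiff_on v T).differentiable (by norm_num) x)
    ((D.contDiff_on w T).differentiable (by norm_num) x), map_add]

theorem grad_smul (hP : D.IsMesh) (a : ℝ) (v : D.V) : grad (a • v) = a • grad v := by
  ext1 T; ext1 x
  simp only [grad, gradient, on_smul hP, Pi.smul_apply]
  rw [fderiv_const_smul ((D.contDiff_on v T).differentiable (by norm_num) x)]
  simp

theorem liftOn_add (hP : D.IsMesh) (v w : D.V) : liftOn (v + w) = liftOn v + liftOn w := by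
  ext1 T; ext1 x
  simp only [liftOn, lift_add hP, vecOn_add hP, Pi.add_apply]

theorem liftOn_smul (hP : D.IsMesh) (a : ℝ) (v : D.V) : liftOn (a • v) = a • liftOn v := by
  ext1 T; ext1 x
  simp only [liftOn, lift_smul hP, vecOn_smul hP, Pi.smul_apply]

theorem jumpForm_add_left (hP : D.IsMesh) (v v' w : D.V) :
    jumpForm (v + v') w = jumpForm v w + jumpForm v' w := by
  simp only [jumpForm, jump_add hP, inner_add_left, mul_add, ← Finset.sum_add_distrib]
  exact Finset.sum_congr rfl fun f hf => integral_add
    (integrableOn_carrier hP hf (by fun_prop)) (integrableOn_carrier hP hf (by fun_prop))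

theorem jumpForm_smul_left (hP : D.IsMesh) (a : ℝ) (v w : D.V) :
    jumpForm (a • v) w = a * jumpForm v w := by
  simp only [jumpForm, jump_smul hP, real_inner_smul_left, mul_left_comm _ a, integral_const_mul,
    Finset.mul_sum]

theorem form_add_left (hP : D.IsMesh) (v v' w : D.V) :
    D.form (v + v') w = D.form v w + D.form v' w := by
  simp only [form_eq hP, grad_add hP, liftOn_add hP, jumpForm_add_left hP,
    volForm_add_left (continuous_grad v) (continuous_grad v') (continuous_grad w),
    volForm_add_left (continuous_grad v) (continuous_grad v') (continuous_liftOn w),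
    volForm_add_left (continuous_liftOn v) (continuous_liftOn v') (continuous_grad w),
    volForm_add_left (continuous_liftOn v) (continuous_liftOn v') (continuous_liftOn w)]
  ring

theorem form_smul_left (hP : D.IsMesh) (a : ℝ) (v w : D.V) :
    D.form (a • v) w = a * D.form v w := by
  simp only [form_eq hP, grad_smul hP, liftOn_smul hP, jumpForm_smul_left hP, volForm_smul_left]
  ring

/-- The DG form as a bilinear map. -/
def bilin (hP : D.IsMesh) : D.V →ₗ[ℝ] D.V →ₗ[ℝ] ℝ :=
  LinearMap.mk₂ ℝ D.form (form_add_left hP) (form_smul_left hP)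
    (fun v w w' => by rw [form_comm hP, form_add_left hP, form_comm hP w, form_comm hP w'])
    (fun a v w => by rw [form_comm hP, form_smul_left hP, form_comm hP w]; rfl)

end Level

/-! ### Shape regular, quasi-uniform meshes -/

/-- A bound for the number of neighbours of an element. -/
def neighbourBound (d : ℕ) (κ₁ κ₂ : ℝ) : ℝ := ((1 + κ₂) * κ₁ * κ₂) ^ d

/-- A bound for the number of faces of an element. -/
def faceBound (d : ℕ) (s : Shape) (κ₁ κ₂ : ℝ) : ℝ :=
  neighbourBound d κ₁ κ₂ + (refFacets_finite d s).toFinset.card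

section Regular

variable {d : ℕ} {s : Shape} {Ω : Set (E d)} {𝒯 : Finset (Cell d)} {κ₁ κ₂ : ℝ}

/-- Packing with the radius of the enclosing ball left free: a = 1 + κ₂ serves for the neighbours of
T and a = 1 for its children. By shape regularity every T' contains a ball of radius a h_T / ((1+κ₂)
κ₁ κ₂), so the ratio of radii does not depend on a. -/
theorem card_cells_le (hd : 0 < d) (hP : IsPartition s Ω 𝒯) (hreg : IsShapeRegular s κ₁ 𝒯)
    (h₁ : 1 ≤ κ₁) (h₂ : 1 ≤ κ₂) {S : Finset (Cell d)} (hS : S ⊆ 𝒯) {T : Cell d} {x : E d}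
    {a : ℝ} (ha0 : 0 < a)
    (hsub : ∀ T' ∈ S, Metric.diam (cell s T) ≤ (1 + κ₂) * κ₂ / a * Metric.diam (cell s T'))
    (hball : ∀ T' ∈ S, cell s T' ⊆ Metric.closedBall x (a * Metric.diam (cell s T))) :
    (S.card : ℝ) ≤ neighbourBound d κ₁ κ₂ := by
  have hT := diam_cell_pos s T hd
  have hρ : 0 < a * Metric.diam (cell s T) / ((1 + κ₂) * κ₁ * κ₂) := by positivity
  have h := card_le_of_disjoint_balls S (cell s) (x₀ := x)
    (R := a * Metric.diam (cell s T))
    (ρ := a * Metric.diam (cell s T) / ((1 + κ₂) * κ₁ * κ₂)) (by positivity) hρ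
    (fun T₁ h₁ T₂ h₂ hne => hP.disjoint T₁ (hS h₁) T₂ (hS h₂) hne)
    (fun T' hT' => ?_) hball
  · refine h.trans (le_of_eq ?_)
    rw [neighbourBound]
    congr 1
    field_simp
  · obtain ⟨y, r, hr, hb, hdiam⟩ := hreg T' (hS hT')
    refine ⟨y, (Metric.ball_subset_ball ?_).trans hb⟩
    rw [div_le_iff₀ (by positivity)]
    have h3 := hsub T' hT'
    calc a * Metric.diam (cell s T) ≤ a * ((1 + κ₂) * κ₂ / a * (κ₁ * r)) := by
          gcongr
          exact h3.trans (by gcongr)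
      _ = r * ((1 + κ₂) * κ₁ * κ₂) := by field_simp

open Classical in
theorem card_neighbours_le (hd : 0 < d) (hP : IsPartition s Ω 𝒯) (hreg : IsShapeRegular s κ₁ 𝒯)
    (hqu : IsQuasiUniform s κ₂ 𝒯) (h₁ : 1 ≤ κ₁) (h₂ : 1 ≤ κ₂) {T : Cell d} (hT : T ∈ 𝒯) :
    ((𝒯.filter fun T' => (closure (cell s T) ∩ closure (cell s T')).Nonempty).card : ℝ) ≤
      neighbourBound d κ₁ κ₂ := by
  obtain ⟨x, hx⟩ := cell_nonempty s T
  refine card_cells_le hd hP hreg h₁ h₂ (Finset.filter_subset _ _) (T := T) (x := x)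
    (a := 1 + κ₂) (by positivity) (fun T' hT' => ?_) fun T' hT' y hy => ?_
  · rw [mul_div_cancel_left₀ _ (by positivity)]
    exact hqu T hT T' (Finset.mem_filter.1 hT').1
  · obtain ⟨hT'm, z, hz, hz'⟩ := Finset.mem_filter.1 hT'
    rw [Metric.mem_closedBall]
    have d1 := Metric.dist_le_diam_of_mem (isBounded_cell s T).closure hz (subset_closure hx)
    have d2 := Metric.dist_le_diam_of_mem (isBounded_cell s T').closure (subset_closure hy) hz'
    rw [Metric.diam_closure] at d1 d2
    have d3 := hqu T' hT'm T hT
    linarith [dist_triangle y z x]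

open Classical in
-- An interior face is determined by the neighbour across it and a boundary face by a facet of T.
theorem card_faces_le (hd : 0 < d) (hP : IsPartition s Ω 𝒯) (hreg : IsShapeRegular s κ₁ 𝒯)
    (hqu : IsQuasiUniform s κ₂ 𝒯) (h₁ : 1 ≤ κ₁) (h₂ : 1 ≤ κ₂) {T : Cell d} (hT : T ∈ 𝒯) :
    (((faces s Ω 𝒯).filter fun f => T ∈ f.cells).card : ℝ) ≤ faceBound d s κ₁ κ₂ := by
  set A := (𝒯.filter fun T' => (closure (cell s T) ∩ closure (cell s T')).Nonempty).image
    fun T' => (⟨{T, T'}, closure (cell s T) ∩ closure (cell s T')⟩ : Face d) with hA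
  set B := (refFacets_finite d s).toFinset.image
    fun G => (⟨{T}, T '' G ∩ frontier Ω⟩ : Face d) with hB
  have hsub : ((faces s Ω 𝒯).filter fun f => T ∈ f.cells) ⊆ A ∪ B := by
    intro f hf
    obtain ⟨hf, hTf⟩ := Finset.mem_filter.1 hf
    have hne := carrier_nonempty hf
    rw [Finset.mem_union]
    rcases mem_faces.1 hf with h | h
    · left
      obtain ⟨T₁, hT₁, T₂, hT₂, _, rfl, _⟩ := mem_interiorFaces.1 h
      rw [hA, Finset.mem_image]
      simp only [Finset.mem_insert, Finset.mem_singleton] at hTf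
      rcases hTf with rfl | rfl
      · exact ⟨T₂, Finset.mem_filter.2 ⟨hT₂, hne⟩, rfl⟩
      · refine ⟨T₁, Finset.mem_filter.2 ⟨hT₁, by rwa [Set.inter_comm]⟩, ?_⟩
        rw [Set.inter_comm, Finset.pair_comm]
    · right
      obtain ⟨T₁, hT₁, G, hG, rfl, _⟩ := mem_boundaryFaces.1 h
      rw [hB, Finset.mem_image]
      rw [Finset.mem_singleton.1 hTf]
      exact ⟨G, (Set.Finite.mem_toFinset _).2 hG, rfl⟩
  have h3 : ((faces s Ω 𝒯).filter fun f => T ∈ f.cells).card ≤ A.card + B.card :=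
    (Finset.card_le_card hsub).trans (Finset.card_union_le _ _)
  have h4 : (A.card : ℝ) ≤ neighbourBound d κ₁ κ₂ := le_trans
    (by exact_mod_cast Finset.card_image_le) (card_neighbours_le hd hP hreg hqu h₁ h₂ hT)
  have h5 : (B.card : ℝ) ≤ (refFacets_finite d s).toFinset.card := by
    exact_mod_cast Finset.card_image_le
  have h6 : (((faces s Ω 𝒯).filter fun f => T ∈ f.cells).card : ℝ) ≤ A.card + B.card := by
    exact_mod_cast h3
  rw [faceBound]
  linarith

end Regular

/-! ### Stability of the lifting operators -/

/-- The size `min (h_{T⁺}, h_{T⁻})` of a face. -/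
def faceSize {d : ℕ} (s : Shape) (f : Face d) : ℝ :=
  ⨅ T : {T // T ∈ f.cells}, Metric.diam (cell s T.1)

theorem faceSize_le {d : ℕ} {s : Shape} {f : Face d} {T : Cell d} (hT : T ∈ f.cells) :
    faceSize s f ≤ Metric.diam (cell s T) := by
  have hfin : BddBelow (Set.range fun T : {T // T ∈ f.cells} => Metric.diam (cell s T.1)) :=
    ⟨0, by rintro _ ⟨T, rfl⟩; exact Metric.diam_nonneg⟩
  exact ciInf_le hfin (⟨T, hT⟩ : {T // T ∈ f.cells})

theorem exists_faceSize_eq {d : ℕ} {s : Shape} {f : Face d} (hf : f.cells.Nonempty) :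
    ∃ T ∈ f.cells, faceSize s f = Metric.diam (cell s T) := by
  have : Nonempty {T // T ∈ f.cells} := ⟨⟨hf.choose, hf.choose_spec⟩⟩
  obtain ⟨T, hT⟩ := exists_eq_ciInf_of_finite
    (f := fun T : {T // T ∈ f.cells} => Metric.diam (cell s T.1))
  exact ⟨T.1, T.2, hT.symm⟩

theorem faceSize_pos {d : ℕ} (hd : 0 < d) {s : Shape} {f : Face d} (hf : f.cells.Nonempty) :
    0 < faceSize s f := by
  obtain ⟨T, -, h⟩ := exists_faceSize_eq (s := s) hf
  rw [h]; exact diam_cell_pos s T hd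

/-- The constant of the trace inverse inequality. -/
def traceConst (d : ℕ) (κ₁ : ℝ) : ℝ := 16 * 2 ^ (d - 1) * (d + 2) ^ 2 * κ₁

/-- The constant of the stability bound for the lifting operators. -/
def liftConst (d : ℕ) (s : Shape) (κ₁ κ₂ B : ℝ) : ℝ :=
  4 * (1 + B) ^ 2 * (traceConst d κ₁ * faceBound d s κ₁ κ₂)

theorem traceConst_pos {d : ℕ} {κ₁ : ℝ} (h₁ : 1 ≤ κ₁) : 0 < traceConst d κ₁ := by
  unfold traceConst; positivity

theorem faceBound_pos {d : ℕ} {s : Shape} {κ₁ κ₂ : ℝ} (h₁ : 1 ≤ κ₁) (h₂ : 1 ≤ κ₂) :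
    0 < faceBound d s κ₁ κ₂ := by
  unfold faceBound neighbourBound; positivity

theorem liftConst_pos {d : ℕ} {s : Shape} {κ₁ κ₂ B : ℝ} (h₁ : 1 ≤ κ₁) (h₂ : 1 ≤ κ₂) (hB : 0 ≤ B) :
    0 < liftConst d s κ₁ κ₂ B := by
  have := traceConst_pos (d := d) h₁
  have := faceBound_pos (d := d) (s := s) h₁ h₂
  unfold liftConst; positivity

namespace Level

variable {d : ℕ} {Ω : Set (E d)} {D : Level d Ω} {κ₁ κ₂ B : ℝ}

theorem σ_eq (f : Face d) : D.σ f = D.α * (D.degree : ℝ) ^ 2 / faceSize D.shape f := rfl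

theorem pairing_eq_volForm (hP : D.IsMesh) (r η : Fin d → D.V) :
    pairing r η = D.volForm (D.vecOn r) (D.vecOn η) := by
  rw [← integral_eq_pairing]
  have hae : ∀ T ∈ D.mesh, (fun x => ∑ i, (r i).1 x * (η i).1 x)
      =ᵐ[volume.restrict (cell D.shape T)] fun x => ⟪D.vecOn r T x, D.vecOn η T x⟫ := by
    intro T hT
    have h1 : ∀ᵐ x ∂(volume.restrict (cell D.shape T)), ∀ i, (r i).1 x = D.on (r i) T x :=
      ae_all_iff.2 fun i => on_ae_cell hP (r i) hT
    have h2 : ∀ᵐ x ∂(volume.restrict (cell D.shape T)), ∀ i, (η i).1 x = D.on (η i) T x :=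
      ae_all_iff.2 fun i => on_ae_cell hP (η i) hT
    filter_upwards [h1, h2] with x h1 h2
    rw [PiLp.inner_apply]
    refine Finset.sum_congr rfl fun i _ => ?_
    rw [h1, h2]
    simp [vecOn, mul_comm]
  rw [hP.integral_eq_sum fun T hT => (integrableOn_inner_cell (continuous_vecOn r T)
      (continuous_vecOn η T) T).congr (hae T hT).symm]
  exact Finset.sum_congr rfl fun T hT => integral_congr_ae (hae T hT)

/-- The trace inverse inequality componentwise, in scaled form: the size of the face is at most h_T
≤ κ₁ r, which cancels 1/r, and the division by p² cancels the growth in the degree. -/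
theorem integral_norm_sq_vecOn_le (hP : D.IsMesh) (hreg : IsShapeRegular D.shape κ₁ D.mesh)
    (hd : 0 < d) (hp : 1 ≤ D.degree) (η : Fin d → D.V) {f : Face d}
    (hf : f ∈ faces D.shape Ω D.mesh) {T : Cell d} (hT : T ∈ f.cells) :
    faceSize D.shape f / (D.degree : ℝ) ^ 2 *
      ∫ x in f.carrier, ‖D.vecOn η T x‖ ^ 2 ∂(surface d) ≤
      traceConst d κ₁ * ∫ x in cell D.shape T, ⟪D.vecOn η T x, D.vecOn η T x⟫ := by
  obtain ⟨x₀, r, hr, hball, hdiam⟩ := hreg T (mem_mesh_of_mem_cells hf hT)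
  have hp0 : (1 : ℝ) ≤ D.degree := by exact_mod_cast hp
  have hdT := diam_cell_pos D.shape T hd
  have hκ : 0 < κ₁ := by
    by_contra h
    have := mul_nonpos_of_nonpos_of_nonneg (not_lt.1 h) hr.le
    linarith
  have e1 : ∀ x, ‖D.vecOn η T x‖ ^ 2 = ∑ i, D.on (η i) T x ^ 2 := by
    intro x
    rw [EuclideanSpace.norm_sq_eq]
    simp [vecOn]
  have e2 : ∀ x, ⟪D.vecOn η T x, D.vecOn η T x⟫ = ∑ i, D.on (η i) T x ^ 2 := by
    intro x
    rw [real_inner_self_eq_norm_sq, e1]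
  simp only [e1, e2]
  rw [integral_finsetSum _ fun i _ => integrableOn_carrier hP hf (by fun_prop),
    integral_finsetSum _ fun i _ => integrableOn_cell (by fun_prop) T, Finset.mul_sum,
    Finset.mul_sum]
  refine Finset.sum_le_sum fun i _ => ?_
  have h := (isFacet_normal hP hf hT).integral_sq_le (convex_cell D.shape T)
    (isBounded_cell D.shape T) hr hball (D.continuous_on (η i) T) (D.isPolyOnLines_on (η i) T)
  have hI : 0 ≤ ∫ x in cell D.shape T, D.on (η i) T x ^ 2 := integral_nonneg fun _ => by positivity
  have hsz := faceSize_le (s := D.shape) hT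
  have hsz0 := faceSize_pos hd (s := D.shape) (cells_nonempty hf)
  -- The assumption p ≥ 1 absorbs the additive 1.
  have hN : ((d * D.degree + D.degree : ℕ) : ℝ) + 1 ≤ (d + 2) * D.degree := by
    push_cast; linarith
  calc _ ≤ faceSize D.shape f / (D.degree : ℝ) ^ 2 * (16 * 2 ^ (d - 1) *
        (((d * D.degree + D.degree : ℕ) : ℝ) + 1) ^ 2 / r *
          ∫ x in cell D.shape T, D.on (η i) T x ^ 2) := by gcongr
    _ ≤ (κ₁ * r) / (D.degree : ℝ) ^ 2 * (16 * 2 ^ (d - 1) *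
        ((d + 2) * D.degree) ^ 2 / r * ∫ x in cell D.shape T, D.on (η i) T x ^ 2) := by
      gcongr
      exact hsz.trans hdiam
    _ = _ := by
      rw [traceConst]
      field_simp

/-- The scaled jumps, without the penalty parameter. -/
def jumpSum (v : D.V) : ℝ := ∑ f ∈ faces D.shape Ω D.mesh,
  (D.degree : ℝ) ^ 2 / faceSize D.shape f * ∫ x in f.carrier, ‖D.jump v f x‖ ^ 2 ∂(surface d)

theorem jumpForm_self (v : D.V) : jumpForm v v = D.α * jumpSum v := by
  rw [jumpForm, jumpSum, Finset.mul_sum]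
  refine Finset.sum_congr rfl fun f _ => ?_
  rw [integral_const_mul, σ_eq]
  simp only [real_inner_self_eq_norm_sq]
  ring

theorem jumpSum_nonneg (hd : 0 < d) (v : D.V) : 0 ≤ jumpSum v :=
  Finset.sum_nonneg fun f hf => mul_nonneg (div_nonneg (by positivity)
    (faceSize_pos hd (cells_nonempty hf)).le) (integral_nonneg fun _ => by positivity)

theorem norm_vecAvg_le {η : Fin d → D.V} {f : Face d} (hf : f ∈ faces D.shape Ω D.mesh) (x : E d) :
    ‖D.vecAvg η f x‖ ≤ ∑ T ∈ f.cells, ‖D.vecOn η T x‖ := by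
  rw [vecAvg, norm_smul]
  have hc : (1 : ℝ) ≤ f.cells.card := by exact_mod_cast (cells_nonempty hf).card_pos
  have h1 : ‖((f.cells.card : ℝ))⁻¹‖ ≤ 1 := by
    rw [Real.norm_of_nonneg (by positivity)]
    exact inv_le_one_of_one_le₀ hc
  calc _ ≤ 1 * ∑ T ∈ f.cells, ‖D.vecOn η T x‖ := by
        gcongr
        exact norm_sum_le _ _
    _ = _ := one_mul _

theorem abs_vecJump_le (hP : D.IsMesh) {η : Fin d → D.V} {f : Face d}
    (hf : f ∈ faces D.shape Ω D.mesh) (x : E d) :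
    |D.vecJump η f x| ≤ ∑ T ∈ f.cells, ‖D.vecOn η T x‖ := by
  rw [vecJump]
  refine (Finset.abs_sum_le_sum_abs _ _).trans (Finset.sum_le_sum fun T hT => ?_)
  refine (abs_real_inner_le_norm _ _).trans ?_
  rw [(isFacet_normal hP hf hT).norm, mul_one]

theorem card_cells_le_two {s : Shape} {𝒯 : Finset (Cell d)} {f : Face d} (hf : f ∈ faces s Ω 𝒯) :
    (f.cells.card : ℝ) ≤ 2 := by
  classical
  have : f.cells.card ≤ 2 := by
    rcases mem_faces.1 hf with h | h
    · obtain ⟨T₁, _, T₂, _, hne, rfl, _⟩ := mem_interiorFaces.1 h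
      exact (Finset.card_pair hne).le
    · obtain ⟨T₁, _, G, _, rfl, _⟩ := mem_boundaryFaces.1 h
      simp
  exact_mod_cast this

/-- Young's inequality on a face. -/
theorem neg_integral_le_young (hP : D.IsMesh) (v : D.V) (η : Fin d → D.V) {f : Face d}
    (hf : f ∈ faces D.shape Ω D.mesh) {g : E d → ℝ} (hg : Continuous g) {b w t : ℝ} (hb : 0 ≤ b)
    (hw : 0 < w) (ht : 0 < t)
    (hle : ∀ x, |g x| ≤ b * (‖D.jump v f x‖ * ∑ T ∈ f.cells, ‖D.vecOn η T x‖)) :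
    -∫ x in f.carrier, g x ∂(surface d) ≤
      b * (t * (w * ∫ x in f.carrier, ‖D.jump v f x‖ ^ 2 ∂(surface d)) +
        t⁻¹ * ∑ T ∈ f.cells, w⁻¹ * ∫ x in f.carrier, ‖D.vecOn η T x‖ ^ 2 ∂(surface d)) := by
  have hpt : ∀ x, -g x ≤ b * (t * (w * ‖D.jump v f x‖ ^ 2) +
      t⁻¹ * ∑ T ∈ f.cells, w⁻¹ * ‖D.vecOn η T x‖ ^ 2) := by
    intro x
    refine (neg_le_abs _).trans ((hle x).trans ?_)
    gcongr
    set a := ‖D.jump v f x‖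
    have hsq : (∑ T ∈ f.cells, ‖D.vecOn η T x‖) ^ 2 ≤ 2 * ∑ T ∈ f.cells, ‖D.vecOn η T x‖ ^ 2 := by
      refine sq_sum_le_card_mul_sum_sq.trans ?_
      gcongr
      exact card_cells_le_two hf
    rw [← Finset.mul_sum]
    set m := ∑ T ∈ f.cells, ‖D.vecOn η T x‖
    set q := ∑ T ∈ f.cells, ‖D.vecOn η T x‖ ^ 2
    -- Completing the square gives 2am ≤ tw a² + (tw)⁻¹ m², while `hsq` uses that a face has at most
    -- two elements.
    have h1 : 0 ≤ (t * w) * (a - (t * w)⁻¹ * m) ^ 2 := by positivity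
    have h2 : (t * w) * (a - (t * w)⁻¹ * m) ^ 2 = t * w * a ^ 2 - 2 * (a * m) +
        (t * w)⁻¹ * m ^ 2 := by
      field_simp; ring
    have h3 : (t * w)⁻¹ * m ^ 2 ≤ (t * w)⁻¹ * (2 * q) := by gcongr
    have h4 : t⁻¹ * (w⁻¹ * q) = (t * w)⁻¹ * q := by rw [mul_inv]; ring
    have h5 : 0 ≤ t * w * a ^ 2 := by positivity
    rw [h4]
    linarith
  have hc : ∀ T, IntegrableOn (fun x => w⁻¹ * ‖D.vecOn η T x‖ ^ 2) f.carrier (surface d) :=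
    fun T => integrableOn_carrier hP hf (by fun_prop)
  rw [← integral_neg]
  calc _ ≤ ∫ x in f.carrier, b * (t * (w * ‖D.jump v f x‖ ^ 2) +
      t⁻¹ * ∑ T ∈ f.cells, w⁻¹ * ‖D.vecOn η T x‖ ^ 2) ∂(surface d) :=
        integral_mono (integrableOn_carrier hP hf (by fun_prop))
          (integrableOn_carrier hP hf (by fun_prop)) hpt
    _ = _ := by
      rw [integral_const_mul, integral_add (integrableOn_carrier hP hf (by fun_prop))
        (integrableOn_carrier hP hf (by fun_prop)), integral_const_mul, integral_const_mul,
        integral_const_mul, integral_finsetSum _ fun T _ => hc T]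
      simp only [integral_const_mul]

/-- The two sides of Young's inequality on a face, for the jumps of `v` and the field `η`. -/
def youngTerm (v : D.V) (η : Fin d → D.V) (t w : ℝ) (f : Face d) : ℝ :=
  t * (w * ∫ x in f.carrier, ‖D.jump v f x‖ ^ 2 ∂(surface d)) +
    t⁻¹ * ∑ T ∈ f.cells, w⁻¹ * ∫ x in f.carrier, ‖D.vecOn η T x‖ ^ 2 ∂(surface d)

theorem youngTerm_nonneg (v : D.V) (η : Fin d → D.V) {t w : ℝ} (ht : 0 < t) (hw : 0 < w)
    (f : Face d) : 0 ≤ youngTerm v η t w f := by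
  have i1 : 0 ≤ ∫ x in f.carrier, ‖D.jump v f x‖ ^ 2 ∂(surface d) :=
    integral_nonneg fun _ => sq_nonneg _
  have i2 : 0 ≤ ∑ T ∈ f.cells, w⁻¹ * ∫ x in f.carrier, ‖D.vecOn η T x‖ ^ 2 ∂(surface d) :=
    Finset.sum_nonneg fun T _ => mul_nonneg (inv_nonneg.2 hw.le)
      (integral_nonneg fun _ => sq_nonneg _)
  exact add_nonneg (mul_nonneg ht.le (mul_nonneg hw.le i1)) (mul_nonneg (inv_nonneg.2 ht.le) i2)

theorem pairing_lift_le (hP : D.IsMesh) (hB : 0 ≤ B)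
    (hβ : ∀ f ∈ interiorFaces D.shape D.mesh, ‖D.β f‖ ≤ B) (v : D.V) (η : Fin d → D.V) {t : ℝ}
    (ht : 0 < t) (w : Face d → ℝ) (hw : ∀ f ∈ faces D.shape Ω D.mesh, 0 < w f) :
    pairing (D.lift v) η ≤ (1 + B) * ∑ f ∈ faces D.shape Ω D.mesh, youngTerm v η t (w f) f := by
  have hA0 : ∀ f ∈ faces D.shape Ω D.mesh, 0 ≤ youngTerm v η t (w f) f := fun f hf =>
    youngTerm_nonneg v η ht (hw f hf) f
  have h1 : ∀ f ∈ faces D.shape Ω D.mesh,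
      -∫ x in f.carrier, ⟪D.jump v f x, D.vecAvg η f x⟫ ∂(surface d) ≤
        1 * youngTerm v η t (w f) f := by
    intro f hf
    refine neg_integral_le_young hP v η hf (by fun_prop) zero_le_one (hw f hf) ht fun x => ?_
    rw [one_mul]
    exact (abs_real_inner_le_norm _ _).trans
      (mul_le_mul_of_nonneg_left (norm_vecAvg_le hf x) (norm_nonneg _))
  have h2 : ∀ f ∈ interiorFaces D.shape D.mesh,
      -∫ x in f.carrier, ⟪D.β f, D.jump v f x⟫ * D.vecJump η f x ∂(surface d) ≤
        B * youngTerm v η t (w f) f := by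
    intro f hf
    have hf' := mem_faces_of_interior (Ω := Ω) hf
    refine neg_integral_le_young hP v η hf' (by fun_prop) hB (hw f hf') ht fun x => ?_
    rw [abs_mul, ← mul_assoc]
    refine mul_le_mul ?_ (abs_vecJump_le hP hf' x) (abs_nonneg _)
      (mul_nonneg hB (norm_nonneg _))
    exact (abs_real_inner_le_norm _ _).trans
      (mul_le_mul_of_nonneg_right (hβ f hf) (norm_nonneg _))
  rw [pairing_lift hP, add_mul, Finset.mul_sum, Finset.mul_sum]
  refine add_le_add (Finset.sum_le_sum h1) ((Finset.sum_le_sum h2).trans ?_)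
  exact Finset.sum_le_sum_of_subset_of_nonneg (fun f hf => mem_faces_of_interior hf)
    fun f hf _ => mul_nonneg hB (hA0 f hf)

/-- After the trace inequality the order of summation is exchanged, and each element is counted once
for each of its boundedly many faces. -/
theorem sum_integral_vecOn_le (hd : 0 < d) (hP : D.IsMesh)
    (hreg : IsShapeRegular D.shape κ₁ D.mesh) (hqu : IsQuasiUniform D.shape κ₂ D.mesh)
    (h₁ : 1 ≤ κ₁) (h₂ : 1 ≤ κ₂) (hp : 1 ≤ D.degree) (η : Fin d → D.V) :
    ∑ f ∈ faces D.shape Ω D.mesh, ∑ T ∈ f.cells,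
      ((D.degree : ℝ) ^ 2 / faceSize D.shape f)⁻¹ *
        ∫ x in f.carrier, ‖D.vecOn η T x‖ ^ 2 ∂(surface d) ≤
      traceConst d κ₁ * faceBound d D.shape κ₁ κ₂ * D.volForm (D.vecOn η) (D.vecOn η) := by
  classical
  have hC := traceConst_pos (d := d) h₁
  set I : Cell d → ℝ := fun T => ∫ x in cell D.shape T, ⟪D.vecOn η T x, D.vecOn η T x⟫ with hI
  have hI0 : ∀ T, 0 ≤ I T := fun T => integral_nonneg fun _ => real_inner_self_nonneg
  calc _ ≤ ∑ f ∈ faces D.shape Ω D.mesh, ∑ T ∈ f.cells, traceConst d κ₁ * I T := by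
        refine Finset.sum_le_sum fun f hf => Finset.sum_le_sum fun T hT => ?_
        rw [inv_div]
        exact integral_norm_sq_vecOn_le hP hreg hd hp η hf hT
    _ = ∑ f ∈ faces D.shape Ω D.mesh, ∑ T ∈ D.mesh,
          if T ∈ f.cells then traceConst d κ₁ * I T else 0 := by
        refine Finset.sum_congr rfl fun f hf => ?_
        rw [← Finset.sum_filter]
        refine Finset.sum_congr ?_ fun _ _ => rfl
        ext T
        rw [Finset.mem_filter]
        exact ⟨fun h => ⟨mem_mesh_of_mem_cells hf h, h⟩, fun h => h.2⟩
    _ = ∑ T ∈ D.mesh, (((faces D.shape Ω D.mesh).filter fun f => T ∈ f.cells).card : ℝ) *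
          (traceConst d κ₁ * I T) := by
        rw [Finset.sum_comm]
        refine Finset.sum_congr rfl fun T _ => ?_
        rw [← Finset.sum_filter, Finset.sum_const, nsmul_eq_mul]
    _ ≤ ∑ T ∈ D.mesh, faceBound d D.shape κ₁ κ₂ * (traceConst d κ₁ * I T) := by
        refine Finset.sum_le_sum fun T hT => ?_
        exact mul_le_mul_of_nonneg_right (card_faces_le hd hP hreg hqu h₁ h₂ hT)
          (mul_nonneg hC.le (hI0 T))
    _ = _ := by
        rw [← Finset.mul_sum, ← Finset.mul_sum, ← mul_assoc, mul_comm (faceBound _ _ _ _)]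
        rfl

/-- The lifting is tested with itself. The weight p²/h on each face balances the jumps against the
traces of the lifting, which are controlled by L. -/
theorem volForm_liftOn_le (hd : 0 < d) (hP : D.IsMesh) (hreg : IsShapeRegular D.shape κ₁ D.mesh)
    (hqu : IsQuasiUniform D.shape κ₂ D.mesh) (h₁ : 1 ≤ κ₁) (h₂ : 1 ≤ κ₂) (hp : 1 ≤ D.degree)
    (hB : 0 ≤ B) (hβ : ∀ f ∈ interiorFaces D.shape D.mesh, ‖D.β f‖ ≤ B) (v : D.V) :
    D.volForm (liftOn v) (liftOn v) ≤ liftConst d D.shape κ₁ κ₂ B * jumpSum v := by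
  set L := D.volForm (liftOn v) (liftOn v) with hL
  have hC := traceConst_pos (d := d) h₁
  have hN := faceBound_pos (d := d) (s := D.shape) h₁ h₂
  -- Chosen so that the part of Young's inequality containing the lifting is exactly L/2 and can be
  -- absorbed on the left.
  set t : ℝ := 2 * (1 + B) * (traceConst d κ₁ * faceBound d D.shape κ₁ κ₂) with ht
  have ht0 : 0 < t := by positivity
  have hp0 : (0 : ℝ) < D.degree := by exact_mod_cast hp
  have hbound := pairing_lift_le hP hB hβ v (D.lift v) ht0
    (fun f => (D.degree : ℝ) ^ 2 / faceSize D.shape f) fun f hf =>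
      div_pos (by positivity) (faceSize_pos hd (cells_nonempty hf))
  have hLp : pairing (D.lift v) (D.lift v) = L := pairing_eq_volForm hP _ _
  have hAsum := sum_integral_vecOn_le hd hP hreg hqu h₁ h₂ hp (D.lift v)
  change _ ≤ _ * L at hAsum
  simp only [youngTerm] at hbound
  rw [hLp, Finset.sum_add_distrib, ← Finset.mul_sum, ← Finset.mul_sum] at hbound
  change _ ≤ (1 + B) * (t * jumpSum v + _) at hbound
  have hfin : L ≤ (1 + B) * (t * jumpSum v) + L / 2 := by
    have e : (1 + B) * (t⁻¹ * (traceConst d κ₁ * faceBound d D.shape κ₁ κ₂ * L)) = L / 2 := by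
      rw [ht]; field_simp
    calc L ≤ _ := hbound
      _ ≤ (1 + B) * (t * jumpSum v + t⁻¹ * (traceConst d κ₁ * faceBound d D.shape κ₁ κ₂ * L)) :=
        mul_le_mul_of_nonneg_left (add_le_add_right
          (mul_le_mul_of_nonneg_left hAsum (by positivity)) _) (by positivity)
      _ = _ := by rw [mul_add, e]
  have e2 : liftConst d D.shape κ₁ κ₂ B * jumpSum v = 2 * ((1 + B) * (t * jumpSum v)) := by
    rw [liftConst, ht]; ring
  rw [e2]
  linarith

end Level

namespace Level

variable {d : ℕ} {Ω : Set (E d)} {D : Level d Ω} {κ₁ κ₂ B : ℝ}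

/-! ### Coercivity and continuity of the form -/

/-- The assumptions on the mesh, the degree and `β` of one level. -/
structure IsRegular (D : Level d Ω) (κ₁ κ₂ B : ℝ) : Prop where
  isMesh : D.IsMesh
  shapeRegular : IsShapeRegular D.shape κ₁ D.mesh
  quasiUniform : IsQuasiUniform D.shape κ₂ D.mesh
  one_le_degree : 1 ≤ D.degree
  norm_β_le : ∀ f ∈ interiorFaces D.shape D.mesh, ‖D.β f‖ ≤ B

/-- The square of the DG norm. -/
def dgNormSq (v : D.V) : ℝ := D.volForm (grad v) (grad v) + jumpForm v v

theorem jumpForm_nonneg (hd : 0 < d) (hα : 0 ≤ D.α) (v : D.V) : 0 ≤ jumpForm v v := by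
  rw [jumpForm_self]; exact mul_nonneg hα (jumpSum_nonneg hd v)

theorem dgNormSq_nonneg (hd : 0 < d) (hα : 0 ≤ D.α) (v : D.V) : 0 ≤ dgNormSq v :=
  add_nonneg (volForm_self_nonneg _) (jumpForm_nonneg hd hα v)

theorem form_self (hP : D.IsMesh) (v : D.V) :
    D.form v v = D.volForm (grad v) (grad v) + 2 * D.volForm (grad v) (liftOn v) +
      jumpForm v v + D.θ * D.volForm (liftOn v) (liftOn v) := by
  rw [form_eq hP, volForm_comm (liftOn v) (grad v)]; ring

theorem volForm_liftOn_le_jumpForm (hd : 0 < d) (h₁ : 1 ≤ κ₁) (h₂ : 1 ≤ κ₂) (hB : 0 ≤ B)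
    (hD : D.IsRegular κ₁ κ₂ B) {a : ℝ} (ha : 0 < a) (haα : a ≤ D.α) (v : D.V) :
    D.volForm (liftOn v) (liftOn v) ≤ liftConst d D.shape κ₁ κ₂ B / a * jumpForm v v := by
  refine (volForm_liftOn_le hd hD.isMesh hD.shapeRegular hD.quasiUniform h₁ h₂ hD.one_le_degree hB
    hD.norm_β_le v).trans ?_
  have hC := liftConst_pos (d := d) (s := D.shape) h₁ h₂ hB
  have hJ := jumpSum_nonneg hd v
  rw [jumpForm_self, div_mul_eq_mul_div, le_div_iff₀ ha, mul_assoc]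
  refine mul_le_mul_of_nonneg_left ?_ hC.le
  rw [mul_comm]
  exact mul_le_mul_of_nonneg_right haα hJ

/-- The coercivity constant. -/
def coercConst (C a : ℝ) : ℝ := min (1 / 2) (a / (2 * C + a))

theorem coercConst_pos {C a : ℝ} (hC : 0 < C) (ha : 0 < a) : 0 < coercConst C a :=
  lt_min (by norm_num) (by positivity)

theorem le_form (hd : 0 < d) (h₁ : 1 ≤ κ₁) (h₂ : 1 ≤ κ₂) (hB : 0 ≤ B)
    (hD : D.IsRegular κ₁ κ₂ B) {a : ℝ} (ha : 0 < a) (haα : a ≤ D.α)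
    (hθ : D.θ = 0 ∧ 4 * liftConst d D.shape κ₁ κ₂ B ≤ a ∨ D.θ = 1) (v : D.V) :
    coercConst (liftConst d D.shape κ₁ κ₂ B) a * dgNormSq v ≤ D.form v v := by
  have hC := liftConst_pos (d := d) (s := D.shape) h₁ h₂ hB
  set C := liftConst d D.shape κ₁ κ₂ B
  have hL := volForm_liftOn_le_jumpForm hd h₁ h₂ hB hD ha haα v
  have hL0 := volForm_self_nonneg (D := D) (liftOn v)
  have hG0 := volForm_self_nonneg (D := D) (grad v)
  have hJ0 := jumpForm_nonneg hd (ha.le.trans haα) v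
  rw [form_self hD.isMesh, dgNormSq]
  have hX := fun {ε : ℝ} (hε : 0 < ε) => neg_le_of_abs_le
    (abs_two_mul_volForm_le (D := D) (continuous_grad v) (continuous_liftOn v) hε)
  set G := D.volForm (grad v) (grad v)
  set X := D.volForm (grad v) (liftOn v)
  set L := D.volForm (liftOn v) (liftOn v)
  set J := jumpForm v v
  rcases hθ with ⟨h0, h4⟩ | h0
  -- Young leaves G/2 and costs 2L. The threshold 4C ≤ a gives L ≤ J/4, so J/2 remains too.
  · have hX' := hX (ε := 1 / 2) (by norm_num)
    have hle : coercConst C a * (G + J) ≤ 1 / 2 * (G + J) :=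
      mul_le_mul_of_nonneg_right (min_le_left _ _) (by positivity)
    have hL2 : L ≤ 1 / 4 * J := hL.trans (mul_le_mul_of_nonneg_right (by
      rw [div_le_iff₀ ha]; linarith) hJ0)
    rw [h0]
    norm_num at hX'
    linarith
  -- Here ε < 1 and ε⁻¹ = 1 + a/(2C). The term L from θ = 1 pays for the 1, and the remainder
  -- (a/(2C)) L is at most J/2, whatever the size of a > 0.
  · set ε := 2 * C / (2 * C + a) with hε
    have hε0 : 0 < ε := by positivity
    have hX' := hX hε0
    have hinv : ε⁻¹ = 1 + a / (2 * C) := by rw [hε]; field_simp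
    have h1ε : 1 - ε = a / (2 * C + a) := by rw [hε]; field_simp; ring
    have hle1 : coercConst C a * G ≤ (1 - ε) * G := by
      rw [h1ε]; exact mul_le_mul_of_nonneg_right (min_le_right _ _) hG0
    have hle2 : coercConst C a * J ≤ 1 / 2 * J :=
      mul_le_mul_of_nonneg_right (min_le_left _ _) hJ0
    have hL2 : a / (2 * C) * L ≤ 1 / 2 * J := by
      calc a / (2 * C) * L ≤ a / (2 * C) * (C / a * J) :=
            mul_le_mul_of_nonneg_left hL (by positivity)
        _ = 1 / 2 * J := by field_simp
    rw [h0, one_mul]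
    rw [hinv] at hX'
    linarith

theorem form_le (hd : 0 < d) (h₁ : 1 ≤ κ₁) (h₂ : 1 ≤ κ₂) (hB : 0 ≤ B)
    (hD : D.IsRegular κ₁ κ₂ B) {a : ℝ} (ha : 0 < a) (haα : a ≤ D.α) (hθ : D.θ ≤ 1) (v : D.V) :
    D.form v v ≤ (2 + 2 * (liftConst d D.shape κ₁ κ₂ B / a)) * dgNormSq v := by
  have hC := liftConst_pos (d := d) (s := D.shape) h₁ h₂ hB
  set C := liftConst d D.shape κ₁ κ₂ B
  have hL := volForm_liftOn_le_jumpForm hd h₁ h₂ hB hD ha haα v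
  have hL0 := volForm_self_nonneg (D := D) (liftOn v)
  have hG0 := volForm_self_nonneg (D := D) (grad v)
  have hJ0 := jumpForm_nonneg hd (ha.le.trans haα) v
  rw [form_self hD.isMesh, dgNormSq]
  have hX := le_of_abs_le (abs_two_mul_volForm_le (D := D) (continuous_grad v)
    (continuous_liftOn v) one_pos)
  have hθL := mul_le_mul_of_nonneg_right hθ hL0
  have hCG : 0 ≤ C / a * D.volForm (grad v) (grad v) := mul_nonneg (by positivity) hG0
  norm_num at hX
  linarith

/-! ### Positivity of the form -/

theorem grad_eq_zero {v : D.V} (h : D.volForm (grad v) (grad v) = 0) {T : Cell d}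
    (hT : T ∈ D.mesh) : ∃ a, ∀ x ∈ closure (cell D.shape T), D.on v T x = a := by
  have h1 : ∫ x in cell D.shape T, ⟪grad v T x, grad v T x⟫ = 0 :=
    (Finset.sum_eq_zero_iff_of_nonneg fun T _ =>
      integral_nonneg fun _ => real_inner_self_nonneg).1 h T hT
  rw [integral_eq_zero_iff_of_nonneg (fun _ => real_inner_self_nonneg)
    (integrableOn_inner_cell (continuous_grad v T) (continuous_grad v T) T)] at h1
  have h2 : Set.EqOn (grad v T) 0 (cell D.shape T) := by
    refine Measure.eqOn_open_of_ae_eq (μ := volume) ?_ (isOpen_cell D.shape T)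
      (continuous_grad v T).continuousOn continuousOn_const
    filter_upwards [h1] with x hx
    exact inner_self_eq_zero.1 hx
  have h3 : Set.EqOn (fderiv ℝ (D.on v T)) 0 (cell D.shape T) := fun x hx =>
    (InnerProductSpace.toDual ℝ (E d)).symm.map_eq_zero_iff.1 (h2 hx)
  obtain ⟨y, hy⟩ := cell_nonempty D.shape T
  refine ⟨D.on v T y, fun x hx => ?_⟩
  have hc : IsClosed {x | D.on v T x = D.on v T y} := isClosed_eq (by fun_prop) continuous_const
  refine (hc.closure_subset_iff.2 fun z hz => ?_) hx
  exact (isOpen_cell D.shape T).is_const_of_fderiv_eq_zero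
    (convex_cell D.shape T).isPreconnected
    ((D.contDiff_on v T).differentiable (by norm_num)).differentiableOn h3 hz hy

theorem exists_jump_eq_zero (hd : 0 < d) (hp : 1 ≤ D.degree) (hP : D.IsMesh) {v : D.V}
    (h : jumpSum v = 0) {f : Face d} (hf : f ∈ faces D.shape Ω D.mesh) :
    ∃ x ∈ f.carrier, D.jump v f x = 0 := by
  have hp0 : (0 : ℝ) < D.degree := by exact_mod_cast hp
  have hw : ∀ f ∈ faces D.shape Ω D.mesh, 0 < (D.degree : ℝ) ^ 2 / faceSize D.shape f := fun f hf =>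
    div_pos (by positivity) (faceSize_pos hd (cells_nonempty hf))
  have h1 := (Finset.sum_eq_zero_iff_of_nonneg fun f hf => mul_nonneg (hw f hf).le
    (integral_nonneg fun _ => sq_nonneg _)).1 h f hf
  have h2 := (mul_eq_zero.1 h1).resolve_left (hw f hf).ne'
  rw [integral_eq_zero_iff_of_nonneg (fun _ => sq_nonneg _)
    (integrableOn_carrier hP hf ((continuous_jump v f).norm.pow 2))] at h2
  have hne : (surface d).restrict f.carrier ≠ 0 := by
    rw [Ne, Measure.restrict_eq_zero]
    exact (surface_pos_of_mem_faces hf).ne'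
  have : (ae ((surface d).restrict f.carrier)).NeBot := ae_neBot.2 hne
  obtain ⟨x, hx, hxm⟩ := (h2.and (ae_restrict_mem (isClosed_carrier hf).measurableSet)).exists
  refine ⟨x, hxm, ?_⟩
  have hx' : ‖D.jump v f x‖ ^ 2 = 0 := hx
  exact norm_eq_zero.1 (pow_eq_zero_iff (by norm_num) |>.1 hx')

/-- A frontier point of the selected union that lies in Ω also belongs to a closed element outside
the selection, for otherwise a neighbourhood would be covered by selected elements. A frontier point
outside Ω lies on ∂Ω and on a facet of a selected element. -/
theorem frontier_subset_of_filter {s : Shape} {𝒯 : Finset (Cell d)} (hP : IsPartition s Ω 𝒯)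
    (p : Cell d → Prop) [DecidablePred p] :
    frontier (⋃ T ∈ 𝒯.filter p, closure (cell s T)) ⊆
      (⋃ T ∈ 𝒯.filter p, ⋃ T' ∈ 𝒯.filter (fun T => ¬ p T),
        closure (cell s T) ∩ closure (cell s T')) ∪
      ⋃ T ∈ 𝒯.filter p, ⋃ G ∈ refFacets d s, T '' G ∩ frontier Ω := by
  set U := ⋃ T ∈ 𝒯.filter p, closure (cell s T) with hU
  have hUc : IsClosed U := (𝒯.filter p).finite_toSet.isClosed_biUnion fun T _ => isClosed_closure
  set U' := ⋃ T ∈ 𝒯.filter (fun T => ¬ p T), closure (cell s T) with hU'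
  have hUc' : IsClosed U' :=
    (𝒯.filter (fun T => ¬ p T)).finite_toSet.isClosed_biUnion fun T _ => isClosed_closure
  intro x hx
  have hxU : x ∈ U := hUc.frontier_subset hx
  obtain ⟨T, hT, hxT⟩ := Set.mem_iUnion₂.1 hxU
  have hTm := (Finset.mem_filter.1 hT).1
  by_cases hxΩ : x ∈ Ω
  · left
    have hxU' : x ∈ U' := by
      by_contra hnot
      have hsub : Ω ∩ U'ᶜ ⊆ U := by
        rintro y ⟨hy, hy'⟩
        have hy2 : y ∈ ⋃ T ∈ 𝒯, closure (cell s T) := by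
          have : y ∈ interior (⋃ T ∈ 𝒯, closure (cell s T)) := hP.cover ▸ hy
          exact interior_subset this
        obtain ⟨S, hS, hyS⟩ := Set.mem_iUnion₂.1 hy2
        by_cases hpS : p S
        · exact Set.mem_iUnion₂.2 ⟨S, Finset.mem_filter.2 ⟨hS, hpS⟩, hyS⟩
        · exact absurd (Set.mem_iUnion₂.2 ⟨S, Finset.mem_filter.2 ⟨hS, hpS⟩, hyS⟩) hy'
      have hint : x ∈ interior U :=
        interior_maximal hsub (hP.isOpen.inter hUc'.isOpen_compl) ⟨hxΩ, hnot⟩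
      exact hx.2 hint
    obtain ⟨T', hT', hxT'⟩ := Set.mem_iUnion₂.1 hxU'
    exact Set.mem_iUnion₂.2 ⟨T, hT, Set.mem_iUnion₂.2 ⟨T', hT', hxT, hxT'⟩⟩
  · right
    have hfr : x ∈ frontier Ω := by
      rw [hP.isOpen.frontier_eq]
      exact ⟨closure_mono (hP.cell_subset hTm) hxT, hxΩ⟩
    have hfrT : x ∈ frontier (cell s T) := by
      rw [(isOpen_cell s T).frontier_eq]
      exact ⟨hxT, fun h => hxΩ (hP.cell_subset hTm h)⟩
    obtain ⟨G, hG, hxG⟩ := Set.mem_iUnion₂.1 (frontier_cell_subset s T hfrT)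
    exact Set.mem_iUnion₂.2 ⟨T, hT, Set.mem_iUnion₂.2 ⟨G, hG, hxG, hfr⟩⟩

/-- A level set argument instead of a walk through neighbouring elements, so no connectedness of Ω
is needed. The function is constant on each element. If one of the constants is nonzero, the closed
elements carrying that value form a bounded set U with interior points, whose frontier has positive
surface measure. Some face of positive measure then separates U from elements with another value or
lies on ∂Ω, and the jump there does not vanish. -/
theorem eq_zero_of_grad_jump (hd : 2 ≤ d) (hp : 1 ≤ D.degree) (hP : D.IsMesh) {v : D.V}
    (hG : D.volForm (grad v) (grad v) = 0) (hJ : jumpSum v = 0) : v = 0 := by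
  classical
  have hex : ∀ T ∈ D.mesh, ∃ a, ∀ x ∈ closure (cell D.shape T), D.on v T x = a :=
    fun T hT => grad_eq_zero hG hT
  choose! a ha using hex
  by_contra hv
  have hex : ∃ T₀ ∈ D.mesh, a T₀ ≠ 0 := by
    by_contra hall
    push Not at hall
    apply hv
    have h0 : ∀ T, D.on (0 : D.V) T = 0 := fun T => (onLinear hP T).map_zero
    refine ext_on hP fun T hT x hx => ?_
    rw [ha T hT x (subset_closure hx), hall T hT, h0, Pi.zero_apply]
  obtain ⟨T₀, hT₀, ha₀⟩ := hex
  set U := ⋃ T ∈ D.mesh.filter (fun T => a T = a T₀), closure (cell D.shape T) with hU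
  have hUb : Bornology.IsBounded U :=
    (Bornology.isBounded_biUnion_finset _).2 fun T _ => (isBounded_cell D.shape T).closure
  have hUi : (interior U).Nonempty := by
    refine (cell_nonempty D.shape T₀).mono (interior_maximal ?_ (isOpen_cell D.shape T₀))
    exact subset_closure.trans (Set.subset_biUnion_of_mem (u := fun T => closure (cell D.shape T))
      (Finset.mem_coe.2 (Finset.mem_filter.2 ⟨hT₀, rfl⟩)))
  have hpos := surface_frontier_pos hd hUb hUi
  -- It remains to see that every piece covering the frontier is null, since a piece of positive
  -- measure would be a face with a nonzero jump.
  refine hpos.ne' (measure_mono_null (frontier_subset_of_filter hP _) (measure_union_null ?_ ?_))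
  · refine (measure_biUnion_null_iff (Finset.countable_toSet _)).2 fun T hT =>
      (measure_biUnion_null_iff (Finset.countable_toSet _)).2 fun T' hT' => ?_
    obtain ⟨hT, haT⟩ := Finset.mem_filter.1 hT
    obtain ⟨hT', haT'⟩ := Finset.mem_filter.1 hT'
    by_contra hne
    have hTT' : T ≠ T' := by rintro rfl; exact haT' haT
    have hf : (⟨{T, T'}, closure (cell D.shape T) ∩ closure (cell D.shape T')⟩ : Face d) ∈
        interiorFaces D.shape D.mesh :=
      mem_interiorFaces.2 ⟨T, hT, T', hT', hTT', rfl, pos_iff_ne_zero.2 hne⟩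
    obtain ⟨x, hx, hjump⟩ := exists_jump_eq_zero (by omega) hp hP hJ (mem_faces_of_interior hf)
    obtain ⟨T₁, _, T₂, _, _, hmem, _, hsum, _, hneg⟩ := exists_cells_of_mem_interiorFaces hd hP hf
    rw [jump, hsum, hneg, smul_neg, ← sub_eq_add_neg, ← sub_smul] at hjump
    have m1 := (hmem T₁).2 (Or.inl rfl)
    have m2 := (hmem T₂).2 (Or.inr rfl)
    have hn1 := (isFacet_normal hP (mem_faces_of_interior (Ω := Ω) hf) m1).norm
    have hon := sub_eq_zero.1 ((smul_eq_zero.1 hjump).resolve_right fun h0 => by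
      rw [h0, norm_zero] at hn1; norm_num at hn1)
    have hTin : ∀ S, S = T ∨ S = T' → D.on v S x = a S := by
      rintro S (rfl | rfl)
      · exact ha _ hT x hx.1
      · exact ha _ hT' x hx.2
    have e1 : T₁ = T ∨ T₁ = T' := by simpa using m1
    have e2 : T₂ = T ∨ T₂ = T' := by simpa using m2
    rw [hTin _ e1, hTin _ e2] at hon
    have t1 : T = T₁ ∨ T = T₂ := (hmem T).1 (by simp)
    have t2 : T' = T₁ ∨ T' = T₂ := (hmem T').1 (by simp)
    apply haT'
    rw [← haT]
    rcases t1 with rfl | rfl <;> rcases t2 with rfl | rfl <;> simp [hon]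
  · refine (measure_biUnion_null_iff (Finset.countable_toSet _)).2 fun T hT =>
      (measure_biUnion_null_iff (refFacets_finite d D.shape).countable).2 fun G hGm => ?_
    obtain ⟨hT, haT⟩ := Finset.mem_filter.1 hT
    by_contra hne
    have hf : (⟨{T}, T '' G ∩ frontier Ω⟩ : Face d) ∈ faces D.shape Ω D.mesh :=
      mem_faces.2 (Or.inr (mem_boundaryFaces.2 ⟨T, hT, G, hGm, rfl, pos_iff_ne_zero.2 hne⟩))
    obtain ⟨x, hx, hjump⟩ := exists_jump_eq_zero (by omega) hp hP hJ hf
    have hn := (isFacet_normal hP hf (T := T) (by simp)).norm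
    have hn0 : normal D.shape T ⟨{T}, T '' G ∩ frontier Ω⟩ ≠ 0 := by
      rw [← norm_ne_zero_iff, hn]; norm_num
    rw [jump, Finset.sum_singleton] at hjump
    have hon := (smul_eq_zero.1 hjump).resolve_right hn0
    rw [ha T hT x (image_facet_subset_closure hGm hx.1), haT] at hon
    exact ha₀ hon

theorem form_pos (hd : 2 ≤ d) (h₁ : 1 ≤ κ₁) (h₂ : 1 ≤ κ₂) (hB : 0 ≤ B)
    (hD : D.IsRegular κ₁ κ₂ B) {a : ℝ} (ha : 0 < a) (haα : a ≤ D.α)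
    (hθ : D.θ = 0 ∧ 4 * liftConst d D.shape κ₁ κ₂ B ≤ a ∨ D.θ = 1) {v : D.V} (hv : v ≠ 0) :
    0 < D.form v v := by
  have hd0 : 0 < d := by omega
  have hα : 0 < D.α := ha.trans_le haα
  refine (mul_pos (coercConst_pos (liftConst_pos h₁ h₂ hB) ha) ?_).trans_le
    (le_form hd0 h₁ h₂ hB hD ha haα hθ v)
  refine lt_of_le_of_ne (dgNormSq_nonneg hd0 hα.le v) fun h0 => hv ?_
  have hG0 := volForm_self_nonneg (D := D) (grad v)
  have hJ0 := jumpForm_nonneg hd0 hα.le v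
  rw [dgNormSq] at h0
  have hJ : jumpForm v v = 0 := by linarith
  rw [jumpForm_self] at hJ
  exact eq_zero_of_grad_jump hd hD.one_le_degree hD.isMesh (by linarith)
    ((mul_eq_zero.1 hJ).resolve_left hα.ne')

theorem form_self_nonneg (hd : 2 ≤ d) (h₁ : 1 ≤ κ₁) (h₂ : 1 ≤ κ₂) (hB : 0 ≤ B)
    (hD : D.IsRegular κ₁ κ₂ B) {a : ℝ} (ha : 0 < a) (haα : a ≤ D.α)
    (hθ : D.θ = 0 ∧ 4 * liftConst d D.shape κ₁ κ₂ B ≤ a ∨ D.θ = 1) (v : D.V) :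
    0 ≤ D.form v v :=
  (mul_nonneg (coercConst_pos (liftConst_pos h₁ h₂ hB) ha).le
    (dgNormSq_nonneg (by omega) (ha.le.trans haα) v)).trans
    (le_form (by omega) h₁ h₂ hB hD ha haα hθ v)

end Level

/-! ### Uniform refinement -/

theorem apply_eq_sum_bary {d : ℕ} (f : E d →ᵃ[ℝ] E d) (x : E d) :
    f x = ∑ j, bary x j • f (refVertex d j) := by
  have hf : ∀ y, f y = f.linear y + f 0 := fun y => by
    have := f.map_vadd 0 y
    simpa using this
  have hx : x = ∑ i, x i • EuclideanSpace.single i (1 : ℝ) := by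
    ext j
    simp [Finset.sum_apply, Pi.single_apply]
  have hlin : f.linear x = ∑ i, x i • f.linear (EuclideanSpace.single i (1 : ℝ)) := by
    conv_lhs => rw [hx]
    rw [map_sum]
    simp only [map_smul]
  rw [Fin.sum_univ_succ]
  simp only [bary, refVertex, Fin.cons_zero, Fin.cons_succ]
  simp only [hf (EuclideanSpace.single _ _), smul_add, Finset.sum_add_distrib]
  rw [hf x, hlin, sub_smul, one_smul, ← Finset.sum_smul]
  abel

theorem exists_bary_eq {d : ℕ} {μ : Fin (d + 1) → ℝ} (hμ : ∑ j, μ j = 1) :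
    ∃ y : E d, bary y = μ := by
  refine ⟨WithLp.toLp 2 fun i => μ i.succ, ?_⟩
  ext j
  rw [Fin.sum_univ_succ] at hμ
  refine Fin.cases ?_ (fun i => ?_) j
  · simp only [bary, Fin.cons_zero]; linarith
  · simp [bary]

theorem bary_injective {d : ℕ} : Function.Injective (bary : E d → Fin (d + 1) → ℝ) := by
  intro x y h
  ext i
  have := congrFun h i.succ
  simpa [bary] using this

theorem bary_refVertex {d : ℕ} (j : Fin (d + 1)) : bary (refVertex d j) = Pi.single j 1 := by
  ext i
  refine Fin.cases ?_ (fun k => ?_) j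
  · refine Fin.cases ?_ (fun l => ?_) i <;> simp [bary, refVertex]
  · refine Fin.cases ?_ (fun l => ?_) i
    · simp [bary, refVertex, (Fin.succ_ne_zero _).symm]
    · simp [bary, refVertex, Pi.single_apply]

/-- No child lies in a facet of its parent. This makes all parental barycentric coordinates of a
point of the open child strictly positive. -/
theorem redChildren_covers {d : ℕ} (hd : d = 2 ∨ d = 3) :
    ∀ c ∈ redChildren d, ∀ i, ∃ j, (c j).1 = i ∨ (c j).2 = i := by
  intro c hc
  rcases hd with rfl | rfl
  · simp only [redChildren, List.mem_cons, List.not_mem_nil, or_false] at hc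
    rcases hc with rfl | rfl | rfl | rfl <;> decide
  · simp only [redChildren, List.mem_cons, List.not_mem_nil, or_false] at hc
    rcases hc with rfl | rfl | rfl | rfl | rfl | rfl | rfl | rfl <;> decide

theorem corner_mem_redChildren {d : ℕ} (hd : d = 2 ∨ d = 3) :
    (fun j => (0, j)) ∈ redChildren d := by
  rcases hd with rfl | rfl
  · decide
  · decide

theorem IsChild.cell_subset {d : ℕ} (hd : d = 2 ∨ d = 3) {s : Shape}
    {π : Equiv.Perm (Fin (d + 1))} {T T' : Cell d} (h : IsChild s π T T') :
    cell s T' ⊆ cell s T := by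
  classical
  rintro _ ⟨x, hx, rfl⟩
  cases s
  · obtain ⟨c, hc, hcT⟩ := h
    rw [mem_simplex_iff] at hx
    -- The barycentric coordinates, with respect to the vertices of T, of the image of x under T'.
    set μ : Fin (d + 1) → ℝ := fun i => ∑ j, bary x j *
      ((if i = π (c j).1 then 1 / 2 else 0) + (if i = π (c j).2 then 1 / 2 else 0)) with hμ
    have hsum : ∑ i, μ i = 1 := by
      rw [hμ, Finset.sum_comm]
      refine Eq.trans ?_ (sum_bary x)
      refine Finset.sum_congr rfl fun j _ => ?_
      rw [← Finset.mul_sum, Finset.sum_add_distrib]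
      simp only [Finset.sum_ite_eq', Finset.mem_univ, if_true]
      ring
    obtain ⟨y, hy⟩ := exists_bary_eq hsum
    refine ⟨y, ?_, ?_⟩
    · rw [mem_simplex_iff, hy]
      intro i
      have hnn : ∀ j, 0 ≤ (if i = π (c j).1 then (1 / 2 : ℝ) else 0) +
          (if i = π (c j).2 then 1 / 2 else 0) := fun j => by positivity
      refine Finset.sum_pos' (fun j _ => mul_nonneg (hx j).le (hnn j)) ?_
      obtain ⟨j, hj⟩ := redChildren_covers hd c hc (π.symm i)
      refine ⟨j, Finset.mem_univ j, mul_pos (hx j) ?_⟩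
      rcases hj with hj | hj
      · rw [hj, Equiv.apply_symm_apply, if_pos rfl]; positivity
      · rw [hj, Equiv.apply_symm_apply, if_pos rfl]; positivity
    · have h1 := apply_eq_sum_bary (T : E d →ᵃ[ℝ] E d) y
      have h2 := apply_eq_sum_bary (T' : E d →ᵃ[ℝ] E d) x
      simp only [AffineEquiv.coe_toAffineMap] at h1 h2
      rw [h1, h2, hy, hμ]
      simp only [Finset.sum_smul]
      rw [Finset.sum_comm]
      refine Finset.sum_congr rfl fun j _ => ?_
      rw [hcT j, midpoint_eq_smul_add]
      simp only [mul_smul, add_smul, smul_add, Finset.sum_add_distrib, ← Finset.smul_sum,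
        ite_smul, zero_smul, Finset.sum_ite_eq', Finset.mem_univ, if_true, one_div]
      rw [invOf_eq_inv]
  · obtain ⟨ε, hε⟩ := h
    rw [hε]
    refine ⟨_, fun i => ?_, rfl⟩
    have hxi := hx i
    have e : (∑ k ∈ ε, EuclideanSpace.single k (1 : ℝ) : E d) i = if i ∈ ε then 1 else 0 := by
      rw [WithLp.ofLp_sum, Finset.sum_apply]
      simp
    simp only [PiLp.smul_apply, PiLp.add_apply, smul_eq_mul, e]
    split_ifs
    · constructor <;> linarith
    · constructor <;> linarith

/-- The affine permutation of the vertices of the reference simplex. -/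
def vertexPerm {d : ℕ} (π : Equiv.Perm (Fin (d + 1))) : E d →ᵃ[ℝ] E d where
  toFun x := WithLp.toLp 2 fun i => bary x (π.symm i.succ)
  linear :=
    { toFun := fun x => WithLp.toLp 2 fun i => bary x (π.symm i.succ) - bary 0 (π.symm i.succ)
      map_add' := fun x y => by
        ext i
        simp only [PiLp.add_apply]
        refine Fin.cases ?_ (fun k => ?_) (π.symm i.succ) <;>
        simp [bary, Finset.sum_add_distrib]
        ring
      map_smul' := fun a x => by
        ext i
        simp only [PiLp.smul_apply, smul_eq_mul, RingHom.id_apply]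
        refine Fin.cases ?_ (fun k => ?_) (π.symm i.succ) <;>
        simp [bary, Finset.mul_sum] }
  map_vadd' x v := by
    ext i
    simp only [vadd_eq_add, PiLp.add_apply, LinearMap.coe_mk, AddHom.coe_mk]
    refine Fin.cases ?_ (fun k => ?_) (π.symm i.succ) <;>
    simp [bary, Finset.sum_add_distrib]
    ring

theorem bary_vertexPerm {d : ℕ} (π : Equiv.Perm (Fin (d + 1))) (x : E d) :
    bary (vertexPerm π x) = fun j => bary x (π.symm j) := by
  have hsum : ∑ j, bary x (π.symm j) = 1 := by
    rw [Equiv.sum_comp π.symm (bary x), sum_bary]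
  ext j
  rw [Fin.sum_univ_succ] at hsum
  refine Fin.cases ?_ (fun k => ?_) j
  · have : ∑ i, vertexPerm π x i = ∑ i : Fin d, bary x (π.symm i.succ) := rfl
    rw [bary, Fin.cons_zero, this]
    linarith
  · rw [bary, Fin.cons_succ]; rfl

theorem bijective_vertexPerm {d : ℕ} (π : Equiv.Perm (Fin (d + 1))) :
    Function.Bijective (vertexPerm (d := d) π) := by
  constructor
  · intro x y h
    apply bary_injective
    have := congrArg bary h
    rw [bary_vertexPerm, bary_vertexPerm] at this
    ext j
    have h2 := congrFun this (π j)
    simpa using h2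
  · intro y
    refine ⟨vertexPerm π.symm y, bary_injective ?_⟩
    rw [bary_vertexPerm, bary_vertexPerm]
    ext j
    simp

theorem vertexPerm_image {d : ℕ} (π : Equiv.Perm (Fin (d + 1))) :
    vertexPerm π '' refElement d .simplex = refElement d .simplex := by
  ext y
  constructor
  · rintro ⟨x, hx, rfl⟩
    rw [mem_simplex_iff] at hx ⊢
    intro j
    rw [bary_vertexPerm]
    exact hx _
  · intro hy
    obtain ⟨x, rfl⟩ := (bijective_vertexPerm π).2 y
    refine ⟨x, ?_, rfl⟩
    rw [mem_simplex_iff] at hy ⊢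
    intro j
    have := hy (π j)
    simpa only [bary_vertexPerm, Equiv.symm_apply_apply] using this

theorem vertexPerm_refVertex {d : ℕ} (π : Equiv.Perm (Fin (d + 1))) (j : Fin (d + 1)) :
    vertexPerm π (refVertex d j) = refVertex d (π j) := by
  apply bary_injective
  rw [bary_vertexPerm, bary_refVertex, bary_refVertex]
  ext i
  simp only [Pi.single_apply, Equiv.symm_apply_eq]

/-- The contraction by the factor `1 / 2` towards `x₀`. -/
def halfTowards {d : ℕ} (x₀ : E d) : Cell d :=
  AffineEquiv.homothetyUnitsMulHom x₀ (Units.mk0 (1 / 2 : ℝ) (by norm_num))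

theorem halfTowards_apply {d : ℕ} (x₀ x : E d) : halfTowards x₀ x = midpoint ℝ x₀ x := by
  have : halfTowards x₀ x = AffineMap.homothety x₀ (1 / 2 : ℝ) x := rfl
  rw [this, AffineMap.homothety_eq_lineMap, midpoint, invOf_eq_inv, one_div]

/-- One child is similar to its parent, even for tetrahedra, where the inner children need not be.
For simplices the element map of this child first renumbers the vertices by π, which preserves the
reference simplex, and then contracts towards the vertex π 0. -/
theorem exists_corner_child {d : ℕ} (hd : d = 2 ∨ d = 3) (s : Shape)
    (π : Equiv.Perm (Fin (d + 1))) (T : Cell d) :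
    ∃ (T' : Cell d) (x₀ : E d), IsChild s π T T' ∧
      cell s T' = (fun y => midpoint ℝ x₀ y) '' cell s T := by
  cases s
  · let A : Cell d := AffineEquiv.ofBijective (bijective_vertexPerm π)
    have hA : ∀ x, A x = vertexPerm π x := fun x => rfl
    have hT' : ∀ x, (A.trans ((halfTowards (refVertex d (π 0))).trans T)) x =
        midpoint ℝ (T (refVertex d (π 0))) (T (vertexPerm π x)) := by
      intro x
      simp only [AffineEquiv.trans_apply, halfTowards_apply, hA, AffineEquiv.map_midpoint]
    refine ⟨A.trans ((halfTowards (refVertex d (π 0))).trans T), T (refVertex d (π 0)),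
      ⟨_, corner_mem_redChildren hd, fun j => ?_⟩, ?_⟩
    · rw [hT', vertexPerm_refVertex]
    · rw [cell, cell]
      conv_rhs => rw [← vertexPerm_image π, Set.image_image, Set.image_image]
      exact Set.image_congr fun x _ => hT' x
  · have hT' : ∀ x, ((halfTowards (0 : E d)).trans T) x = midpoint ℝ (T 0) (T x) := by
      intro x
      simp only [AffineEquiv.trans_apply, halfTowards_apply, AffineEquiv.map_midpoint]
    refine ⟨(halfTowards 0).trans T, T 0, ⟨∅, fun x => ?_⟩, ?_⟩
    · simp [AffineEquiv.trans_apply, halfTowards_apply, midpoint_eq_smul_add]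
    · rw [cell, cell, Set.image_image]
      exact Set.image_congr fun x _ => hT' x

theorem diam_midpoint_image {d : ℕ} {A : Set (E d)} (hA : Bornology.IsBounded A) (x₀ : E d) :
    Metric.diam ((fun y => midpoint ℝ x₀ y) '' A) = Metric.diam A / 2 := by
  have hdist : ∀ y z : E d, dist (midpoint ℝ x₀ y) (midpoint ℝ x₀ z) = dist y z / 2 := by
    intro y z
    rw [dist_eq_norm, dist_eq_norm, midpoint_eq_smul_add, midpoint_eq_smul_add, ← smul_sub,
      add_sub_add_left_eq_sub, norm_smul]
    rw [invOf_eq_inv, norm_inv, Real.norm_ofNat]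
    ring
  have hlip : LipschitzWith 1 fun y : E d => midpoint ℝ x₀ y :=
    LipschitzWith.of_dist_le_mul fun y z => by
      rw [hdist, NNReal.coe_one, one_mul]
      linarith [dist_nonneg (x := y) (y := z)]
  have hb : Bornology.IsBounded ((fun y => midpoint ℝ x₀ y) '' A) := hlip.isBounded_image hA
  apply le_antisymm
  · refine Metric.diam_le_of_forall_dist_le (by positivity) ?_
    rintro _ ⟨y, hy, rfl⟩ _ ⟨z, hz, rfl⟩
    rw [hdist]
    linarith [Metric.dist_le_diam_of_mem hA hy hz]
  · have : Metric.diam A ≤ 2 * Metric.diam ((fun y => midpoint ℝ x₀ y) '' A) := by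
      refine Metric.diam_le_of_forall_dist_le (by positivity) fun y hy z hz => ?_
      have := Metric.dist_le_diam_of_mem hb (Set.mem_image_of_mem _ hy) (Set.mem_image_of_mem _ hz)
      rw [hdist] at this
      linarith
    linarith

section Refinement

variable {d : ℕ} {s : Shape} {𝒯 𝒯' : Finset (Cell d)} {κ : ℝ}

theorem IsRefinement.exists_half (hd : d = 2 ∨ d = 3) (h : IsRefinement s 𝒯 𝒯') {T : Cell d}
    (hT : T ∈ 𝒯) : ∃ T' ∈ 𝒯', ∃ x₀, cell s T' = (fun y => midpoint ℝ x₀ y) '' cell s T ∧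
      Metric.diam (cell s T') = Metric.diam (cell s T) / 2 := by
  obtain ⟨π, hπ⟩ := h
  obtain ⟨T', x₀, hch, hcell⟩ := exists_corner_child hd s (π T) T
  refine ⟨T', (hπ T').2 ⟨T, hT, hch⟩, x₀, hcell, ?_⟩
  rw [hcell, diam_midpoint_image (isBounded_cell s T)]

/-- Regularity is assumed on the finest mesh and has to be passed to coarser ones. The similar child
of T has an inscribed ball, and undoing the contraction doubles both its radius and the diameter. -/
theorem IsRefinement.isShapeRegular (hd : d = 2 ∨ d = 3) (h : IsRefinement s 𝒯 𝒯')
    (hreg : IsShapeRegular s κ 𝒯') : IsShapeRegular s κ 𝒯 := by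
  intro T hT
  obtain ⟨T', hT', x₀, hcell, hdiam⟩ := h.exists_half hd hT
  obtain ⟨y, r, hr, hball, hle⟩ := hreg T' hT'
  -- Centre and radius of the preimage of the ball under z ↦ midpoint of x₀ and z.
  refine ⟨(2 : ℝ) • y - x₀, 2 * r, by positivity, fun z hz => ?_, by linarith⟩
  have hmem : midpoint ℝ x₀ z ∈ cell s T' := hball (by
    rw [Metric.mem_ball, dist_eq_norm] at hz ⊢
    have e : midpoint ℝ x₀ z - y = (2 : ℝ)⁻¹ • (z - ((2 : ℝ) • y - x₀)) := by
      rw [midpoint_eq_smul_add, invOf_eq_inv]; module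
    rw [e, norm_smul, norm_inv, Real.norm_ofNat]
    linarith)
  rw [hcell] at hmem
  obtain ⟨z', hz', heq⟩ := hmem
  have : z' = z := by
    simp only [midpoint_eq_smul_add, invOf_eq_inv] at heq
    have := smul_right_injective (E d) (by norm_num : (2 : ℝ)⁻¹ ≠ 0) heq
    exact add_left_cancel this
  rwa [← this]

theorem IsRefinement.isQuasiUniform (hd : d = 2 ∨ d = 3) (h : IsRefinement s 𝒯 𝒯')
    (hqu : IsQuasiUniform s κ 𝒯') : IsQuasiUniform s κ 𝒯 := by
  intro T₁ hT₁ T₂ hT₂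
  obtain ⟨T₁', hT₁', _, _, hd₁⟩ := h.exists_half hd hT₁
  obtain ⟨T₂', hT₂', _, _, hd₂⟩ := h.exists_half hd hT₂
  have := hqu T₁' hT₁' T₂' hT₂'
  rw [hd₁, hd₂] at this
  linarith

/-- The half-size child of T lies in the fine mesh and is comparable to T' there, so
quasi-uniformity costs only an extra factor 2. -/
theorem IsRefinement.diam_le (hd : d = 2 ∨ d = 3) (h : IsRefinement s 𝒯 𝒯')
    (hqu : IsQuasiUniform s κ 𝒯') {T T' : Cell d} (hT : T ∈ 𝒯) (hT' : T' ∈ 𝒯') :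
    Metric.diam (cell s T) ≤ 2 * κ * Metric.diam (cell s T') := by
  obtain ⟨S, hS, _, _, hdS⟩ := h.exists_half hd hT
  have := hqu S hS T' hT'
  rw [hdS] at this
  linarith

theorem IsRefinement.exists_parent (h : IsRefinement s 𝒯 𝒯') {T' : Cell d} (hT' : T' ∈ 𝒯') :
    ∃ T ∈ 𝒯, ∃ π, IsChild s π T T' := by
  obtain ⟨π, hπ⟩ := h
  obtain ⟨T, hT, hch⟩ := (hπ T').1 hT'
  exact ⟨T, hT, π T, hch⟩

end Refinement

/-! ### Polynomials on the children of an element -/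

theorem aeval_mem_of_monomials {d q : ℕ} {s : Shape} {P : MvPolynomial (Fin d) ℝ}
    (L : Fin d → MvPolynomial (Fin d) ℝ)
    (h : ∀ m ∈ P.support, (∏ i, L i ^ m i) ∈ refPoly d s q) :
    MvPolynomial.aeval L P ∈ refPoly d s q := by
  rw [MvPolynomial.aeval_def, MvPolynomial.eval₂_eq']
  refine Submodule.sum_mem _ fun m hm => ?_
  rw [← Algebra.smul_def]
  exact Submodule.smul_mem _ _ (h m hm)

theorem mem_refPoly_cube_iff {d q : ℕ} {P : MvPolynomial (Fin d) ℝ} :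
    P ∈ refPoly d .cube q ↔ ∀ i, P.degreeOf i ≤ q := by
  simp only [MvPolynomial.degreeOf_le_iff]
  refine (MvPolynomial.mem_restrictDegree (Fin d) P q).trans ?_
  exact ⟨fun h i m hm => h m hm i, fun h m hm i => h i m hm⟩

theorem pushPoly_of_eval {d : ℕ} {T T' : Cell d} {P : MvPolynomial (Fin d) ℝ}
    {L : Fin d → MvPolynomial (Fin d) ℝ}
    (hL : ∀ x : E d, ∀ i, MvPolynomial.eval (fun j => x j) (L i) = T.symm (T' x) i) :
    Level.pushPoly T' (MvPolynomial.aeval L P) = Level.pushPoly T P := by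
  ext x
  have hc : (MvPolynomial.eval fun i => T'.symm x i).comp
      (algebraMap ℝ (MvPolynomial (Fin d) ℝ)) = RingHom.id ℝ := by
    ext a; simp [MvPolynomial.algebraMap_eq]
  rw [Level.pushPoly, Level.pushPoly, MvPolynomial.aeval_def, MvPolynomial.hom_eval₂, hc]
  have hp : ∀ i, MvPolynomial.eval (fun j => T'.symm x j) (L i) = T.symm x i := fun i => by
    rw [hL, AffineEquiv.apply_symm_apply]
  conv_rhs => unfold MvPolynomial.eval
  rw [MvPolynomial.coe_eval₂Hom]
  congr 1
  ext i
  exact hp i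

/-- Substituting the affine map T⁻¹ ∘ T' does not raise the total degree. On the hypercube the map
acts in each coordinate separately, so the degree in each variable is preserved as well. -/
theorem IsChild.exists_pushPoly_eq {d p : ℕ} {s : Shape}
    {π : Equiv.Perm (Fin (d + 1))} {T T' : Cell d} (h : IsChild s π T T')
    {P : MvPolynomial (Fin d) ℝ} (hP : P ∈ refPoly d s p) :
    ∃ Q ∈ refPoly d s p, Level.pushPoly T' Q = Level.pushPoly T P := by
  cases s
  · set f : E d →ᵃ[ℝ] E d := ((T'.trans T.symm : Cell d) : E d →ᵃ[ℝ] E d) with hf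
    set L : Fin d → MvPolynomial (Fin d) ℝ := fun i => MvPolynomial.C (f 0 i) +
      ∑ j, MvPolynomial.C (f.linear (EuclideanSpace.single j (1 : ℝ)) i) * MvPolynomial.X j with hL
    have hLdeg : ∀ i, (L i).totalDegree ≤ 1 := by
      intro i
      refine (MvPolynomial.totalDegree_add _ _).trans (max_le (by simp) ?_)
      refine MvPolynomial.totalDegree_finsetSum_le fun j _ => ?_
      refine (MvPolynomial.totalDegree_mul _ _).trans ?_
      simp
    refine ⟨MvPolynomial.aeval L P, aeval_mem_of_monomials L fun m hm => ?_,
      pushPoly_of_eval fun x i => ?_⟩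
    · refine (MvPolynomial.mem_restrictTotalDegree _ _ _).2 ?_
      have hP' := (MvPolynomial.mem_restrictTotalDegree (Fin d) p P).1 hP
      refine (MvPolynomial.totalDegree_finsetProd _ _).trans ?_
      calc ∑ i, (L i ^ m i).totalDegree ≤ ∑ i, m i := by
            refine Finset.sum_le_sum fun i _ => (MvPolynomial.totalDegree_pow _ _).trans ?_
            simpa using Nat.mul_le_mul_left (m i) (hLdeg i)
        _ = m.sum fun _ e => e := (m.sum_fintype (fun _ e => e) fun _ => rfl).symm
        _ ≤ P.totalDegree := MvPolynomial.le_totalDegree hm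
        _ ≤ p := hP'
    · have h1 : T.symm (T' x) = f.linear x + f 0 := by
        have := f.map_vadd 0 x
        simpa [hf] using this
      have hx : x = ∑ i, x i • EuclideanSpace.single i (1 : ℝ) := by
        ext j
        simp [Finset.sum_apply, Pi.single_apply]
      have h2 : f.linear x i = ∑ j, x j * f.linear (EuclideanSpace.single j (1 : ℝ)) i := by
        conv_lhs => rw [hx]
        rw [map_sum, WithLp.ofLp_sum, Finset.sum_apply]
        simp
      rw [h1, PiLp.add_apply, h2, hL]
      simp [add_comm, mul_comm]
  · obtain ⟨ε, hε⟩ := h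
    set c : E d := (1 / 2 : ℝ) • ∑ i ∈ ε, EuclideanSpace.single i 1 with hc
    set L : Fin d → MvPolynomial (Fin d) ℝ := fun i =>
      MvPolynomial.C (1 / 2) * MvPolynomial.X i + MvPolynomial.C (c i) with hL
    have hLdeg : ∀ i j, (L i).degreeOf j ≤ if i = j then 1 else 0 := by
      classical
      intro i j
      refine (MvPolynomial.degreeOf_add_le _ _ _).trans (max_le ?_ (by simp))
      refine (MvPolynomial.degreeOf_C_mul_le _ _ _).trans ?_
      rw [MvPolynomial.degreeOf_X]
      simp only [eq_comm, le_refl]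
    refine ⟨MvPolynomial.aeval L P, aeval_mem_of_monomials L fun m hm => ?_,
      pushPoly_of_eval fun x i => ?_⟩
    · rw [mem_refPoly_cube_iff]
      intro j
      refine (MvPolynomial.degreeOf_prod_le _ _ _).trans ?_
      calc ∑ i, (L i ^ m i).degreeOf j ≤ ∑ i, m i * (if i = j then 1 else 0) :=
            Finset.sum_le_sum fun i _ => (MvPolynomial.degreeOf_pow_le _ _ _).trans
              (Nat.mul_le_mul_left _ (hLdeg i j))
        _ = m j := by simp
        _ ≤ p := (MvPolynomial.mem_restrictDegree (Fin d) P p).1 hP m hm j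
    · rw [hε, AffineEquiv.symm_apply_apply, smul_add, ← hc, hL]
      simp

/-! ### Comparison of the norms on two consecutive levels -/

/-- The sets B i may overlap, which only enlarges the right side because g is nonnegative, and they
need to cover A only almost everywhere. -/
theorem setIntegral_le_sum {X ι : Type*} [MeasurableSpace X] {μ : Measure X} {g : X → ℝ}
    (hg : ∀ x, 0 ≤ g x) (S : Finset ι) {A : Set X} {B : ι → Set X}
    (hB : ∀ i ∈ S, MeasurableSet (B i)) (hint : ∀ i ∈ S, IntegrableOn g (B i) μ)
    (hA : A ≤ᵐ[μ] ⋃ i ∈ S, B i) : ∫ x in A, g x ∂μ ≤ ∑ i ∈ S, ∫ x in B i, g x ∂μ := by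
  classical
  have hnn : ∀ t : Set X, 0 ≤ᵐ[μ.restrict t] g := fun t => Filter.Eventually.of_forall hg
  have hU : IntegrableOn g (⋃ i ∈ S, B i) μ := (integrableOn_finset_iUnion).2 hint
  refine (setIntegral_mono_set hU (hnn _) hA).trans ?_
  clear hA
  induction S using Finset.induction_on with
  | empty => simp
  | insert j S hj ih =>
    rw [Finset.set_biUnion_insert] at hU ⊢
    have hm : MeasurableSet (⋃ i ∈ S, B i) :=
      S.measurableSet_biUnion fun i hi => hB i (Finset.mem_insert_of_mem hi)
    have hUS : IntegrableOn g (⋃ i ∈ S, B i) μ := hU.mono_set Set.subset_union_right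
    have hUj : IntegrableOn g (B j) μ := hU.mono_set Set.subset_union_left
    rw [Finset.sum_insert hj, ← Set.sdiff_union_self,
      setIntegral_union Set.disjoint_sdiff_left hm (hUj.mono_set Set.sdiff_subset) hUS]
    exact add_le_add (setIntegral_mono_set hUj (hnn _) Set.sdiff_subset.eventuallyLE)
      (ih (fun i hi => hB i (Finset.mem_insert_of_mem hi))
        (fun i hi => hint i (Finset.mem_insert_of_mem hi)) hUS)

namespace Level

variable {d : ℕ} {Ω : Set (E d)}

/-- The mesh of `Df` is nested in the mesh of `Dc`; `par` maps an element to its parent. -/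
structure IsNested (Dc Df : Level d Ω) (par : Cell d → Cell d) : Prop where
  shape_eq : Df.shape = Dc.shape
  V_le : Dc.V ≤ Df.V
  mem : ∀ T ∈ Df.mesh, par T ∈ Dc.mesh
  subset : ∀ T ∈ Df.mesh, cell Dc.shape T ⊆ cell Dc.shape (par T)

/-- A parent is chosen for every fine element. On a child, a polynomial of the parent is again an
admissible polynomial, which gives the inclusion of the spaces. -/
theorem exists_isNested (hd : d = 2 ∨ d = 3) {Dc Df : Level d Ω} (hs : Df.shape = Dc.shape)
    (href : IsRefinement Dc.shape Dc.mesh Df.mesh) (hdeg : Dc.degree ≤ Df.degree) :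
    ∃ par, IsNested Dc Df par := by
  have h : ∀ T' ∈ Df.mesh, ∃ T ∈ Dc.mesh, ∃ π, IsChild Dc.shape π T T' :=
    fun T' hT' => href.exists_parent hT'
  choose! par hmem hch using h
  refine ⟨par, hs, fun v hv T' hT' => ?_, hmem, fun T' hT' => ?_⟩
  · obtain ⟨P, hP, hvP⟩ := hv (par T') (hmem T' hT')
    obtain ⟨π, hπ⟩ := hch T' hT'
    obtain ⟨Q, hQ, hQe⟩ := hπ.exists_pushPoly_eq hP
    rw [hs]
    refine ⟨Q, refPoly_mono hdeg hQ, ?_⟩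
    filter_upwards [hvP] with x hx hxT'
    rw [hx (hπ.cell_subset hd hxT'), hQe]
  · obtain ⟨π, hπ⟩ := hch T' hT'
    exact hπ.cell_subset hd

variable {Dc Df : Level d Ω} {par : Cell d → Cell d} {κ₁ κ₂ B : ℝ}

theorem IsNested.on_inclusion (h : IsNested Dc Df par) (hPc : Dc.IsMesh) (hPf : Df.IsMesh)
    (v : Dc.V) {T : Cell d} (hT : T ∈ Df.mesh) :
    Df.on (Submodule.inclusion h.V_le v) T = Dc.on v (par T) := by
  refine on_unique hPf _ hT (Dc.continuous_on v (par T)) (Dc.isPolyOnLines_on v (par T))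
    (isOpen_cell Df.shape T) (cell_nonempty Df.shape T) subset_rfl ?_
  have h1 := on_ae_cell hPc v (h.mem T hT)
  rw [h.shape_eq]
  exact ae_mono (Measure.restrict_mono (h.subset T hT) le_rfl) h1

/-- The assumptions that relate two consecutive levels. -/
structure IsComparable (Dc Df : Level d Ω) (κ₂ c : ℝ) : Prop where
  diam_le : ∀ T ∈ Dc.mesh, ∀ T' ∈ Df.mesh,
    Metric.diam (cell Dc.shape T) ≤ 2 * κ₂ * Metric.diam (cell Dc.shape T')
  degree_le : (Df.degree : ℝ) ≤ c * Dc.degree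

open Classical in
theorem IsNested.card_children_le (h : IsNested Dc Df par) (hd : 0 < d) (h₁ : 1 ≤ κ₁)
    (h₂ : 1 ≤ κ₂) {c : ℝ} (hcmp : IsComparable Dc Df κ₂ c) (hDf : Df.IsRegular κ₁ κ₂ B)
    {T : Cell d} (hT : T ∈ Dc.mesh) :
    ((Df.mesh.filter fun T' => par T' = T).card : ℝ) ≤ neighbourBound d κ₁ κ₂ := by
  obtain ⟨x, hx⟩ := cell_nonempty Dc.shape T
  have hP := hDf.isMesh
  have hreg := hDf.shapeRegular
  rw [IsMesh, h.shape_eq] at hP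
  rw [h.shape_eq] at hreg
  refine card_cells_le hd hP hreg h₁ h₂ (Finset.filter_subset _ _) (T := T) (x := x) (a := 1)
    one_pos (fun T' hT' => ?_) fun T' hT' y hy => ?_
  · refine (hcmp.diam_le T hT T' (Finset.mem_filter.1 hT').1).trans ?_
    rw [div_one]
    have := Metric.diam_nonneg (s := cell Dc.shape T')
    gcongr
    linarith
  · obtain ⟨hT'm, rfl⟩ := Finset.mem_filter.1 hT'
    rw [Metric.mem_closedBall, one_mul]
    exact Metric.dist_le_diam_of_mem (isBounded_cell _ _) (h.subset T' hT'm hy) hx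

/-- A crude count suffices: the integral over a child is bounded by the integral over its whole
parent, and the number of children is bounded by packing. -/
theorem IsNested.volForm_grad_le (h : IsNested Dc Df par) (hd : 0 < d) (h₁ : 1 ≤ κ₁)
    (h₂ : 1 ≤ κ₂) {c : ℝ} (hcmp : IsComparable Dc Df κ₂ c) (hPc : Dc.IsMesh)
    (hDf : Df.IsRegular κ₁ κ₂ B) (v : Dc.V) :
    Df.volForm (grad (Submodule.inclusion h.V_le v)) (grad (Submodule.inclusion h.V_le v)) ≤
      neighbourBound d κ₁ κ₂ * Dc.volForm (grad v) (grad v) := by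
  classical
  have hI0 : ∀ T, 0 ≤ ∫ x in cell Dc.shape T, ⟪grad v T x, grad v T x⟫ :=
    fun T => integral_nonneg fun _ => real_inner_self_nonneg
  calc _ ≤ ∑ T ∈ Df.mesh, ∫ x in cell Dc.shape (par T), ⟪grad v (par T) x, grad v (par T) x⟫ := by
        refine Finset.sum_le_sum fun T hT => ?_
        rw [grad, h.on_inclusion hPc hDf.isMesh v hT, h.shape_eq]
        exact setIntegral_mono_set
          (integrableOn_inner_cell (continuous_grad v (par T)) (continuous_grad v (par T)) _)
          (Filter.Eventually.of_forall fun _ => real_inner_self_nonneg)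
          (h.subset T hT).eventuallyLE
    _ = ∑ T ∈ Dc.mesh, ((Df.mesh.filter fun T' => par T' = T).card : ℝ) *
          ∫ x in cell Dc.shape T, ⟪grad v T x, grad v T x⟫ := by
        rw [← Finset.sum_fiberwise_of_maps_to h.mem]
        refine Finset.sum_congr rfl fun T _ => ?_
        rw [← nsmul_eq_mul, ← Finset.sum_const]
        refine Finset.sum_congr rfl fun T' hT' => ?_
        rw [(Finset.mem_filter.1 hT').2]
    _ ≤ _ := by
        rw [volForm, Finset.mul_sum]
        exact Finset.sum_le_sum fun T hT => mul_le_mul_of_nonneg_right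
          (h.card_children_le hd h₁ h₂ hcmp hDf hT) (hI0 T)

/-- The scaled jump on one face. -/
def faceTerm {D : Level d Ω} (v : D.V) (f : Face d) : ℝ :=
  (D.degree : ℝ) ^ 2 / faceSize D.shape f * ∫ x in f.carrier, ‖D.jump v f x‖ ^ 2 ∂(surface d)

theorem faceTerm_nonneg {D : Level d Ω} (hd : 0 < d) (v : D.V) {f : Face d}
    (hf : f ∈ faces D.shape Ω D.mesh) : 0 ≤ faceTerm v f :=
  mul_nonneg (div_nonneg (sq_nonneg _) (faceSize_pos hd (cells_nonempty hf)).le)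
    (integral_nonneg fun _ => sq_nonneg _)

open Classical in
theorem norm_jump_interior {D : Level d Ω} (hd : 2 ≤ d) (hP : D.IsMesh) (v : D.V) {f : Face d}
    (hf : f ∈ interiorFaces D.shape D.mesh) {T T' : Cell d} (hc : f.cells = {T, T'})
    (x : E d) : ‖D.jump v f x‖ = |D.on v T x - D.on v T' x| := by
  obtain ⟨T₁, _, T₂, _, hne, hmem, _, hsum, _, hneg⟩ := exists_cells_of_mem_interiorFaces hd hP hf
  have m1 := (hmem T₁).2 (Or.inl rfl)
  have hn1 := (isFacet_normal hP (mem_faces_of_interior (Ω := Ω) hf) m1).norm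
  rw [jump, hsum, hneg, smul_neg, ← sub_eq_add_neg, ← sub_smul, norm_smul, hn1, mul_one,
    Real.norm_eq_abs]
  have m2 := (hmem T₂).2 (Or.inr rfl)
  have t1 := (hmem T).1 (by simp [hc])
  have t2 := (hmem T').1 (by simp [hc])
  rw [hc] at m1 m2
  simp only [Finset.mem_insert, Finset.mem_singleton] at m1 m2
  rcases m1 with rfl | rfl
  · rcases m2 with rfl | rfl
    · exact absurd rfl hne
    · rfl
  · rcases m2 with rfl | rfl
    · exact abs_sub_comm _ _
    · exact absurd rfl hne

theorem norm_jump_boundary {D : Level d Ω} (hP : D.IsMesh) (v : D.V) {f : Face d}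
    (hf : f ∈ faces D.shape Ω D.mesh) {T : Cell d} (hc : f.cells = {T})
    (x : E d) : ‖D.jump v f x‖ = |D.on v T x| := by
  have hn := (isFacet_normal hP hf (T := T) (by simp [hc])).norm
  rw [jump, hc, Finset.sum_singleton, norm_smul, hn, mul_one, Real.norm_eq_abs]

/-- The element T realising the size of f has its parent next to F, so the size of F is at most
h_{par T} ≤ 2 κ₂ h_T. The degrees contribute c². -/
theorem IsNested.weight_le (h : IsNested Dc Df par) (hd : 0 < d)
    {c : ℝ} (hcmp : IsComparable Dc Df κ₂ c) {f F : Face d} (hf : f ∈ faces Df.shape Ω Df.mesh)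
    (hF : F ∈ faces Dc.shape Ω Dc.mesh) (hR : ∀ T ∈ f.cells, par T ∈ F.cells) :
    (Df.degree : ℝ) ^ 2 / faceSize Df.shape f ≤
      2 * κ₂ * c ^ 2 * ((Dc.degree : ℝ) ^ 2 / faceSize Dc.shape F) := by
  obtain ⟨T, hT, hsz⟩ := exists_faceSize_eq (s := Df.shape) (cells_nonempty hf)
  have hTm := mem_mesh_of_mem_cells hf hT
  have h1 := faceSize_le (s := Dc.shape) (hR T hT)
  have h2 := hcmp.diam_le (par T) (h.mem T hTm) T hTm
  have hpos := faceSize_pos hd (s := Dc.shape) (cells_nonempty hF)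
  have hposf := faceSize_pos hd (s := Df.shape) (cells_nonempty hf)
  rw [h.shape_eq] at hsz hposf ⊢
  rw [← hsz] at h2
  rw [div_le_iff₀ hposf]
  have hdeg : (Df.degree : ℝ) ^ 2 ≤ c ^ 2 * (Dc.degree : ℝ) ^ 2 := by
    rw [← mul_pow]
    exact pow_le_pow_left₀ (Nat.cast_nonneg _) hcmp.degree_le 2
  calc (Df.degree : ℝ) ^ 2 ≤ c ^ 2 * (Dc.degree : ℝ) ^ 2 := hdeg
    _ = c ^ 2 * (Dc.degree : ℝ) ^ 2 / faceSize Dc.shape F * faceSize Dc.shape F := by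
        field_simp
    _ ≤ c ^ 2 * (Dc.degree : ℝ) ^ 2 / faceSize Dc.shape F *
          (2 * κ₂ * faceSize Dc.shape f) := by
        refine mul_le_mul_of_nonneg_left (h1.trans h2) (by positivity)
    _ = _ := by ring

open Classical in
/-- The coarse faces that can contain the fine face `f`. -/
def parentFaces (Dc : Level d Ω) (par : Cell d → Cell d) (f : Face d) : Finset (Face d) :=
  (faces Dc.shape Ω Dc.mesh).filter fun F => ∀ T ∈ f.cells, par T ∈ F.cells

theorem IsNested.faceTerm_le_of_subset (h : IsNested Dc Df par) (hd : 0 < d)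
    {c : ℝ} (hcmp : IsComparable Dc Df κ₂ c) (h₂ : 1 ≤ κ₂) (hPc : Dc.IsMesh)
    {f : Face d} (hf : f ∈ faces Df.shape Ω Df.mesh) (v : Dc.V) {S : Finset (Face d)}
    (hS : S ⊆ parentFaces Dc par f) (hsub : f.carrier ≤ᵐ[surface d] ⋃ F ∈ S, F.carrier)
    (hjump : ∀ F ∈ S, ∀ x, ‖Df.jump (Submodule.inclusion h.V_le v) f x‖ = ‖Dc.jump v F x‖) :
    faceTerm (Submodule.inclusion h.V_le v) f ≤
      2 * κ₂ * c ^ 2 * ∑ F ∈ parentFaces Dc par f, faceTerm v F := by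
  classical
  have hSf : ∀ F ∈ S, F ∈ faces Dc.shape Ω Dc.mesh := fun F hF =>
    (Finset.mem_filter.1 (hS hF)).1
  have hint : ∫ x in f.carrier, ‖Df.jump (Submodule.inclusion h.V_le v) f x‖ ^ 2 ∂(surface d) ≤
      ∑ F ∈ S, ∫ x in F.carrier, ‖Dc.jump v F x‖ ^ 2 ∂(surface d) := by
    refine (setIntegral_le_sum (fun x => sq_nonneg _) S
      (fun F hF => (isClosed_carrier (hSf F hF)).measurableSet)
      (fun F hF => integrableOn_carrier hPc (hSf F hF)
        ((continuous_jump _ _).norm.pow 2)) hsub).trans (le_of_eq ?_)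
    refine Finset.sum_congr rfl fun F hF => ?_
    simp only [hjump F hF]
  have hw : 0 ≤ (Df.degree : ℝ) ^ 2 / faceSize Df.shape f :=
    div_nonneg (sq_nonneg _) (faceSize_pos hd (cells_nonempty hf)).le
  calc faceTerm (Submodule.inclusion h.V_le v) f
      ≤ (Df.degree : ℝ) ^ 2 / faceSize Df.shape f *
          ∑ F ∈ S, ∫ x in F.carrier, ‖Dc.jump v F x‖ ^ 2 ∂(surface d) :=
        mul_le_mul_of_nonneg_left hint hw
    _ ≤ ∑ F ∈ S, 2 * κ₂ * c ^ 2 * faceTerm v F := by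
        rw [Finset.mul_sum]
        refine Finset.sum_le_sum fun F hF => ?_
        rw [faceTerm, ← mul_assoc]
        exact mul_le_mul_of_nonneg_right
          (h.weight_le hd hcmp hf (hSf F hF) (Finset.mem_filter.1 (hS hF)).2)
          (integral_nonneg fun _ => sq_nonneg _)
    _ ≤ ∑ F ∈ parentFaces Dc par f, 2 * κ₂ * c ^ 2 * faceTerm v F :=
        Finset.sum_le_sum_of_subset_of_nonneg hS fun F hF _ =>
          mul_nonneg (by positivity) (faceTerm_nonneg hd v (Finset.mem_filter.1 hF).1)
    _ = _ := by rw [Finset.mul_sum]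

/-- An interior fine face lies inside one coarse element or in the coarse face between two parents.
A boundary fine face is covered, up to a null set, by the boundary faces of its parent. -/
theorem IsNested.faceTerm_le (h : IsNested Dc Df par) (hd : 2 ≤ d)
    {c : ℝ} (hcmp : IsComparable Dc Df κ₂ c) (h₂ : 1 ≤ κ₂) (hPc : Dc.IsMesh) (hPf : Df.IsMesh)
    {f : Face d} (hf : f ∈ faces Df.shape Ω Df.mesh) (v : Dc.V) :
    faceTerm (Submodule.inclusion h.V_le v) f ≤
      2 * κ₂ * c ^ 2 * ∑ F ∈ parentFaces Dc par f, faceTerm v F := by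
  classical
  have hd0 : 0 < d := by omega
  have hpf : ∀ F ∈ parentFaces Dc par f, F ∈ faces Dc.shape Ω Dc.mesh := fun F hF =>
    (Finset.mem_filter.1 hF).1
  rcases mem_faces.1 hf with hi | hb
  · obtain ⟨T, hT, T', hT', hne, hfe, hpos⟩ := mem_interiorFaces.1 hi
    have hc : f.cells = {T, T'} := by rw [hfe]
    have hcar : f.carrier = closure (cell Dc.shape T) ∩ closure (cell Dc.shape T') := by
      rw [hfe, h.shape_eq]
    have hj : ∀ x, ‖Df.jump (Submodule.inclusion h.V_le v) f x‖ =
        |Dc.on v (par T) x - Dc.on v (par T') x| := by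
      intro x
      rw [norm_jump_interior hd hPf _ hi hc, h.on_inclusion hPc hPf v hT,
        h.on_inclusion hPc hPf v hT']
    by_cases hpar : par T = par T'
    -- Both traces are values of the same polynomial on the common parent, so the jump vanishes.
    · have h0 : faceTerm (Submodule.inclusion h.V_le v) f = 0 := by
        simp [faceTerm, hj, hpar]
      rw [h0]
      exact mul_nonneg (by positivity)
        (Finset.sum_nonneg fun F hF => faceTerm_nonneg hd0 v (hpf F hF))
    · set F : Face d := ⟨{par T, par T'},
        closure (cell Dc.shape (par T)) ∩ closure (cell Dc.shape (par T'))⟩ with hF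
      have hsub : f.carrier ⊆ F.carrier := by
        rw [hcar]
        exact Set.inter_subset_inter (closure_mono (h.subset T hT))
          (closure_mono (h.subset T' hT'))
      have hFi : F ∈ interiorFaces Dc.shape Dc.mesh :=
        mem_interiorFaces.2 ⟨par T, h.mem T hT, par T', h.mem T' hT', hpar, rfl,
          hpos.trans_le (measure_mono hsub)⟩
      refine h.faceTerm_le_of_subset hd0 hcmp h₂ hPc hf v (S := {F}) ?_ ?_ ?_
      · rw [Finset.singleton_subset_iff, parentFaces, Finset.mem_filter]
        refine ⟨mem_faces_of_interior hFi, fun S hS => ?_⟩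
        rw [hc] at hS
        simp only [Finset.mem_insert, Finset.mem_singleton] at hS
        rcases hS with rfl | rfl <;> simp [hF]
      · refine LE.le.eventuallyLE ?_
        rwa [Finset.set_biUnion_singleton]
      · intro F' hF' x
        rw [Finset.mem_singleton.1 hF', hj, norm_jump_interior hd hPc v hFi rfl]
  · obtain ⟨T, hT, G, hG, hfe, hpos⟩ := mem_boundaryFaces.1 hb
    have hc : f.cells = {T} := by rw [hfe]
    have hcar : f.carrier = T '' G ∩ frontier Ω := by rw [hfe]
    have hfcl := carrier_subset_closure hf (T := T) (by simp [hc])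
    rw [h.shape_eq] at hfcl
    set S := (boundaryFaces Dc.shape Ω Dc.mesh).filter fun F => F.cells = {par T} with hS
    have hSm : ∀ F ∈ S, F ∈ faces Dc.shape Ω Dc.mesh ∧ F.cells = {par T} := fun F hF =>
      ⟨mem_faces.2 (Or.inr (Finset.mem_filter.1 hF).1), (Finset.mem_filter.1 hF).2⟩
    refine h.faceTerm_le_of_subset hd0 hcmp h₂ hPc hf v (S := S) ?_ ?_ ?_
    · intro F hF
      rw [parentFaces, Finset.mem_filter]
      refine ⟨(hSm F hF).1, fun S hS => ?_⟩
      rw [hc, Finset.mem_singleton] at hS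
      rw [hS, (hSm F hF).2, Finset.mem_singleton]
    -- Facets of the parent that meet ∂Ω in a null set are not faces. Discarding these finitely many
    -- null sets leaves points of the frontier of the parent that lie on genuine coarse boundary
    -- faces.
    · have hnull : surface d (⋃ G' ∈ {G' ∈ refFacets d Dc.shape |
          surface d (par T '' G' ∩ frontier Ω) = 0}, par T '' G' ∩ frontier Ω) = 0 :=
        (measure_biUnion_null_iff
          ((refFacets_finite d Dc.shape).subset (fun _ h => h.1)).countable).2 fun G' hG' => hG'.2
      filter_upwards [measure_eq_zero_iff_ae_notMem.1 hnull] with x hx hxf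
      have hxcl : x ∈ closure (cell Dc.shape (par T)) := closure_mono (h.subset T hT) (hfcl hxf)
      have hxf' : x ∈ f.carrier := hxf
      rw [hcar] at hxf'
      have hxΩ : x ∉ Ω := by
        have := hxf'.2
        rw [hPc.isOpen.frontier_eq] at this
        exact this.2
      have hxfr : x ∈ frontier (cell Dc.shape (par T)) := by
        rw [(isOpen_cell _ _).frontier_eq]
        exact ⟨hxcl, fun hmem => hxΩ (hPc.cell_subset (h.mem T hT) hmem)⟩
      obtain ⟨G', hG', hxG'⟩ := Set.mem_iUnion₂.1 (frontier_cell_subset _ _ hxfr)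
      have hne : surface d (par T '' G' ∩ frontier Ω) ≠ 0 := fun h0 =>
        hx (Set.mem_iUnion₂.2 ⟨G', ⟨hG', h0⟩, hxG', hxf'.2⟩)
      refine Set.mem_iUnion₂.2 ⟨⟨{par T}, par T '' G' ∩ frontier Ω⟩, ?_, hxG', hxf'.2⟩
      exact Finset.mem_filter.2 ⟨mem_boundaryFaces.2
        ⟨par T, h.mem T hT, G', hG', rfl, pos_iff_ne_zero.2 hne⟩, rfl⟩
    · intro F hF x
      rw [norm_jump_boundary hPf _ hf hc, h.on_inclusion hPc hPf v hT,
        norm_jump_boundary hPc v (hSm F hF).1 (hSm F hF).2]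

open Classical in
-- A fine face attached to F touches a child of one of the at most two elements at F. Children per
-- element and faces per child are both bounded.
theorem IsNested.card_fine_faces_le (h : IsNested Dc Df par) (hd : 0 < d) (h₁ : 1 ≤ κ₁)
    (h₂ : 1 ≤ κ₂) {c : ℝ} (hcmp : IsComparable Dc Df κ₂ c) (hDf : Df.IsRegular κ₁ κ₂ B)
    {F : Face d} (hF : F ∈ faces Dc.shape Ω Dc.mesh) :
    (((faces Df.shape Ω Df.mesh).filter fun f => F ∈ parentFaces Dc par f).card : ℝ) ≤
      2 * neighbourBound d κ₁ κ₂ * faceBound d Df.shape κ₁ κ₂ := by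
  set A := F.cells.biUnion fun T => Df.mesh.filter fun T' => par T' = T with hA
  have hAcard : (A.card : ℝ) ≤ 2 * neighbourBound d κ₁ κ₂ := by
    calc (A.card : ℝ) ≤ ∑ T ∈ F.cells, ((Df.mesh.filter fun T' => par T' = T).card : ℝ) := by
          exact_mod_cast Finset.card_biUnion_le
      _ ≤ ∑ T ∈ F.cells, neighbourBound d κ₁ κ₂ := Finset.sum_le_sum fun T hT =>
          h.card_children_le hd h₁ h₂ hcmp hDf (mem_mesh_of_mem_cells hF hT)
      _ = F.cells.card * neighbourBound d κ₁ κ₂ := by rw [Finset.sum_const, nsmul_eq_mul]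
      _ ≤ _ := mul_le_mul_of_nonneg_right (card_cells_le_two hF)
          (by unfold neighbourBound; positivity)
  have hsub : ((faces Df.shape Ω Df.mesh).filter fun f => F ∈ parentFaces Dc par f) ⊆
      A.biUnion fun T' => (faces Df.shape Ω Df.mesh).filter fun f => T' ∈ f.cells := by
    intro f hf
    obtain ⟨hf, hFf⟩ := Finset.mem_filter.1 hf
    obtain ⟨T', hT'⟩ := cells_nonempty hf
    refine Finset.mem_biUnion.2 ⟨T', Finset.mem_biUnion.2 ⟨par T', ?_, ?_⟩,
      Finset.mem_filter.2 ⟨hf, hT'⟩⟩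
    · exact (Finset.mem_filter.1 hFf).2 T' hT'
    · exact Finset.mem_filter.2 ⟨mem_mesh_of_mem_cells hf hT', rfl⟩
  calc _ ≤ ((A.biUnion fun T' =>
          (faces Df.shape Ω Df.mesh).filter fun f => T' ∈ f.cells).card : ℝ) := by
        exact_mod_cast Finset.card_le_card hsub
    _ ≤ ∑ T' ∈ A, (((faces Df.shape Ω Df.mesh).filter fun f => T' ∈ f.cells).card : ℝ) := by
        exact_mod_cast Finset.card_biUnion_le
    _ ≤ ∑ T' ∈ A, faceBound d Df.shape κ₁ κ₂ := by
        refine Finset.sum_le_sum fun T' hT' => ?_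
        obtain ⟨T, _, hT'2⟩ := Finset.mem_biUnion.1 hT'
        exact card_faces_le hd hDf.isMesh hDf.shapeRegular hDf.quasiUniform h₁ h₂
          (Finset.mem_filter.1 hT'2).1
    _ = A.card * faceBound d Df.shape κ₁ κ₂ := by rw [Finset.sum_const, nsmul_eq_mul]
    _ ≤ _ := mul_le_mul_of_nonneg_right hAcard (faceBound_pos h₁ h₂).le

theorem IsNested.jumpSum_le (h : IsNested Dc Df par) (hd : 2 ≤ d) (h₁ : 1 ≤ κ₁)
    (h₂ : 1 ≤ κ₂) {c : ℝ} (hcmp : IsComparable Dc Df κ₂ c) (hPc : Dc.IsMesh)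
    (hDf : Df.IsRegular κ₁ κ₂ B) (v : Dc.V) :
    jumpSum (Submodule.inclusion h.V_le v) ≤
      2 * κ₂ * c ^ 2 * (2 * neighbourBound d κ₁ κ₂ * faceBound d Df.shape κ₁ κ₂) * jumpSum v := by
  classical
  have hd0 : 0 < d := by omega
  calc jumpSum (Submodule.inclusion h.V_le v)
      = ∑ f ∈ faces Df.shape Ω Df.mesh, faceTerm (Submodule.inclusion h.V_le v) f := rfl
    _ ≤ ∑ f ∈ faces Df.shape Ω Df.mesh,
          2 * κ₂ * c ^ 2 * ∑ F ∈ parentFaces Dc par f, faceTerm v F :=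
        Finset.sum_le_sum fun f hf => h.faceTerm_le hd hcmp h₂ hPc hDf.isMesh hf v
    _ = 2 * κ₂ * c ^ 2 * ∑ F ∈ faces Dc.shape Ω Dc.mesh,
          (((faces Df.shape Ω Df.mesh).filter fun f => F ∈ parentFaces Dc par f).card : ℝ) *
            faceTerm v F := by
        rw [← Finset.mul_sum]
        congr 1
        have e : ∀ f ∈ faces Df.shape Ω Df.mesh, ∑ F ∈ parentFaces Dc par f, faceTerm v F =
            ∑ F ∈ faces Dc.shape Ω Dc.mesh,
              if F ∈ parentFaces Dc par f then faceTerm v F else 0 := by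
          intro f _
          rw [← Finset.sum_filter]
          refine Finset.sum_congr ?_ fun _ _ => rfl
          ext F
          rw [Finset.mem_filter]
          exact ⟨fun hF => ⟨(Finset.mem_filter.1 hF).1, hF⟩, fun hF => hF.2⟩
        rw [Finset.sum_congr rfl e, Finset.sum_comm]
        refine Finset.sum_congr rfl fun F _ => ?_
        rw [← Finset.sum_filter, Finset.sum_const, nsmul_eq_mul]
    _ ≤ 2 * κ₂ * c ^ 2 * ∑ F ∈ faces Dc.shape Ω Dc.mesh,
          2 * neighbourBound d κ₁ κ₂ * faceBound d Df.shape κ₁ κ₂ * faceTerm v F := by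
        refine mul_le_mul_of_nonneg_left (Finset.sum_le_sum fun F hF => ?_) (by positivity)
        exact mul_le_mul_of_nonneg_right (h.card_fine_faces_le hd0 h₁ h₂ hcmp hDf hF)
          (faceTerm_nonneg hd0 v hF)
    _ = _ := by
        rw [← Finset.mul_sum, ← mul_assoc]
        rfl

end Level

/-! ### Adjoints with respect to a pair of forms -/

section Adjoint

variable {V W : Type*} [AddCommGroup V] [Module ℝ V] [AddCommGroup W] [Module ℝ W]

/-- Positive definiteness makes b injective as a map from W to its dual, hence bijective by
dimension. -/
theorem existsUnique_adjoint [FiniteDimensional ℝ W] (a : V →ₗ[ℝ] V →ₗ[ℝ] ℝ)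
    (b : W →ₗ[ℝ] W →ₗ[ℝ] ℝ) (hb : ∀ w, w ≠ 0 → 0 < b w w) (R : W →ₗ[ℝ] V) :
    ∃! P : V →ₗ[ℝ] W, ∀ v w, b (P v) w = a v (R w) := by
  have hinj : Function.Injective b := by
    rw [← LinearMap.ker_eq_bot, LinearMap.ker_eq_bot']
    intro w hw
    by_contra hne
    have := hb w hne
    rw [hw, LinearMap.zero_apply] at this
    exact this.false
  let e : W ≃ₗ[ℝ] (W →ₗ[ℝ] ℝ) :=
    LinearMap.linearEquivOfInjective b hinj Subspace.dual_finrank_eq.symm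
  have he : ∀ f, b (e.symm f) = f := fun f => e.apply_symm_apply f
  refine ⟨e.symm.toLinearMap ∘ₗ R.dualMap ∘ₗ a, fun v w => ?_, fun P hP => ?_⟩
  · simp only [LinearMap.comp_apply, LinearEquiv.coe_coe]
    rw [he]
    rfl
  · ext v
    apply hinj
    ext w
    simp only [LinearMap.comp_apply, LinearEquiv.coe_coe]
    rw [hP, he]
    rfl

/-- Duality: b(Pv, Pv) = a(v, R P v), to which Cauchy–Schwarz for a and the bound for R are applied.
One factor of the norm of Pv is then divided out. -/
theorem sqrt_adjoint_le (a : V →ₗ[ℝ] V →ₗ[ℝ] ℝ) (b : W →ₗ[ℝ] W →ₗ[ℝ] ℝ)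
    (ha : ∀ v, 0 ≤ a v v) (hs : ∀ v v', a v v' = a v' v) {R : W →ₗ[ℝ] V} {C : ℝ}
    (hR : ∀ w, √(a (R w) (R w)) ≤ C * √(b w w)) (hb : ∀ w, 0 ≤ b w w)
    {P : V →ₗ[ℝ] W} (hP : ∀ v w, b (P v) w = a v (R w)) (hC : 0 ≤ C) (v : V) :
    √(b (P v) (P v)) ≤ C * √(a v v) := by
  have hcs : a v (R (P v)) ≤ √(a v v) * √(a (R (P v)) (R (P v))) := by
    rw [← Real.sqrt_mul (ha v)]
    refine Real.le_sqrt_of_sq_le ?_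
    have := LinearMap.BilinForm.apply_mul_apply_le_of_forall_zero_le a ha v (R (P v))
    rwa [hs (R (P v)) v, ← sq] at this
  have h1 : √(b (P v) (P v)) * √(b (P v) (P v)) ≤ C * √(a v v) * √(b (P v) (P v)) := by
    calc √(b (P v) (P v)) * √(b (P v) (P v)) = a v (R (P v)) := by
          rw [Real.mul_self_sqrt (hb _), hP]
      _ ≤ √(a v v) * (C * √(b (P v) (P v))) :=
          hcs.trans (mul_le_mul_of_nonneg_left (hR _) (Real.sqrt_nonneg _))
      _ = C * √(a v v) * √(b (P v) (P v)) := by ring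
  rcases (Real.sqrt_nonneg (b (P v) (P v))).eq_or_lt with h | h
  · rw [← h]; positivity
  · exact le_of_mul_le_mul_right h1 h

end Adjoint

/-! ### Stability of the transfer between two levels -/

namespace Level

variable {d : ℕ} {Ω : Set (E d)} {Dc Df : Level d Ω} {par : Cell d → Cell d} {κ₁ κ₂ B : ℝ}

/-- The factor by which the square of the DG norm can grow under the inclusion of a coarse space
into the fine one. -/
def transferConst (d : ℕ) (s : Shape) (κ₁ κ₂ αmin αmax c : ℝ) : ℝ :=
  neighbourBound d κ₁ κ₂ +
    |αmax| / αmin * (2 * κ₂ * c ^ 2 * (2 * neighbourBound d κ₁ κ₂ * faceBound d s κ₁ κ₂))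

theorem transferConst_pos {s : Shape} (h₁ : 1 ≤ κ₁) (h₂ : 1 ≤ κ₂) {αmin αmax c : ℝ}
    (hα : 0 < αmin) : 0 < transferConst d s κ₁ κ₂ αmin αmax c := by
  have := faceBound_pos (d := d) (s := s) h₁ h₂
  unfold transferConst neighbourBound
  positivity

theorem IsNested.dgNormSq_le (h : IsNested Dc Df par) (hd : 2 ≤ d) (h₁ : 1 ≤ κ₁)
    (h₂ : 1 ≤ κ₂) {αmin αmax c : ℝ} (hcmp : IsComparable Dc Df κ₂ c) (hPc : Dc.IsMesh)
    (hDf : Df.IsRegular κ₁ κ₂ B) (hα : 0 < αmin) (hαc : αmin ≤ Dc.α) (hαf : Df.α ≤ αmax)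
    (v : Dc.V) :
    dgNormSq (Submodule.inclusion h.V_le v) ≤
      transferConst d Df.shape κ₁ κ₂ αmin αmax c * dgNormSq v := by
  have hd0 : 0 < d := by omega
  have hG := h.volForm_grad_le hd0 h₁ h₂ hcmp hPc hDf v
  have hJ := h.jumpSum_le hd h₁ h₂ hcmp hPc hDf v
  have hG0 := volForm_self_nonneg (D := Dc) (grad v)
  have hJ0 := jumpSum_nonneg hd0 v
  have hJf0 := jumpSum_nonneg hd0 (Submodule.inclusion h.V_le v)
  have hF := faceBound_pos (d := d) (s := Df.shape) h₁ h₂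
  have hN : 0 < neighbourBound d κ₁ κ₂ := by unfold neighbourBound; positivity
  rw [dgNormSq, dgNormSq, jumpForm_self, jumpForm_self, transferConst]
  set Q := 2 * κ₂ * c ^ 2 * (2 * neighbourBound d κ₁ κ₂ * faceBound d Df.shape κ₁ κ₂)
  have hQ : 0 ≤ Q := by positivity
  have e1 : Df.α * jumpSum (Submodule.inclusion h.V_le v) ≤
      |αmax| / αmin * Q * (Dc.α * jumpSum v) := by
    -- The absolute value of αmax keeps the constant positive for every real αmax. The quotient by
    -- αmin converts the fine penalty into the coarse one.
    calc Df.α * jumpSum (Submodule.inclusion h.V_le v)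
        ≤ |αmax| * jumpSum (Submodule.inclusion h.V_le v) :=
          mul_le_mul_of_nonneg_right (hαf.trans (le_abs_self _)) hJf0
      _ ≤ |αmax| * (Q * jumpSum v) := mul_le_mul_of_nonneg_left hJ (abs_nonneg _)
      _ = |αmax| / αmin * Q * (αmin * jumpSum v) := by field_simp
      _ ≤ _ := mul_le_mul_of_nonneg_left (mul_le_mul_of_nonneg_right hαc hJ0) (by positivity)
  have hαJ : 0 ≤ Dc.α * jumpSum v := mul_nonneg (hα.le.trans hαc) hJ0
  have e2 : 0 ≤ |αmax| / αmin * Q * Dc.volForm (grad v) (grad v) := by positivity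
  have e3 : 0 ≤ neighbourBound d κ₁ κ₂ * (Dc.α * jumpSum v) := by positivity
  linarith

/-- The stability constant. -/
def stabConst (d : ℕ) (s : Shape) (κ₁ κ₂ B αmin αmax c : ℝ) : ℝ :=
  √((2 + 2 * (liftConst d s κ₁ κ₂ B / αmin)) * transferConst d s κ₁ κ₂ αmin αmax c /
    coercConst (liftConst d s κ₁ κ₂ B) αmin)

theorem stabConst_pos {s : Shape} (h₁ : 1 ≤ κ₁) (h₂ : 1 ≤ κ₂) (hB : 0 ≤ B) {αmin αmax c : ℝ}
    (hα : 0 < αmin) : 0 < stabConst d s κ₁ κ₂ B αmin αmax c := by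
  have hL := liftConst_pos (d := d) (s := s) h₁ h₂ hB
  have hT := transferConst_pos (d := d) (s := s) (αmax := αmax) (c := c) h₁ h₂ hα
  have hC := coercConst_pos hL hα
  exact Real.sqrt_pos.2 (by positivity)

/-- The three factors of the constant are met in turn: continuity of the fine form, transfer of the
DG norm, and coercivity of the coarse form. -/
theorem IsNested.energyNorm_inclusion_le (h : IsNested Dc Df par) (hd : 2 ≤ d) (h₁ : 1 ≤ κ₁)
    (h₂ : 1 ≤ κ₂) (hB : 0 ≤ B) {αmin αmax c : ℝ} (hcmp : IsComparable Dc Df κ₂ c)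
    (hDc : Dc.IsRegular κ₁ κ₂ B) (hDf : Df.IsRegular κ₁ κ₂ B) (hα : 0 < αmin)
    (hαc : αmin ≤ Dc.α) (hαf : αmin ≤ Df.α) (hαf' : Df.α ≤ αmax)
    (hθ : Dc.θ = 0 ∧ 4 * liftConst d Dc.shape κ₁ κ₂ B ≤ αmin ∨ Dc.θ = 1) (hθf : Df.θ ≤ 1)
    (v : Dc.V) :
    Df.energyNorm (Submodule.inclusion h.V_le v) ≤
      stabConst d Dc.shape κ₁ κ₂ B αmin αmax c * Dc.energyNorm v := by
  have hd0 : 0 < d := by omega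
  have hL := liftConst_pos (d := d) (s := Dc.shape) h₁ h₂ hB
  have hT := transferConst_pos (d := d) (s := Dc.shape) (αmax := αmax) (c := c) h₁ h₂ hα
  have hC := coercConst_pos hL hα
  have e1 := form_le hd0 h₁ h₂ hB hDf hα hαf hθf (Submodule.inclusion h.V_le v)
  have e2 := h.dgNormSq_le hd h₁ h₂ hcmp hDc.isMesh hDf hα hαc hαf' v
  have e3 := le_form hd0 h₁ h₂ hB hDc hα hαc hθ v
  rw [h.shape_eq] at e1 e2
  rw [energyNorm, energyNorm, stabConst, ← Real.sqrt_mul (by positivity)]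
  refine Real.sqrt_le_sqrt (e1.trans ?_)
  rw [div_mul_eq_mul_div, le_div_iff₀ hC, mul_assoc, mul_assoc]
  refine mul_le_mul_of_nonneg_left ?_ (by positivity)
  calc dgNormSq (Submodule.inclusion h.V_le v) * coercConst (liftConst d Dc.shape κ₁ κ₂ B) αmin
      ≤ transferConst d Dc.shape κ₁ κ₂ αmin αmax c * dgNormSq v *
          coercConst (liftConst d Dc.shape κ₁ κ₂ B) αmin := mul_le_mul_of_nonneg_right e2 hC.le
    _ = transferConst d Dc.shape κ₁ κ₂ αmin αmax c *
          (coercConst (liftConst d Dc.shape κ₁ κ₂ B) αmin * dgNormSq v) := by ring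
    _ ≤ _ := mul_le_mul_of_nonneg_left e3 hT.le

end Level

/-! ### The hierarchy of meshes -/

section Hierarchy

variable {d : ℕ} {s : Shape} {𝒯 : Finset (Cell d)} {κ κ' : ℝ}

theorem IsShapeRegular.mono (h : IsShapeRegular s κ 𝒯) (hκ : κ ≤ κ') :
    IsShapeRegular s κ' 𝒯 := fun T hT => by
  obtain ⟨x, r, hr, hb, hle⟩ := h T hT
  exact ⟨x, r, hr, hb, hle.trans (mul_le_mul_of_nonneg_right hκ hr.le)⟩

theorem IsQuasiUniform.mono (h : IsQuasiUniform s κ 𝒯) (hκ : κ ≤ κ') :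
    IsQuasiUniform s κ' 𝒯 := fun T hT T' hT' =>
  (h T hT T' hT').trans (mul_le_mul_of_nonneg_right hκ Metric.diam_nonneg)

/-- Descending induction from the finest level K, with no loss in the constants. -/
theorem regular_of_refinements {K : ℕ} (hd : d = 2 ∨ d = 3) {𝒯 : ℕ → Finset (Cell d)} {κ₁ κ₂ : ℝ}
    (href : ∀ k, 2 ≤ k → k ≤ K → IsRefinement s (𝒯 (k - 1)) (𝒯 k))
    (hreg : IsShapeRegular s κ₁ (𝒯 K)) (hqu : IsQuasiUniform s κ₂ (𝒯 K)) {k : ℕ} (hk : 1 ≤ k)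
    (hkK : k ≤ K) : IsShapeRegular s κ₁ (𝒯 k) ∧ IsQuasiUniform s κ₂ (𝒯 k) := by
  induction hkK using Nat.decreasingInduction with
  | self => exact ⟨hreg, hqu⟩
  | of_succ j hj ih =>
    have hr := href (j + 1) (by omega) hj
    rw [Nat.add_sub_cancel] at hr
    obtain ⟨h1, h2⟩ := ih (by omega)
    exact ⟨hr.isShapeRegular hd h1, hr.isQuasiUniform hd h2⟩

theorem Method.IsBeta.norm_le {m : Method} {B : ℝ} {β : Face d → E d} {Ω : Set (E d)}
    (hβ : m.IsBeta B s 𝒯 β) (hP : IsPartition s Ω 𝒯) {f : Face d} (hf : f ∈ interiorFaces s 𝒯) :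
    ‖β f‖ ≤ |B| + 1 := by
  have hB := abs_nonneg B
  cases m with
  | sipg => rw [hβ f hf, norm_zero]; positivity
  | sipgDelta =>
    obtain ⟨T, hT, δ, h0, h1, he⟩ := hβ f hf
    rw [he, norm_smul, (isFacet_normal hP (mem_faces.2 (Or.inl hf)) hT).norm, mul_one,
      Real.norm_eq_abs]
    have : |δ - 1 / 2| ≤ 1 := abs_le.2 ⟨by linarith, by linarith⟩
    linarith
  | ldg => linarith [hβ f hf, le_abs_self B]

end Hierarchy

end HPDG

end

/-! ### The stability lemma -/

open HPDG in
theorem lemma4p4 (d : ℕ) (hd : d = 2 ∨ d = 3) (s : Shape) (m : Method) (κ₁ κ₂ : ℝ) (B : ℝ) :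
    ∃ α₀ : ℝ, 0 < α₀ ∧ ∀ αmin αmax c : ℝ, 0 < αmin → (m ≠ Method.ldg → α₀ ≤ αmin) →
      ∃ Cstab : ℝ, 0 < Cstab ∧
        ∀ (Ω : Set (E d)) (K : ℕ) (𝒯 : ℕ → Finset (Cell d)) (p : ℕ → ℕ) (α : ℕ → ℝ)
          (β : ℕ → Face d → E d) (D : ℕ → Level d Ω),
          (∀ k, D k = ⟨s, 𝒯 k, p k, α k, m.θ, β k⟩) →
          (∀ k, 1 ≤ k → k ≤ K → IsPartition s Ω (𝒯 k)) →
          (∀ k, 2 ≤ k → k ≤ K → IsRefinement s (𝒯 (k - 1)) (𝒯 k)) →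
          IsShapeRegular s κ₁ (𝒯 K) →
          IsQuasiUniform s κ₂ (𝒯 K) →
          (∀ k, 1 ≤ k → k ≤ K → 1 ≤ p k) →
          (∀ k, 2 ≤ k → k ≤ K → p (k - 1) ≤ p k ∧ (p k : ℝ) ≤ c * p (k - 1)) →
          (∀ k, 1 ≤ k → k ≤ K → αmin ≤ α k ∧ α k ≤ αmax) →
          (∀ k, 1 ≤ k → k ≤ K → m.IsBeta B s (𝒯 k) (β k)) →
          (∀ k, 1 ≤ k → k ≤ K → ∀ v : (D k).V, v ≠ 0 → 0 < (D k).form v v) ∧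
          ∀ k, 2 ≤ k → k ≤ K →
            ∃ hV : (D (k - 1)).V ≤ (D k).V,
              (∀ v : (D (k - 1)).V,
                (D k).energyNorm (Submodule.inclusion hV v) ≤
                  Cstab * (D (k - 1)).energyNorm v) ∧
              (∃! P : (D k).V →ₗ[ℝ] (D (k - 1)).V,
                ∀ (v : (D k).V) (w : (D (k - 1)).V),
                  (D (k - 1)).form (P v) w = (D k).form v (Submodule.inclusion hV w)) ∧
              ∀ P : (D k).V →ₗ[ℝ] (D (k - 1)).V,
                (∀ (v : (D k).V) (w : (D (k - 1)).V),
                  (D (k - 1)).form (P v) w = (D k).form v (Submodule.inclusion hV w)) →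
                ∀ v : (D k).V,
                  (D (k - 1)).energyNorm (P v) ≤ Cstab * (D k).energyNorm v := by
  have hd2 : 2 ≤ d := by omega
  -- The constants are enlarged to values for which the estimates above apply. The bound |B| + 1 for
  -- β serves all three methods, as |δ - 1/2| ≤ 1.
  have h₁ : 1 ≤ max κ₁ 1 := le_max_right _ _
  have h₂ : 1 ≤ max κ₂ 1 := le_max_right _ _
  have hB : 0 ≤ |B| + 1 := by positivity
  -- Four times the lifting constant is the threshold in the coercivity proof for θ = 0.
  refine ⟨4 * liftConst d s (max κ₁ 1) (max κ₂ 1) (|B| + 1),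
    mul_pos (by norm_num) (liftConst_pos h₁ h₂ hB), fun αmin αmax c hα hα₀ =>
    ⟨Level.stabConst d s (max κ₁ 1) (max κ₂ 1) (|B| + 1) αmin αmax c,
      Level.stabConst_pos h₁ h₂ hB hα, ?_⟩⟩
  intro Ω K 𝒯 p α β D hD hpart href hreg hqu hp hpp hαk hβ
  obtain rfl : D = fun k => ⟨s, 𝒯 k, p k, α k, m.θ, β k⟩ := funext hD
  have hθ : m.θ = 0 ∧ 4 * liftConst d s (max κ₁ 1) (max κ₂ 1) (|B| + 1) ≤ αmin ∨
      m.θ = 1 := by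
    cases m
    · exact Or.inl ⟨rfl, hα₀ (by simp)⟩
    · exact Or.inl ⟨rfl, hα₀ (by simp)⟩
    · exact Or.inr rfl
  have hθ1 : m.θ ≤ 1 := by rcases hθ with h | h <;> simp [h]
  have hR : ∀ k, 1 ≤ k → k ≤ K →
      (⟨s, 𝒯 k, p k, α k, m.θ, β k⟩ : Level d Ω).IsRegular (max κ₁ 1) (max κ₂ 1) (|B| + 1) := by
    intro k hk hkK
    obtain ⟨hs, hq⟩ := regular_of_refinements hd href hreg hqu hk hkK
    exact ⟨hpart k hk hkK, hs.mono (le_max_left _ _), hq.mono (le_max_left _ _), hp k hk hkK,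
      fun f hf => (hβ k hk hkK).norm_le (hpart k hk hkK) hf⟩
  refine ⟨fun k hk hkK v hv => Level.form_pos hd2 h₁ h₂ hB (hR k hk hkK) hα (hαk k hk hkK).1 hθ hv,
    fun k hk hkK => ?_⟩
  have hc1 : 1 ≤ k - 1 := by omega
  have hcK : k - 1 ≤ K := by omega
  have hRc := hR (k - 1) hc1 hcK
  have hRf := hR k (by omega) hkK
  have hαc := hαk (k - 1) hc1 hcK
  have hαf := hαk k (by omega) hkK
  obtain ⟨par, hnest⟩ := Level.exists_isNested hd
    (Dc := ⟨s, 𝒯 (k - 1), p (k - 1), α (k - 1), m.θ, β (k - 1)⟩)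
    (Df := ⟨s, 𝒯 k, p k, α k, m.θ, β k⟩) rfl (href k hk hkK) (hpp k hk hkK).1
  have hcmp : Level.IsComparable (⟨s, 𝒯 (k - 1), p (k - 1), α (k - 1), m.θ, β (k - 1)⟩ : Level d Ω)
      ⟨s, 𝒯 k, p k, α k, m.θ, β k⟩ (max κ₂ 1) c :=
    ⟨fun T hT T' hT' => (href k hk hkK).diam_le hd hRf.quasiUniform hT hT', (hpp k hk hkK).2⟩
  have hincl := hnest.energyNorm_inclusion_le hd2 h₁ h₂ hB hcmp hRc hRf hα hαc.1 hαf.1 hαf.2 hθ hθ1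
  have hposc := fun v hv =>
    Level.form_pos hd2 h₁ h₂ hB hRc hα hαc.1 hθ (v := v) hv
  have hnnc := Level.form_self_nonneg hd2 h₁ h₂ hB hRc hα hαc.1 hθ
  have hnnf := Level.form_self_nonneg hd2 h₁ h₂ hB hRf hα hαf.1 hθ
  have hfin := Level.finiteDimensional_V hRc.isMesh
  exact ⟨hnest.V_le, hincl,
    existsUnique_adjoint (Level.bilin hRf.isMesh) (Level.bilin hRc.isMesh) hposc _,
    fun P hP => sqrt_adjoint_le (Level.bilin hRf.isMesh) (Level.bilin hRc.isMesh) hnnf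
      (Level.form_comm hRf.isMesh) hincl hnnc hP (Level.stabConst_pos h₁ h₂ hB hα).le⟩
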